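/- **Setting.** Let $A\in\mathbb R^{d_x\times d_x}$, $B\in\mathbb R^{d_x\times d_u}$, $d=\max(d_x,d_u)$, and consider the system $x_{t+1}=Ax_t+Bu_t+w_t$, $x_1=0$, where $w_1,w_2,\dots$ are i.i.d. with a law $\mathcal D_w$ such that $\mathbb E[w_t]=0$, $\|w_t\|\le W$ almost surely and $\mathbb E[w_tw_t^\top]\succeq\sigma^2I$ with $\sigma>0$; put $w_s=0$ for $s<1$. Matrix norms are spectral norms. Let $\kappa\ge1$, $0<\gamma<1$. A matrix $K\in\mathbb R^{d_u\times d_x}$ is *$(\kappa,\gamma)$-diagonal strongly stable* if $A-BK=QLQ^{-1}$ for a complex diagonal matrix $L$ and an invertible complex matrix $Q$ with $\|L\|\le1-\gamma$ and $\|K\|,\|Q\|,\|Q^{-1}\|\le\kappa$. Let $\mathcal K$ be the set of these $K$, let $\mathbb K\in\mathcal K$ be fixed, and let $\kappa_B$ satisfy $\|B\|\le\kappa_B$ and $\kappa_B(1-\gamma)\ge2$. For a horizon $T\ge2$ put $H=\lceil\gamma^{-1}\log(T\kappa^2)\rceil$ and $$\mathcal M=\{M=(M^{[0]},\dots,M^{[H-1]}):\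 M^{[i-1]}\in\mathbb R^{d_u\times d_x},\ \|M^{[i-1]}\|\le\kappa^3\kappa_B(1-\gamma)^i,\ 1\le i\le H\}.$$ **Costs.** $c_t(x,u)=r_t(\|x\|^2+\|u\|^2)$, where $(r_t)$ is any sequence of numbers in $[\alpha,\beta]$, $\alpha>0$. For a control rule $\mathcal A$, $J_T(\mathcal A)=\mathbb E\sum_{t=1}^Tc_t(x_t,u_t)$; $J_T(K)$ is the cost of $u_t=-Kx_t$. **Algorithm (online natural gradient).** With $\tilde A=A-B\mathbb K$, i.i.d. $n_0,\dots,n_{2H}\sim\mathcal D_w$ and $$\Psi_i(M)=\tilde A^i\mathbf 1_{i\le H}+\sum_{j=0}^H\tilde A^jBM^{[i-j-1]}\mathbf 1_{1\le i-j\le H},$$ let $y(M)=\sum_{i=0}^{2H}\Psi_i(M)n_i$, $v(M)=-\mathbb Ky(M)+\sum_{i=1}^HM^{[i-1]}n_{i-1}$ and $f_t(M)=\mathbb E[c_t(y(M),v(M))]$. Let $J$ be the (random) Jacobian of the affine map $M_{\rm vec}\mapsto(y(M),v(M))$, where $M_{\rm vec}$ is the vector of all entries of $M$, and $P=\mathbb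 E[J^\top J]$. Starting from an arbitrary $M_1\in\mathcal M$, the algorithm plays $u_t=-\mathbb Kx_t+\sum_{i=1}^HM_t^{[i-1]}w_{t-i}$ and updates $$M_{t+1}=\Pi_{\mathcal M}\bigl(M_t-\eta_tP^{-1}\nabla f_t(M_t)\bigr),$$ where $\Pi_{\mathcal M}$ is the projection onto $\mathcal M$ in the norm $\|V\|_P=(V^\top PV)^{1/2}$, and the step sizes satisfy $\frac1{\alpha t}\le\eta_t\le\frac c{\alpha t}$ for a constant $c\ge1$. **Claim.** For every $c\ge1$ there are constants $C,p$, depending only on $c$, such that in every such setting $\min_{K\in\mathcal K}J_T(K)$ is attained and $$J_T(\mathcal A)-\min_{K\in\mathcal K}J_T(K)\ \le\ C\,\bigl(d\,\kappa\,\kappa_B\,\gamma^{-1}\bigr)^p\;\frac{\beta^2W^2}{\alpha}\;\log^7T .$$ In particular the bound does not depend on $\sigma$. -/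

import Mathlib

open MeasureTheory ProbabilityTheory
open scoped Matrix Matrix.Norms.L2Operator Gradient

noncomputable section

namespace OnlineControl

/-- Euclidean space `ℝⁿ`. -/
abbrev Vec (n : ℕ) := EuclideanSpace ℝ (Fin n)

/-- The matrix `A` applied to a vector of Euclidean space. -/
def app {m n : ℕ} (A : Matrix (Fin m) (Fin n) ℝ) (x : Vec n) : Vec m :=
  Matrix.toEuclideanLin A x

/-! ### The linear dynamical system and linear controllers -/

/-- `K` is `(κ, γ)`-diagonal strongly stable for `(A, B)`. All matrix norms are spectral norms
(operator norms for the Euclidean norm). -/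
def DiagStronglyStable {dx du : ℕ} (A : Matrix (Fin dx) (Fin dx) ℝ)
    (B : Matrix (Fin dx) (Fin du) ℝ) (κ γ : ℝ) (K : Matrix (Fin du) (Fin dx) ℝ) : Prop :=
  ∃ (l : Fin dx → ℂ) (Q : Matrix (Fin dx) (Fin dx) ℂ), IsUnit Q.det ∧
    (A - B * K).map Complex.ofReal = Q * Matrix.diagonal l * Q⁻¹ ∧
    ‖Matrix.diagonal l‖ ≤ 1 - γ ∧ ‖K‖ ≤ κ ∧ ‖Q‖ ≤ κ ∧ ‖Q⁻¹‖ ≤ κ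

/-- The state `x_t` (`t ≥ 1`) of `x_{t+1} = A x_t + B u_t + w_t`, `x_1 = 0`, when the action at
time `t` in state `x` is `u_t = ctrl t x`. The value at `t = 0` is a placeholder. -/
def state {dx du : ℕ} (A : Matrix (Fin dx) (Fin dx) ℝ) (B : Matrix (Fin dx) (Fin du) ℝ)
    (ctrl : ℕ → Vec dx → Vec du) (w : ℕ → Vec dx) : ℕ → Vec dx
  | 0 => 0
  | 1 => 0
  | t + 2 => app A (state A B ctrl w (t + 1))
      + app B (ctrl (t + 1) (state A B ctrl w (t + 1))) + w (t + 1)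

/-- The expected total cost `E[∑_{t=1}^T c_t(x_t, u_t)]`. The controller may depend on the
realized noise sequence (its first argument). -/
def expectedCost {Ω : Type*} [MeasurableSpace Ω] (P : Measure Ω) {dx du : ℕ}
    (A : Matrix (Fin dx) (Fin dx) ℝ) (B : Matrix (Fin dx) (Fin du) ℝ)
    (w : ℕ → Ω → Vec dx) (c : ℕ → Vec dx → Vec du → ℝ) (T : ℕ)
    (ctrl : (ℕ → Vec dx) → ℕ → Vec dx → Vec du) : ℝ :=
  ∫ ω, ∑ t ∈ Finset.Icc 1 T,
    c t (state A B (ctrl fun s => w s ω) (fun s => w s ω) t)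
      (ctrl (fun s => w s ω) t (state A B (ctrl fun s => w s ω) (fun s => w s ω) t)) ∂P

/-- The linear controller `u_t = -K x_t`. -/
def linearCtrl {dx du : ℕ} (K : Matrix (Fin du) (Fin dx) ℝ) :
    (ℕ → Vec dx) → ℕ → Vec dx → Vec du :=
  fun _ _ x => -app K x

/-! ### Disturbance-action policies -/

/-- A policy `M = (M^{[0]}, …, M^{[H-1]})`, flattened to the vector `M_vec` of its entries, with
the Euclidean structure. The coordinate `(i, a, b)` is the entry `(a, b)` of `M^{[i]}`. -/
abbrev Policy (H dx du : ℕ) := EuclideanSpace ℝ (Fin H × Fin du × Fin dx)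

/-- The matrix `M^{[i]}`, extended by `0` to `i ≥ H`. -/
def block {H dx du : ℕ} (M : Policy H dx du) (i : ℕ) : Matrix (Fin du) (Fin dx) ℝ :=
  if h : i < H then Matrix.of fun a b => M (⟨i, h⟩, a, b) else 0

/-- The set `{M : ‖M^{[i-1]}‖ ≤ κ³ κ_B (1-γ)^i, i = 1, …, H}`. -/
def policySet (H dx du : ℕ) (κ κB γ : ℝ) : Set (Policy H dx du) :=
  {M | ∀ i ∈ Finset.Icc 1 H, ‖block M (i - 1)‖ ≤ κ ^ 3 * κB * (1 - γ) ^ i}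

/-- The controller `u_t = -K₀ x_t + ∑_{i=1}^H M_t^{[i-1]} w_{t-i}`, where `w_s = 0` for `s < 1`. -/
def policyCtrl {H dx du : ℕ} (K₀ : Matrix (Fin du) (Fin dx) ℝ) (M : ℕ → Policy H dx du) :
    (ℕ → Vec dx) → ℕ → Vec dx → Vec du :=
  fun w t x => -app K₀ x +
    ∑ i ∈ Finset.Icc 1 H, if i < t then app (block (M t) (i - 1)) (w (t - i)) else 0

/-! ### Surrogate state, action and cost -/

/-- The transfer matrix `Ψ_i(M) = Ã^i 1_{i ≤ H} + ∑_{j=0}^H Ã^j B M^{[i-j-1]} 1_{1 ≤ i-j ≤ H}`,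
`Ã = A - B K₀`, of a policy `M` that is used at all times. -/
def transfer {H dx du : ℕ} (A : Matrix (Fin dx) (Fin dx) ℝ) (B : Matrix (Fin dx) (Fin du) ℝ)
    (K₀ : Matrix (Fin du) (Fin dx) ℝ) (M : Policy H dx du) (i : ℕ) :
    Matrix (Fin dx) (Fin dx) ℝ :=
  (if i ≤ H then (A - B * K₀) ^ i else 0) +
    ∑ j ∈ Finset.range (H + 1),
      if j + 1 ≤ i ∧ i ≤ j + H then (A - B * K₀) ^ j * B * block M (i - j - 1) else 0

/-- The surrogate state `y(M) = ∑_{i=0}^{2H} Ψ_i(M) n_i`; `n_i` is the noise of age `i`, that is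
the noise `i + 1` steps before the time of the surrogate state. -/
def surrogateState {H dx du : ℕ} (A : Matrix (Fin dx) (Fin dx) ℝ)
    (B : Matrix (Fin dx) (Fin du) ℝ) (K₀ : Matrix (Fin du) (Fin dx) ℝ) (M : Policy H dx du)
    (n : Fin (2 * H + 1) → Vec dx) : Vec dx :=
  ∑ i : Fin (2 * H + 1), app (transfer A B K₀ M i) (n i)

/-- The surrogate action `v(M) = -K₀ y(M) + ∑_{i=1}^H M^{[i-1]} n_{i-1}`. -/
def surrogateAction {H dx du : ℕ} (A : Matrix (Fin dx) (Fin dx) ℝ)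
    (B : Matrix (Fin dx) (Fin du) ℝ) (K₀ : Matrix (Fin du) (Fin dx) ℝ) (M : Policy H dx du)
    (n : Fin (2 * H + 1) → Vec dx) : Vec du :=
  -app K₀ (surrogateState A B K₀ M n) +
    ∑ i : Fin H, app (block M i) (n ⟨i, by omega⟩)

/-- The surrogate cost `f(M) = E[c(y(M), v(M))]`, with independent noises of law `D`. -/
def surrogateCost {H dx du : ℕ} (A : Matrix (Fin dx) (Fin dx) ℝ)
    (B : Matrix (Fin dx) (Fin du) ℝ) (K₀ : Matrix (Fin du) (Fin dx) ℝ) (D : Measure (Vec dx))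
    (c : Vec dx → Vec du → ℝ) (M : Policy H dx du) : ℝ :=
  ∫ n, c (surrogateState A B K₀ M n) (surrogateAction A B K₀ M n)
    ∂(Measure.pi fun _ : Fin (2 * H + 1) => D)

/-- The stacked vector `z(M) = (y(M), v(M))`. -/
def surrogatePair {H dx du : ℕ} (A : Matrix (Fin dx) (Fin dx) ℝ)
    (B : Matrix (Fin dx) (Fin du) ℝ) (K₀ : Matrix (Fin du) (Fin dx) ℝ) (M : Policy H dx du)
    (n : Fin (2 * H + 1) → Vec dx) : Fin dx ⊕ Fin du → ℝ :=
  Sum.elim (fun a => surrogateState A B K₀ M n a) (fun a => surrogateAction A B K₀ M n a)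

/-- The Jacobian `J` of `M_vec ↦ z(M)`. As `z` is affine in `M`, its column at the coordinate `p`
is `z(e_p) - z(0)`. -/
def jacobian {H dx du : ℕ} (A : Matrix (Fin dx) (Fin dx) ℝ)
    (B : Matrix (Fin dx) (Fin du) ℝ) (K₀ : Matrix (Fin du) (Fin dx) ℝ)
    (n : Fin (2 * H + 1) → Vec dx) :
    Matrix (Fin dx ⊕ Fin du) (Fin H × Fin du × Fin dx) ℝ :=
  Matrix.of fun ρ p => surrogatePair A B K₀ (EuclideanSpace.single p 1 : Policy H dx du) n ρ
    - surrogatePair A B K₀ (0 : Policy H dx du) n ρ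

/-- The preconditioner `E[Jᵀ J]`. -/
def gram (H : ℕ) {dx du : ℕ} (A : Matrix (Fin dx) (Fin dx) ℝ)
    (B : Matrix (Fin dx) (Fin du) ℝ) (K₀ : Matrix (Fin du) (Fin dx) ℝ) (D : Measure (Vec dx)) :
    Matrix (Fin H × Fin du × Fin dx) (Fin H × Fin du × Fin dx) ℝ :=
  Matrix.of fun p q => ∫ n, ((jacobian A B K₀ n)ᵀ * jacobian A B K₀ n) p q
    ∂(Measure.pi fun _ : Fin (2 * H + 1) => D)

/-! ### The online natural gradient update -/

/-- The squared matrix norm `‖V‖_U² = Vᵀ U V`. -/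
def sqNorm {ι : Type*} [Fintype ι] (U : Matrix ι ι ℝ) (V : EuclideanSpace ℝ ι) : ℝ :=
  V.ofLp ⬝ᵥ (U *ᵥ V.ofLp)

/-- `N` is a projection of `V` onto the set `S` in the norm `‖·‖_U`. -/
def IsProjection {ι : Type*} [Fintype ι] (U : Matrix ι ι ℝ) (S : Set (EuclideanSpace ℝ ι))
    (V N : EuclideanSpace ℝ ι) : Prop :=
  N ∈ S ∧ ∀ N' ∈ S, sqNorm U (N - V) ≤ sqNorm U (N' - V)

/-- `M_1, …, M_T` are iterates of the online natural gradient update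
`M_{t+1} = Π(M_t - η_t E[JᵀJ]⁻¹ ∇f_t(M_t))` with an arbitrary initial policy `M_1` in the policy
set, `f_t` being the surrogate cost of `c_t`. -/
def IsNaturalGradientRun {H dx du : ℕ} (A : Matrix (Fin dx) (Fin dx) ℝ)
    (B : Matrix (Fin dx) (Fin du) ℝ) (K₀ : Matrix (Fin du) (Fin dx) ℝ) (κ κB γ : ℝ)
    (D : Measure (Vec dx)) (c : ℕ → Vec dx → Vec du → ℝ) (η : ℕ → ℝ) (T : ℕ)
    (M : ℕ → Policy H dx du) : Prop :=
  M 1 ∈ policySet H dx du κ κB γ ∧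
  ∀ t, 1 ≤ t → t < T →
    IsProjection (gram H A B K₀ D) (policySet H dx du κ κB γ)
      (M t - η t • Matrix.toEuclideanLin (gram H A B K₀ D)⁻¹
        (∇ (surrogateCost A B K₀ D (c t)) (M t)))
      (M (t + 1))

/-- The horizon `H = γ⁻¹ log(T κ²)`, rounded up to an integer. -/
def horizon (κ γ : ℝ) (T : ℕ) : ℕ := ⌈γ⁻¹ * Real.log (T * κ ^ 2)⌉₊

/-! ### The noise and the costs -/

/-- A noise law that is bounded by `W`, centred, and has `E[w wᵀ] ⪰ σ² I`. -/
structure NoiseLaw {dx : ℕ} (D : Measure (Vec dx)) (W σ : ℝ) : Prop where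
  bounded : ∀ᵐ x ∂D, ‖x‖ ≤ W
  centred : ∫ x, x ∂D = 0
  covariance : ((Matrix.of fun a b => ∫ x, x a * x b ∂D : Matrix (Fin dx) (Fin dx) ℝ)
    - σ ^ 2 • (1 : Matrix (Fin dx) (Fin dx) ℝ)).PosSemidef

/-- The costs `c_t(x, u) = r_t (‖x‖² + ‖u‖²)`. -/
def sphericalCost {dx du : ℕ} (r : ℕ → ℝ) : ℕ → Vec dx → Vec du → ℝ :=
  fun t x u => r t * (‖x‖ ^ 2 + ‖u‖ ^ 2)

end OnlineControl

end

open OnlineControl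

/-! For spherical costs the weight `r t` only rescales: every surrogate cost is `r t` times one
quadratic function `meanSquare` of the policy (`surrogateCost_sphericalCost`), and the Hessian of
that function is exactly twice the preconditioner P (`integral_surrogatePair_dotProduct_self`).
Completing the square turns it into a constant plus ‖M - m‖_P², where m does not depend on t. Hence
all surrogate costs share one minimizer N over the policy set, the P-projection of m, and the
natural gradient step is M_t - 2 η_t r_t (M_t - m), a plain projected gradient step for a squared
distance in the P-norm.

Such a step contracts the distance to N by |1 - 2 η_t r_t| (`norm_sub_le_of_projected_step`). The
step sizes give 2/t ≤ 2 η_t r_t always, and 2 η_t r_t ≤ 1 once t ≥ 2cβ/α. So E_t = ‖M_t - N‖_P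
eventually satisfies t E_{t+1} ≤ (t-2) E_t. This is decay like t⁻², and the sum of the E_t is at
most a constant times cβ/α times the P-diameter of the policy set (`sum_le_of_contraction`).

The bound is free of σ because distances are never converted to the Euclidean norm of policies. The
P-norm directly dominates the second moment of the disturbance action (`integral_norm_input_sq_le`),
and stability turns a summable difference of actions into a summable difference of states, hence of
costs (`abs_sum_cost_sub_le`). The condition σ > 0 serves only to make P invertible (`gram_posDef`).

The regret then splits into four comparisons: the iterates against the constant policy N; N against
its surrogate cost; the surrogate cost of N against that of the policy imitating K, where minimality
of N is used; and that imitation against K itself. Truncation errors are geometric, and the horizon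
makes them O(1/T) per round. The first 2H+1 rounds, whose noise history is still incomplete, are
charged at the maximal cost. This is the only source of log T, so a single logarithm suffices. -/

namespace OnlineControl

/-! ### Matrices acting on Euclidean vectors. -/

section Application

variable {l m n : ℕ}

lemma app_ofLp (A : Matrix (Fin m) (Fin n) ℝ) (x : Vec n) : (app A x).ofLp = A *ᵥ x.ofLp := rfl

lemma app_add (A : Matrix (Fin m) (Fin n) ℝ) (x y : Vec n) : app A (x + y) = app A x + app A y :=
  map_add _ _ _

lemma app_sub (A : Matrix (Fin m) (Fin n) ℝ) (x y : Vec n) : app A (x - y) = app A x - app A y :=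
  map_sub _ _ _

lemma app_smul (A : Matrix (Fin m) (Fin n) ℝ) (a : ℝ) (x : Vec n) :
    app A (a • x) = a • app A x :=
  map_smul _ _ _

lemma app_zero (A : Matrix (Fin m) (Fin n) ℝ) : app A 0 = 0 := map_zero _

lemma app_sum {ι : Type*} (A : Matrix (Fin m) (Fin n) ℝ) (s : Finset ι) (x : ι → Vec n) :
    app A (∑ i ∈ s, x i) = ∑ i ∈ s, app A (x i) :=
  map_sum _ _ _

lemma add_app (A B : Matrix (Fin m) (Fin n) ℝ) (x : Vec n) :
    app (A + B) x = app A x + app B x := by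
  simp [app]

lemma sub_app (A B : Matrix (Fin m) (Fin n) ℝ) (x : Vec n) :
    app (A - B) x = app A x - app B x := by
  simp [app]

lemma smul_app (a : ℝ) (A : Matrix (Fin m) (Fin n) ℝ) (x : Vec n) :
    app (a • A) x = a • app A x := by
  simp [app]

lemma zero_app (x : Vec n) : app (0 : Matrix (Fin m) (Fin n) ℝ) x = 0 := by
  simp [app]

lemma one_app (x : Vec n) : app (1 : Matrix (Fin n) (Fin n) ℝ) x = x := by
  ext i; simp [app_ofLp]

lemma mul_app (A : Matrix (Fin l) (Fin m) ℝ) (B : Matrix (Fin m) (Fin n) ℝ) (x : Vec n) :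
    app (A * B) x = app A (app B x) := by
  ext i; simp [app_ofLp, Matrix.mulVec_mulVec]

lemma sum_app {ι : Type*} (s : Finset ι) (A : ι → Matrix (Fin m) (Fin n) ℝ) (x : Vec n) :
    app (∑ i ∈ s, A i) x = ∑ i ∈ s, app (A i) x := by
  simp [app]

lemma norm_app_le (A : Matrix (Fin m) (Fin n) ℝ) (x : Vec n) : ‖app A x‖ ≤ ‖A‖ * ‖x‖ :=
  Matrix.l2_opNorm_mulVec A x

lemma norm_app_le_of_le {A : Matrix (Fin m) (Fin n) ℝ} {x : Vec n} {a b : ℝ} (hA : ‖A‖ ≤ a)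
    (hx : ‖x‖ ≤ b) : ‖app A x‖ ≤ a * b :=
  (norm_app_le A x).trans (mul_le_mul hA hx (norm_nonneg _) ((norm_nonneg _).trans hA))

lemma continuous_app (A : Matrix (Fin m) (Fin n) ℝ) : Continuous (app A) :=
  LinearMap.continuous_of_finiteDimensional (Matrix.toEuclideanLin A)

lemma continuous_app_left : Continuous fun p : Matrix (Fin m) (Fin n) ℝ × Vec n => app p.1 p.2 := by
  refine (PiLp.continuous_toLp 2 _).comp ?_
  exact continuous_fst.matrix_mulVec ((PiLp.continuous_ofLp 2 _).comp continuous_snd)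

/-- Not an equality, since the identity matrix of size zero has norm zero. -/
lemma norm_one_matrix_le : ‖(1 : Matrix (Fin n) (Fin n) ℝ)‖ ≤ 1 := by
  rw [Matrix.l2_opNorm_def]
  refine ContinuousLinearMap.opNorm_le_bound _ zero_le_one fun x => ?_
  simp

/-- The spectral norm of a real matrix is at most that of its complexification. -/
lemma norm_le_norm_map_ofReal (A : Matrix (Fin m) (Fin n) ℝ) :
    ‖A‖ ≤ ‖A.map Complex.ofReal‖ := by
  have key : ∀ {k : ℕ} (y : Vec k),
      ‖(WithLp.toLp 2 fun i => (y i : ℂ) : EuclideanSpace ℂ (Fin k))‖ = ‖y‖ := fun y => by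
    simp [EuclideanSpace.norm_eq]
  rw [Matrix.l2_opNorm_def A]
  refine ContinuousLinearMap.opNorm_le_bound _ (norm_nonneg _) fun x => ?_
  have h := Matrix.l2_opNorm_mulVec (A.map Complex.ofReal)
    (WithLp.toLp 2 fun i => (x i : ℂ) : EuclideanSpace ℂ (Fin n))
  rw [key] at h
  refine le_trans (le_of_eq ?_) h
  rw [← key]
  congr 1
  ext i
  simp [Matrix.mulVec, dotProduct]

lemma abs_entry_le_norm (A : Matrix (Fin m) (Fin n) ℝ) (i : Fin m) (j : Fin n) :
    |A i j| ≤ ‖A‖ := by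
  have h := norm_app_le A (EuclideanSpace.single j 1)
  have h' := PiLp.norm_apply_le (app A (EuclideanSpace.single j 1)) i
  simp [app_ofLp] at h h'
  exact h'.trans h

end Application

/-! ### Strong stability: power bounds and compactness. -/

section StrongStability

variable {dx du : ℕ} {A : Matrix (Fin dx) (Fin dx) ℝ} {B : Matrix (Fin dx) (Fin du) ℝ}
  {K : Matrix (Fin du) (Fin dx) ℝ} {κ γ : ℝ}

lemma DiagStronglyStable.norm_le (h : DiagStronglyStable A B κ γ K) : ‖K‖ ≤ κ := by
  obtain ⟨l, Q, -, -, -, hK, -⟩ := h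
  exact hK

/-- Powers of Q L Q⁻¹ are Q Lʲ Q⁻¹, so the conjugation costs κ² only once, whatever the exponent. -/
lemma DiagStronglyStable.norm_pow_le (h : DiagStronglyStable A B κ γ K) (hκ : 1 ≤ κ) (j : ℕ) :
    ‖(A - B * K) ^ j‖ ≤ κ ^ 2 * (1 - γ) ^ j := by
  obtain ⟨l, Q, hQ, hA, hl, -, hQn, hQi⟩ := h
  rcases Nat.eq_zero_or_pos j with rfl | hj
  · simp only [pow_zero, mul_one]
    exact norm_one_matrix_le.trans (one_le_pow₀ hκ)
  have hpow : ∀ k, ((A - B * K) ^ k).map Complex.ofReal = Q * Matrix.diagonal l ^ k * Q⁻¹ := by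
    intro k
    induction k with
    | zero =>
      rw [pow_zero, pow_zero, mul_one, Matrix.mul_nonsing_inv _ hQ]
      exact Matrix.map_one _ Complex.ofReal_zero Complex.ofReal_one
    | succ k ih =>
      have h1 : ((A - B * K) ^ (k + 1)).map Complex.ofReal
          = ((A - B * K) ^ k).map Complex.ofReal * (A - B * K).map Complex.ofReal := by
        rw [pow_succ]
        exact Matrix.map_mul (f := Complex.ofRealHom)
      rw [h1, ih, hA, pow_succ]
      simp only [Matrix.mul_assoc]
      rw [← Matrix.mul_assoc Q⁻¹ Q, Matrix.nonsing_inv_mul _ hQ, Matrix.one_mul]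
  have h0 : 0 ≤ 1 - γ := (norm_nonneg _).trans hl
  have hd : ‖Matrix.diagonal l ^ j‖ ≤ (1 - γ) ^ j :=
    (norm_pow_le' _ hj).trans (pow_le_pow_left₀ (norm_nonneg _) hl j)
  calc ‖(A - B * K) ^ j‖ ≤ ‖((A - B * K) ^ j).map Complex.ofReal‖ := norm_le_norm_map_ofReal _
    _ = ‖Q * Matrix.diagonal l ^ j * Q⁻¹‖ := by rw [hpow]
    _ ≤ ‖Q‖ * ‖Matrix.diagonal l ^ j‖ * ‖Q⁻¹‖ :=
      (Matrix.l2_opNorm_mul _ _).trans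
        (mul_le_mul_of_nonneg_right (Matrix.l2_opNorm_mul _ _) (norm_nonneg _))
    _ ≤ κ * (1 - γ) ^ j * κ := by gcongr
    _ = κ ^ 2 * (1 - γ) ^ j := by ring

/-- The set of strongly stable controllers is compact. -/
lemma isCompact_diagStronglyStable (A : Matrix (Fin dx) (Fin dx) ℝ)
    (B : Matrix (Fin dx) (Fin du) ℝ) (κ γ : ℝ) :
    IsCompact {K | DiagStronglyStable A B κ γ K} := by
  -- Invertibility is not a closed condition, so the inverse is carried as an extra coordinate R
  -- with Q R = 1. The controllers are then the projection of a closed bounded set of tuples (K, l,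
  -- Q, R).
  let S : Set (Matrix (Fin du) (Fin dx) ℝ × (Fin dx → ℂ) × Matrix (Fin dx) (Fin dx) ℂ ×
      Matrix (Fin dx) (Fin dx) ℂ) :=
    {p | p.2.2.1 * p.2.2.2 = 1 ∧
      (A - B * p.1).map Complex.ofReal = p.2.2.1 * Matrix.diagonal p.2.1 * p.2.2.2 ∧
      ‖p.2.1‖ ≤ 1 - γ ∧ ‖p.1‖ ≤ κ ∧ ‖p.2.2.1‖ ≤ κ ∧ ‖p.2.2.2‖ ≤ κ}
  have himg : {K | DiagStronglyStable A B κ γ K} = Prod.fst '' S := by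
    ext K
    constructor
    · rintro ⟨l, Q, hQ, hA, hl, hK, hQn, hQi⟩
      rw [Matrix.l2_opNorm_diagonal] at hl
      exact ⟨(K, l, Q, Q⁻¹), ⟨Matrix.mul_nonsing_inv _ hQ, hA, hl, hK, hQn, hQi⟩, rfl⟩
    · rintro ⟨⟨K', l, Q, R⟩, ⟨hQR, hA, hl, hK, hQn, hQi⟩, rfl⟩
      dsimp only at hQR hA hl hK hQn hQi
      have hR : Q⁻¹ = R := Matrix.inv_eq_right_inv hQR
      refine ⟨l, Q, (Matrix.isUnit_iff_isUnit_det Q).1 (IsUnit.of_mul_eq_one R hQR), ?_, ?_, hK,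
        hQn, ?_⟩
      · rw [hR]; exact hA
      · rwa [Matrix.l2_opNorm_diagonal]
      · rwa [hR]
  rw [himg]
  refine IsCompact.image ?_ continuous_fst
  have c1 : Continuous fun p : Matrix (Fin du) (Fin dx) ℝ × (Fin dx → ℂ) ×
      Matrix (Fin dx) (Fin dx) ℂ × Matrix (Fin dx) (Fin dx) ℂ => p.2.2.1 :=
    continuous_fst.comp (continuous_snd.comp continuous_snd)
  have c2 : Continuous fun p : Matrix (Fin du) (Fin dx) ℝ × (Fin dx → ℂ) ×
      Matrix (Fin dx) (Fin dx) ℂ × Matrix (Fin dx) (Fin dx) ℂ => p.2.2.2 :=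
    continuous_snd.comp (continuous_snd.comp continuous_snd)
  have c3 : Continuous fun p : Matrix (Fin du) (Fin dx) ℝ × (Fin dx → ℂ) ×
      Matrix (Fin dx) (Fin dx) ℂ × Matrix (Fin dx) (Fin dx) ℂ => p.2.1 :=
    continuous_fst.comp continuous_snd
  have hclosed : IsClosed S := by
    refine (isClosed_eq (c1.matrix_mul c2) continuous_const).inter ?_
    refine (isClosed_eq ?_ ((c1.matrix_mul c3.matrix_diagonal).matrix_mul c2)).inter ?_
    · exact (continuous_const.sub (continuous_const.matrix_mul continuous_fst)).matrix_map
        Complex.continuous_ofReal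
    exact (isClosed_le c3.norm continuous_const).inter
      ((isClosed_le continuous_fst.norm continuous_const).inter
        ((isClosed_le c1.norm continuous_const).inter (isClosed_le c2.norm continuous_const)))
  have : ProperSpace (Matrix (Fin du) (Fin dx) ℝ) := FiniteDimensional.proper ℝ _
  have : ProperSpace (Matrix (Fin dx) (Fin dx) ℂ) := FiniteDimensional.proper ℂ _
  have hcpt : IsCompact ((Metric.closedBall (0 : Matrix (Fin du) (Fin dx) ℝ) κ) ×ˢ
      ((Metric.closedBall (0 : Fin dx → ℂ) (1 - γ)) ×ˢ
        ((Metric.closedBall (0 : Matrix (Fin dx) (Fin dx) ℂ) κ) ×ˢ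
          (Metric.closedBall (0 : Matrix (Fin dx) (Fin dx) ℂ) κ)))) :=
    (isCompact_closedBall _ _).prod ((isCompact_closedBall _ _).prod
      ((isCompact_closedBall _ _).prod (isCompact_closedBall _ _)))
  refine hcpt.of_isClosed_subset hclosed ?_
  rintro ⟨K', l, Q, R⟩ ⟨-, -, hl, hK, hQn, hQi⟩
  simp only [Set.mem_prod, mem_closedBall_zero_iff]
  exact ⟨hK, hl, hQn, hQi⟩

end StrongStability

/-! ### Geometric sums and the choice of the horizon. -/

section GeometricSums

variable {q γ : ℝ}

lemma sum_range_one_sub_pow_le (hγ : 0 < γ) (hγ1 : γ < 1) (n : ℕ) :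
    ∑ j ∈ Finset.range n, (1 - γ) ^ j ≤ γ⁻¹ := by
  have h := geom_sum_mul_neg (1 - γ) n
  rw [sub_sub_cancel] at h
  rw [← one_div, le_div_iff₀ hγ, h]
  have := pow_nonneg (sub_nonneg.2 hγ1.le) n
  linarith

lemma norm_sum_range_le_geometric {E : Type*} [SeminormedAddCommGroup E] (hγ : 0 < γ) (hγ1 : γ < 1)
    {f : ℕ → E} {c : ℝ} (hc : 0 ≤ c) (hf : ∀ j, ‖f j‖ ≤ c * (1 - γ) ^ j) (n : ℕ) :
    ‖∑ j ∈ Finset.range n, f j‖ ≤ c * γ⁻¹ := by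
  refine (norm_sum_le _ _).trans ((Finset.sum_le_sum fun j _ => hf j).trans ?_)
  rw [← Finset.mul_sum]
  exact mul_le_mul_of_nonneg_left (sum_range_one_sub_pow_le hγ hγ1 n) hc

/-- Truncating a geometrically decaying sum that stops at `m`. -/
lemma norm_sum_range_sub_sum_range_le {E : Type*} [SeminormedAddCommGroup E] (hγ : 0 < γ)
    (hγ1 : γ < 1) {f : ℕ → E} {c : ℝ} (hc : 0 ≤ c) (hf : ∀ j, ‖f j‖ ≤ c * (1 - γ) ^ j) {m : ℕ}
    (hm : ∀ j, m ≤ j → f j = 0) (N : ℕ) :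
    ‖∑ j ∈ Finset.range m, f j - ∑ j ∈ Finset.range N, f j‖ ≤ c * (1 - γ) ^ N * γ⁻¹ := by
  have h0 : 0 ≤ 1 - γ := sub_nonneg.2 hγ1.le
  have hr : 0 ≤ c * (1 - γ) ^ N := mul_nonneg hc (pow_nonneg h0 N)
  rcases le_total m N with h | h
  · rw [← Finset.sum_range_add_sum_Ico f h, Finset.sum_eq_zero (s := Finset.Ico m N)]
    · simpa using mul_nonneg hr (inv_nonneg.2 hγ.le)
    · intro j hj
      exact hm j (Finset.mem_Ico.1 hj).1
  · rw [← Finset.sum_range_add_sum_Ico f h, add_sub_cancel_left, Finset.sum_Ico_eq_sum_range]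
    refine norm_sum_range_le_geometric hγ hγ1 hr (fun j => (hf _).trans (le_of_eq ?_)) _
    rw [pow_add]; ring

/-- Since 1 - γ ≤ exp(-γ), the power is at most exp(-γH) ≤ 1/(Tκ²). The gain κ² is then dropped. -/
lemma one_sub_pow_horizon_le {κ : ℝ} (hκ : 1 ≤ κ) (hγ : 0 < γ) (hγ1 : γ < 1) {T : ℕ}
    (hT : 2 ≤ T) : (1 - γ) ^ horizon κ γ T ≤ 1 / T := by
  have hT0 : (0 : ℝ) < T := by positivity
  have hH : Real.log (T * κ ^ 2) ≤ γ * horizon κ γ T := by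
    have := Nat.le_ceil (γ⁻¹ * Real.log (T * κ ^ 2))
    rw [inv_mul_le_iff₀ hγ] at this
    exact this
  calc (1 - γ) ^ horizon κ γ T ≤ Real.exp (-γ) ^ horizon κ γ T :=
        pow_le_pow_left₀ (sub_nonneg.2 hγ1.le) (Real.one_sub_le_exp_neg γ) _
    _ = Real.exp (-(γ * horizon κ γ T)) := by rw [← Real.exp_nat_mul]; ring_nf
    _ ≤ Real.exp (-Real.log (T * κ ^ 2)) := Real.exp_le_exp.2 (neg_le_neg hH)
    _ = 1 / (T * κ ^ 2) := by rw [Real.exp_neg, Real.exp_log (by positivity), one_div]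
    _ ≤ 1 / T := by
        apply one_div_le_one_div_of_le hT0
        nlinarith [one_le_pow₀ hκ (n := 2)]

end GeometricSums

end OnlineControl

namespace OnlineControl

variable {H dx du : ℕ}

/-! ### Policies and the policy set. -/

section Block

lemma block_add (M N : Policy H dx du) (i : ℕ) : block (M + N) i = block M i + block N i := by
  unfold block
  split_ifs
  · ext; simp
  · simp

lemma block_smul (a : ℝ) (M : Policy H dx du) (i : ℕ) : block (a • M) i = a • block M i := by
  unfold block
  split_ifs
  · ext; simp
  · simp

lemma block_sub (M N : Policy H dx du) (i : ℕ) : block (M - N) i = block M i - block N i := by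
  have h := block_add (M - N) N i
  rw [sub_add_cancel] at h
  rw [h, add_sub_cancel_right]

lemma block_of_le {M : Policy H dx du} {i : ℕ} (h : H ≤ i) : block M i = 0 := by
  simp [block, not_lt.2 h]

lemma continuous_block (i : ℕ) : Continuous fun M : Policy H dx du => block M i := by
  unfold block
  split_ifs with h
  · refine continuous_matrix fun a b => ?_
    simp only [Matrix.of_apply]
    fun_prop
  · exact continuous_const

/-- The policy with prescribed blocks. -/
noncomputable def ofBlocks (H : ℕ) (G : ℕ → Matrix (Fin du) (Fin dx) ℝ) : Policy H dx du :=
  WithLp.toLp 2 fun p => G p.1 p.2.1 p.2.2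

lemma block_ofBlocks (G : ℕ → Matrix (Fin du) (Fin dx) ℝ) {i : ℕ} (h : i < H) :
    block (ofBlocks H G) i = G i := by
  ext a b
  simp [block, ofBlocks, h]

variable {κ κB γ : ℝ}

/-- One factor 1 - γ is given away and blocks beyond H are zero, so the bound has a uniform
geometric form valid for every index. -/
lemma norm_block_le_of_mem {M : Policy H dx du} (hM : M ∈ policySet H dx du κ κB γ)
    (hc : 0 ≤ κ ^ 3 * κB) (hγ : 0 ≤ γ) (hγ1 : γ < 1) (i : ℕ) :
    ‖block M i‖ ≤ κ ^ 3 * κB * (1 - γ) ^ i := by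
  have h0 : 0 ≤ 1 - γ := sub_nonneg.2 hγ1.le
  rcases lt_or_ge i H with h | h
  · refine (hM (i + 1) (Finset.mem_Icc.2 ⟨by omega, h⟩)).trans ?_
    exact mul_le_mul_of_nonneg_left
      (pow_le_pow_of_le_one h0 (by linarith) (Nat.le_succ i)) hc
  · rw [block_of_le h, norm_zero]
    positivity

lemma convex_policySet : Convex ℝ (policySet H dx du κ κB γ) := by
  intro M hM N hN a b ha hb hab i hi
  rw [block_add, block_smul, block_smul]
  calc ‖a • block M (i - 1) + b • block N (i - 1)‖
      ≤ a * ‖block M (i - 1)‖ + b * ‖block N (i - 1)‖ := by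
        refine (norm_add_le _ _).trans (le_of_eq ?_)
        rw [norm_smul, norm_smul, Real.norm_of_nonneg ha, Real.norm_of_nonneg hb]
    _ ≤ a * (κ ^ 3 * κB * (1 - γ) ^ i) + b * (κ ^ 3 * κB * (1 - γ) ^ i) := by
        gcongr
        exacts [hM i hi, hN i hi]
    _ = κ ^ 3 * κB * (1 - γ) ^ i := by rw [← add_mul, hab, one_mul]

lemma isCompact_policySet : IsCompact (policySet H dx du κ κB γ) := by
  have hclosed : IsClosed (policySet H dx du κ κB γ) := by
    simp only [policySet, Set.ofPred_forall]
    refine isClosed_iInter fun i => isClosed_iInter fun _ => ?_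
    exact isClosed_le (continuous_block _).norm continuous_const
  have hK : IsCompact ((WithLp.ofLp : Policy H dx du → _) ⁻¹'
      Set.univ.pi fun p : Fin H × Fin du × Fin dx =>
        Set.Icc (-(κ ^ 3 * κB * (1 - γ) ^ (p.1.1 + 1))) (κ ^ 3 * κB * (1 - γ) ^ (p.1.1 + 1))) :=
    (EuclideanSpace.equiv (Fin H × Fin du × Fin dx) ℝ).toHomeomorph.isCompact_preimage.2
      (isCompact_univ_pi fun _ => isCompact_Icc)
  refine hK.of_isClosed_subset hclosed fun M hM p _ => ?_
  have h1 := hM (p.1.1 + 1) (Finset.mem_Icc.2 ⟨by omega, p.1.2⟩)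
  have h2 := (abs_entry_le_norm (block M p.1.1) p.2.1 p.2.2).trans h1
  have h3 : block M p.1.1 p.2.1 p.2.2 = M p := by simp [block]
  rw [h3] at h2
  exact abs_le.1 h2

end Block

/-! ### Disturbance actions, and the surrogate state as a truncated response. -/

section Response

/-- The disturbance action of `M` for the noise history `h`, where `h i` is the noise of age `i`. -/
noncomputable def input (M : Policy H dx du) (h : ℕ → Vec dx) : Vec du :=
  ∑ i ∈ Finset.range H, app (block M i) (h i)

/-- The state reached from `0` after `H + 1` steps of `x ↦ F x + B u + w`, where the action `u` is
the disturbance action of `M`. -/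
noncomputable def response (F : Matrix (Fin dx) (Fin dx) ℝ) (B : Matrix (Fin dx) (Fin du) ℝ)
    (M : Policy H dx du) (h : ℕ → Vec dx) : Vec dx :=
  ∑ j ∈ Finset.range (H + 1), app (F ^ j) (app B (input M fun i => h (j + 1 + i)) + h j)

/-- A finite noise history, extended by `0`. -/
noncomputable def extend {N : ℕ} (n : Fin N → Vec dx) (i : ℕ) : Vec dx :=
  if h : i < N then n ⟨i, h⟩ else 0

/-- The noise of age `i` at time `t`, which is `0` before time `1`. -/
noncomputable def history (w : ℕ → Vec dx) (t i : ℕ) : Vec dx :=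
  if i + 1 < t then w (t - 1 - i) else 0

variable {F : Matrix (Fin dx) (Fin dx) ℝ} {B : Matrix (Fin dx) (Fin du) ℝ}

lemma input_congr (M : Policy H dx du) {h h' : ℕ → Vec dx} (hh : ∀ i < H, h i = h' i) :
    input M h = input M h' :=
  Finset.sum_congr rfl fun i hi => by rw [hh i (Finset.mem_range.1 hi)]

/-- The oldest noise that enters has age H + 1 + (H - 1) = 2H: H steps of dynamics preceded by an
action that looks back over H noises. -/
lemma response_congr (F : Matrix (Fin dx) (Fin dx) ℝ) (B : Matrix (Fin dx) (Fin du) ℝ)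
    (M : Policy H dx du) {h h' : ℕ → Vec dx} (hh : ∀ i < 2 * H + 1, h i = h' i) :
    response F B M h = response F B M h' := by
  refine Finset.sum_congr rfl fun j hj => ?_
  rw [Finset.mem_range] at hj
  rw [hh j (by omega), input_congr M fun i hi => hh (j + 1 + i) (by omega)]

lemma input_add (M N : Policy H dx du) (h : ℕ → Vec dx) :
    input (M + N) h = input M h + input N h := by
  simp [input, block_add, add_app, Finset.sum_add_distrib]

lemma input_sub (M N : Policy H dx du) (h : ℕ → Vec dx) :
    input (M - N) h = input M h - input N h := by
  simp [input, block_sub, sub_app, Finset.sum_sub_distrib]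

lemma input_smul (a : ℝ) (M : Policy H dx du) (h : ℕ → Vec dx) :
    input (a • M) h = a • input M h := by
  simp [input, block_smul, smul_app, Finset.smul_sum]

/-- The noise also enters the state directly, so the response is affine in the policy. Additivity
holds after subtracting the value at the zero policy. -/
lemma response_add_sub (F : Matrix (Fin dx) (Fin dx) ℝ) (B : Matrix (Fin dx) (Fin du) ℝ)
    (M N : Policy H dx du) (h : ℕ → Vec dx) :
    response F B (M + N) h - response F B (0 : Policy H dx du) h
      = (response F B M h - response F B (0 : Policy H dx du) h)
        + (response F B N h - response F B (0 : Policy H dx du) h) := by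
  simp only [response, ← Finset.sum_sub_distrib, ← Finset.sum_add_distrib]
  refine Finset.sum_congr rfl fun j _ => ?_
  have h0 : input (0 : Policy H dx du) (fun i => h (j + 1 + i)) = 0 := by
    simpa using input_smul 0 (0 : Policy H dx du) fun i => h (j + 1 + i)
  simp only [input_add, app_add, h0, app_zero]
  abel

lemma response_smul_sub (F : Matrix (Fin dx) (Fin dx) ℝ) (B : Matrix (Fin dx) (Fin du) ℝ)
    (a : ℝ) (M : Policy H dx du) (h : ℕ → Vec dx) :
    response F B (a • M) h - response F B (0 : Policy H dx du) h
      = a • (response F B M h - response F B (0 : Policy H dx du) h) := by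
  simp only [response, ← Finset.sum_sub_distrib, Finset.smul_sum]
  refine Finset.sum_congr rfl fun j _ => ?_
  have h0 : input (0 : Policy H dx du) (fun i => h (j + 1 + i)) = 0 := by
    simpa using input_smul 0 (0 : Policy H dx du) fun i => h (j + 1 + i)
  simp only [input_smul, app_add, h0, app_zero, app_smul, zero_add, add_sub_cancel_right]

lemma continuous_input (M : Policy H dx du) {X : Type*} [TopologicalSpace X] {h : X → ℕ → Vec dx}
    (hh : ∀ i, Continuous fun x => h x i) : Continuous fun x => input M (h x) :=
  continuous_finsetSum _ fun i _ => (continuous_app _).comp (hh i)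

lemma continuous_response (F : Matrix (Fin dx) (Fin dx) ℝ) (B : Matrix (Fin dx) (Fin du) ℝ)
    (M : Policy H dx du) {X : Type*} [TopologicalSpace X] {h : X → ℕ → Vec dx}
    (hh : ∀ i, Continuous fun x => h x i) : Continuous fun x => response F B M (h x) :=
  continuous_finsetSum _ fun j _ => (continuous_app _).comp
    (((continuous_app _).comp (continuous_input M fun i => hh (j + 1 + i))).add (hh j))

lemma continuous_extend {N : ℕ} (i : ℕ) :
    Continuous fun n : Fin N → Vec dx => extend n i := by
  unfold extend
  split_ifs
  · exact continuous_apply _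
  · exact continuous_const

lemma norm_extend_le {N : ℕ} {n : Fin N → Vec dx} {W : ℝ} (hW : 0 ≤ W) (hn : ∀ i, ‖n i‖ ≤ W)
    (i : ℕ) : ‖extend n i‖ ≤ W := by
  unfold extend
  split_ifs
  · exact hn _
  · simpa

lemma norm_history_le {w : ℕ → Vec dx} {W : ℝ} (hW : 0 ≤ W) (hw : ∀ s, ‖w s‖ ≤ W) (t i : ℕ) :
    ‖history w t i‖ ≤ W := by
  unfold history
  split_ifs
  · exact hw _
  · simpa

/-- Exchanging sums: the transfer matrices group the contributions by the age of the noise, the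
response by the step at which an action is applied. The second form matches the unrolled dynamics.
-/
lemma surrogateState_eq (A : Matrix (Fin dx) (Fin dx) ℝ) (B : Matrix (Fin dx) (Fin du) ℝ)
    (K₀ : Matrix (Fin du) (Fin dx) ℝ) (M : Policy H dx du) (n : Fin (2 * H + 1) → Vec dx) :
    surrogateState A B K₀ M n = response (A - B * K₀) B M (extend n) := by
  set F := A - B * K₀ with hF
  have h1 : surrogateState A B K₀ M n
      = ∑ i ∈ Finset.range (2 * H + 1), app (transfer A B K₀ M i) (extend n i) := by
    rw [Finset.sum_range]
    refine Finset.sum_congr rfl fun i _ => ?_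
    rw [extend, dif_pos i.2]
  -- For fixed j the indicator keeps the ages j+1, …, j+H. Shifting by j+1 turns them into the H
  -- lags of one action.
  have h2 : ∀ j ∈ Finset.range (H + 1), ∑ i ∈ Finset.range (2 * H + 1),
      app (if j + 1 ≤ i ∧ i ≤ j + H then F ^ j * B * block M (i - j - 1) else 0) (extend n i)
      = app (F ^ j) (app B (input M fun i => extend n (j + 1 + i))) := by
    intro j hj
    rw [Finset.mem_range] at hj
    have h3 : Finset.range (2 * H + 1)
        = Finset.range (j + 1 + H) ∪ Finset.Ico (j + 1 + H) (2 * H + 1) := by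
      ext i; simp only [Finset.mem_range, Finset.mem_union, Finset.mem_Ico]; omega
    have h4 : ∑ i ∈ Finset.Ico (j + 1 + H) (2 * H + 1),
        app (if j + 1 ≤ i ∧ i ≤ j + H then F ^ j * B * block M (i - j - 1) else 0) (extend n i)
        = 0 := by
      refine Finset.sum_eq_zero fun i hi => ?_
      rw [Finset.mem_Ico] at hi
      rw [if_neg (by omega), zero_app]
    rw [← Finset.sum_range_add_sum_Ico _ (show j + 1 + H ≤ 2 * H + 1 by omega), h4, add_zero,
      Finset.sum_range_add, Finset.sum_eq_zero (s := Finset.range (j + 1)), zero_add, input,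
      app_sum, app_sum]
    · refine Finset.sum_congr rfl fun i hi => ?_
      rw [Finset.mem_range] at hi
      rw [if_pos ⟨by omega, by omega⟩, mul_app, mul_app,
        show j + 1 + i - j - 1 = i by omega]
    · intro i hi
      rw [Finset.mem_range] at hi
      rw [if_neg (by omega), zero_app]
  have h5 : ∑ i ∈ Finset.range (2 * H + 1), app (if i ≤ H then F ^ i else 0) (extend n i)
      = ∑ i ∈ Finset.range (H + 1), app (F ^ i) (extend n i) := by
    rw [← Finset.sum_range_add_sum_Ico _ (show H + 1 ≤ 2 * H + 1 by omega),
      Finset.sum_eq_zero (s := Finset.Ico _ _), add_zero]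
    · refine Finset.sum_congr rfl fun i hi => ?_
      rw [Finset.mem_range] at hi
      rw [if_pos (by omega)]
    · intro i hi
      rw [Finset.mem_Ico] at hi
      rw [if_neg (by omega), zero_app]
  rw [h1]
  simp only [transfer, add_app, sum_app, Finset.sum_add_distrib, ← hF]
  rw [h5, Finset.sum_comm, Finset.sum_congr rfl h2, response, ← Finset.sum_add_distrib]
  refine Finset.sum_congr rfl fun j _ => ?_
  rw [app_add, add_comm]

lemma surrogateAction_eq (A : Matrix (Fin dx) (Fin dx) ℝ) (B : Matrix (Fin dx) (Fin du) ℝ)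
    (K₀ : Matrix (Fin du) (Fin dx) ℝ) (M : Policy H dx du) (n : Fin (2 * H + 1) → Vec dx) :
    surrogateAction A B K₀ M n
      = -app K₀ (response (A - B * K₀) B M (extend n)) + input M (extend n) := by
  rw [surrogateAction, surrogateState_eq, input, Finset.sum_range]
  congr 1
  refine Finset.sum_congr rfl fun i _ => ?_
  rw [extend, dif_pos (show i.1 < 2 * H + 1 by omega)]

variable {κ κB γ W : ℝ}

lemma norm_input_le {M : Policy H dx du} {b : ℝ} (hγ : 0 < γ) (hγ1 : γ < 1) (hb : 0 ≤ b)
    (hW : 0 ≤ W) (hM : ∀ i, ‖block M i‖ ≤ b * (1 - γ) ^ i) {h : ℕ → Vec dx}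
    (hh : ∀ i, ‖h i‖ ≤ W) : ‖input M h‖ ≤ b * γ⁻¹ * W := by
  refine (norm_sum_range_le_geometric hγ hγ1 (mul_nonneg hb hW)
    (fun i => (norm_app_le_of_le (hM i) (hh i)).trans (le_of_eq ?_)) H).trans (le_of_eq ?_)
  all_goals ring

lemma norm_response_le {M : Policy H dx du} {a : ℝ} (hγ : 0 < γ) (hγ1 : γ < 1)
    (hF : ∀ j, ‖F ^ j‖ ≤ κ ^ 2 * (1 - γ) ^ j) (hB : ‖B‖ ≤ κB) {h : ℕ → Vec dx}
    (hh : ∀ i, ‖h i‖ ≤ W) (ha : ∀ j, ‖input M fun i => h (j + i)‖ ≤ a) :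
    ‖response F B M h‖ ≤ κ ^ 2 * (κB * a + W) * γ⁻¹ := by
  have hb : ∀ j, ‖app B (input M fun i => h (j + 1 + i)) + h j‖ ≤ κB * a + W := fun j =>
    (norm_add_le _ _).trans (add_le_add (norm_app_le_of_le hB (ha (j + 1))) (hh j))
  refine norm_sum_range_le_geometric hγ hγ1
    (mul_nonneg (sq_nonneg κ) ((norm_nonneg _).trans (hb 0)))
    (fun j => (norm_app_le_of_le (hF j) (hb j)).trans (le_of_eq ?_)) _
  ring

end Response

/-! ### Linear recursions and their perturbations. -/

section Dynamics

variable {F : Matrix (Fin dx) (Fin dx) ℝ}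

lemma eq_sum_of_recursion {x d : ℕ → Vec dx} (h1 : x 1 = 0)
    (hx : ∀ t, x (t + 2) = app F (x (t + 1)) + d (t + 1)) (t : ℕ) :
    x (t + 1) = ∑ j ∈ Finset.range t, app (F ^ j) (d (t - j)) := by
  induction t with
  | zero => simpa using h1
  | succ t ih =>
    rw [hx, ih, Finset.sum_range_succ', app_sum]
    congr 1
    · refine Finset.sum_congr rfl fun j _ => ?_
      rw [pow_succ', mul_app, Nat.add_sub_add_right]
    · rw [pow_zero, one_app, Nat.sub_zero]

lemma norm_le_of_recursion {κ γ b : ℝ} (hγ : 0 < γ) (hγ1 : γ < 1) (hb : 0 ≤ b)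
    (hF : ∀ j, ‖F ^ j‖ ≤ κ ^ 2 * (1 - γ) ^ j) {x d : ℕ → Vec dx} (h1 : x 1 = 0)
    (hx : ∀ t, x (t + 2) = app F (x (t + 1)) + d (t + 1)) {t : ℕ}
    (hd : ∀ s, 1 ≤ s → s ≤ t → ‖d s‖ ≤ b) : ‖x (t + 1)‖ ≤ κ ^ 2 * b * γ⁻¹ := by
  rw [eq_sum_of_recursion h1 hx]
  refine (norm_sum_le_of_le _ (n := fun j => κ ^ 2 * b * (1 - γ) ^ j) fun j hj => ?_).trans ?_
  · rw [Finset.mem_range] at hj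
    refine (norm_app_le_of_le (hF j) (hd (t - j) (by omega) (by omega))).trans (le_of_eq ?_)
    ring
  · rw [← Finset.mul_sum]
    exact mul_le_mul_of_nonneg_left (sum_range_one_sub_pow_le hγ hγ1 t) (by positivity)

/-- In the sum over time, the states are controlled by the perturbations. -/
lemma sum_norm_le_of_recursion {κ γ : ℝ} (hγ : 0 < γ) (hγ1 : γ < 1)
    (hF : ∀ j, ‖F ^ j‖ ≤ κ ^ 2 * (1 - γ) ^ j) {x d : ℕ → Vec dx} (h1 : x 1 = 0)
    (hx : ∀ t, x (t + 2) = app F (x (t + 1)) + d (t + 1)) (T : ℕ) :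
    ∑ t ∈ Finset.range T, ‖x (t + 1)‖
      ≤ κ ^ 2 * γ⁻¹ * ∑ t ∈ Finset.range T, ‖d (t + 1)‖ := by
  have h0 : 0 ≤ 1 - γ := sub_nonneg.2 hγ1.le
  have hS : 0 ≤ ∑ t ∈ Finset.range T, ‖d (t + 1)‖ := Finset.sum_nonneg fun _ _ => norm_nonneg _
  -- Young's inequality for the convolution of the perturbations with a geometric kernel. The
  -- indicator makes the range of j independent of t, so the sums can be exchanged.
  calc ∑ t ∈ Finset.range T, ‖x (t + 1)‖
      ≤ ∑ t ∈ Finset.range T, ∑ j ∈ Finset.range T,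
          if j < t then κ ^ 2 * (1 - γ) ^ j * ‖d (t - j)‖ else 0 := by
        refine Finset.sum_le_sum fun t ht => ?_
        rw [eq_sum_of_recursion h1 hx, ← Finset.sum_filter]
        have hf : (Finset.range T).filter (fun j => j < t) = Finset.range t := by
          ext j; rw [Finset.mem_range] at ht; simp only [Finset.mem_filter, Finset.mem_range]; omega
        rw [hf]
        exact norm_sum_le_of_le _ fun j _ => norm_app_le_of_le (hF j) le_rfl
    _ = ∑ j ∈ Finset.range T, κ ^ 2 * (1 - γ) ^ j *
          ∑ t ∈ Finset.range T, if j < t then ‖d (t - j)‖ else 0 := by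
        rw [Finset.sum_comm]
        simp only [Finset.mul_sum, mul_ite, mul_zero]
    _ ≤ ∑ j ∈ Finset.range T, κ ^ 2 * (1 - γ) ^ j * ∑ t ∈ Finset.range T, ‖d (t + 1)‖ := by
        refine Finset.sum_le_sum fun j _ => mul_le_mul_of_nonneg_left ?_ (by positivity)
        rw [← Finset.sum_filter]
        -- For fixed j, the shift t ↦ t - j - 1 sends the relevant times injectively into the range
        -- up to T, so each perturbation is counted at most once.
        have hinj : Set.InjOn (fun t => t - j - 1)
            ((Finset.range T).filter (fun t => j < t) : Finset ℕ) := by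
          intro s hs t ht hst
          simp only [Finset.coe_filter, Set.mem_ofPred_eq] at hs ht
          dsimp only at hst
          omega
        calc ∑ t ∈ (Finset.range T).filter (fun t => j < t), ‖d (t - j)‖
            = ∑ s ∈ ((Finset.range T).filter (fun t => j < t)).image (fun t => t - j - 1),
                ‖d (s + 1)‖ := by
              rw [Finset.sum_image hinj]
              refine Finset.sum_congr rfl fun t ht => ?_
              rw [Finset.mem_filter] at ht
              rw [show t - j - 1 + 1 = t - j by omega]
          _ ≤ ∑ t ∈ Finset.range T, ‖d (t + 1)‖ := by
              refine Finset.sum_le_sum_of_subset_of_nonneg ?_ fun _ _ _ => norm_nonneg _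
              intro s hs
              obtain ⟨t, ht, rfl⟩ := Finset.mem_image.1 hs
              simp only [Finset.mem_filter, Finset.mem_range] at ht ⊢
              omega
    _ = κ ^ 2 * (∑ j ∈ Finset.range T, (1 - γ) ^ j) * ∑ t ∈ Finset.range T, ‖d (t + 1)‖ := by
        rw [← Finset.sum_mul, ← Finset.mul_sum]
    _ ≤ κ ^ 2 * γ⁻¹ * ∑ t ∈ Finset.range T, ‖d (t + 1)‖ := by
        gcongr
        exact sum_range_one_sub_pow_le hγ hγ1 T

variable {A : Matrix (Fin dx) (Fin dx) ℝ} {B : Matrix (Fin dx) (Fin du) ℝ}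

lemma sum_Icc_one_eq_sum_range {E : Type*} [AddCommMonoid E] (f : ℕ → E) (T : ℕ) :
    ∑ t ∈ Finset.Icc 1 T, f t = ∑ t ∈ Finset.range T, f (t + 1) := by
  have hI : Finset.Icc 1 T = Finset.Ico 1 (T + 1) := by
    ext i; simp only [Finset.mem_Icc, Finset.mem_Ico]; omega
  rw [hI, Finset.sum_Ico_eq_sum_range, Nat.add_sub_cancel]
  exact Finset.sum_congr rfl fun t _ => by rw [add_comm]

lemma policyCtrl_eq (K₀ : Matrix (Fin du) (Fin dx) ℝ) (M : ℕ → Policy H dx du) (w : ℕ → Vec dx)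
    (t : ℕ) (x : Vec dx) :
    policyCtrl K₀ M w t x = -app K₀ x + input (M t) (history w t) := by
  rw [policyCtrl, input, sum_Icc_one_eq_sum_range]
  congr 1
  refine Finset.sum_congr rfl fun i _ => ?_
  rw [history, Nat.add_sub_cancel, Nat.sub_sub, add_comm 1 i]
  split_ifs
  · rfl
  · rw [app_zero]

/-- Every controller is a stabilising linear controller plus an additional input. -/
lemma state_succ (K₀ : Matrix (Fin du) (Fin dx) ℝ) (ctrl : ℕ → Vec dx → Vec du) (w : ℕ → Vec dx)
    (t : ℕ) :
    state A B ctrl w (t + 2) = app (A - B * K₀) (state A B ctrl w (t + 1))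
      + (app B (ctrl (t + 1) (state A B ctrl w (t + 1)) + app K₀ (state A B ctrl w (t + 1)))
        + w (t + 1)) := by
  rw [state, sub_app, mul_app, app_add]
  abel

end Dynamics

end OnlineControl

namespace OnlineControl

/-! ### Projected steps in a Hilbert norm and summability of contracting sequences. -/

section Optimization

variable {F : Type*} [NormedAddCommGroup F] [InnerProductSpace ℝ F]

lemma inner_sub_le_zero_of_forall_norm_le {C : Set F} (hC : Convex ℝ C) {u v : F} (hv : v ∈ C)
    (hmin : ∀ q ∈ C, ‖u - v‖ ≤ ‖u - q‖) {q : F} (hq : q ∈ C) : inner ℝ (u - v) (q - v) ≤ 0 := by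
  refine (norm_eq_iInf_iff_real_inner_le_zero hC hv).1 (le_antisymm ?_ ?_) q hq
  · have : Nonempty C := ⟨⟨v, hv⟩⟩
    exact le_ciInf fun q => hmin q q.2
  · exact ciInf_le (f := fun w : C => ‖u - w‖) ⟨0, by rintro _ ⟨w, rfl⟩; exact norm_nonneg _⟩
      ⟨v, hv⟩

/-- A projected gradient step for `‖· - m‖²` contracts the distance to the projection of `m`. -/
lemma norm_sub_le_of_projected_step {C : Set F} (hC : Convex ℝ C) {p p' q m : F} {s : ℝ}
    (hs : 0 ≤ s) (hp' : p' ∈ C) (hq : q ∈ C)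
    (hmin' : ∀ x ∈ C, ‖p - s • (p - m) - p'‖ ≤ ‖p - s • (p - m) - x‖)
    (hmin : ∀ x ∈ C, ‖m - q‖ ≤ ‖m - x‖) : ‖p' - q‖ ≤ |1 - s| * ‖p - q‖ := by
  -- Add the variational inequality at p', tested with q, to s times the one at q, tested with p'.
  -- The terms containing m cancel and ‖p' - q‖² ≤ (1-s)⟪p - q, p' - q⟫ remains.
  have h1 := inner_sub_le_zero_of_forall_norm_le hC hp' hmin' hq
  have h2 := mul_nonpos_of_nonneg_of_nonpos hs
    (inner_sub_le_zero_of_forall_norm_le hC hq hmin hp')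
  have h3 : ‖p' - q‖ ^ 2 ≤ inner ℝ ((1 - s) • (p - q)) (p' - q) := by
    have e1 : p - s • (p - m) - p' = ((1 - s) • (p - q) + s • (m - q)) - (p' - q) := by
      module
    have e2 : q - p' = -(p' - q) := by abel
    rw [e1, e2, inner_neg_right, inner_sub_left, inner_add_left, inner_smul_left _ _ s,
      real_inner_self_eq_norm_sq] at h1
    simp only [conj_trivial] at h1
    linarith
  have h4 := h3.trans (real_inner_le_norm _ _)
  rw [norm_smul, Real.norm_eq_abs] at h4
  rcases (norm_nonneg (p' - q)).eq_or_lt with h | h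
  · rw [← h]; positivity
  · nlinarith

/-- The potential ∑_{t ≤ N} E_t + (N-1) E_N does not increase for N ≥ k: the hypothesis and E_{N+1}
≤ E_N give (N+1) E_{N+1} ≤ (N-1) E_N. At N = k it is at most kD + (k-1)D. -/
lemma sum_le_of_contraction {E : ℕ → ℝ} {D : ℝ} {T k : ℕ} (hE : ∀ t, 0 ≤ E t) (hD : 0 ≤ D)
    (hED : ∀ t, 1 ≤ t → t ≤ T → E t ≤ D) (hk : 2 ≤ k)
    (hstep : ∀ t, k ≤ t → t < T → t * E (t + 1) ≤ (t - 2) * E t) :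
    ∑ t ∈ Finset.Icc 1 T, E t ≤ 2 * k * D := by
  have hcrude : ∀ N, N ≤ T → ∑ t ∈ Finset.Icc 1 N, E t ≤ N * D := fun N hN => by
    refine (Finset.sum_le_card_nsmul _ _ D fun t ht => ?_).trans (by simp)
    rw [Finset.mem_Icc] at ht
    exact hED t ht.1 (ht.2.trans hN)
  have hkD : 0 ≤ k * D := by positivity
  rcases le_or_gt T k with h | h
  · have := hcrude T le_rfl
    have : (T : ℝ) * D ≤ k * D := by gcongr
    linarith
  · have key : ∀ N, k ≤ N → N ≤ T →
        ∑ t ∈ Finset.Icc 1 N, E t + (N - 1) * E N ≤ 2 * k * D := by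
      intro N hN
      induction N, hN using Nat.le_induction with
      | base =>
        intro hkT
        have h1 := hcrude k hkT
        have h2 := hED k (by omega) hkT
        have h3 : (2 : ℝ) ≤ k := by exact_mod_cast hk
        nlinarith
      | succ N hN ih =>
        intro hNT
        have h1 := ih (by omega)
        have h2 := hstep N hN (by omega)
        have h3 : (2 : ℝ) ≤ N := by exact_mod_cast hk.trans hN
        have h4 : E (N + 1) ≤ E N := by nlinarith [hE N]
        rw [Finset.sum_Icc_succ_top (by omega)]
        push_cast
        nlinarith
    have h1 := key T h.le le_rfl
    have h2 : (1 : ℝ) ≤ T := by exact_mod_cast (show 1 ≤ T by omega)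
    nlinarith [hE T]

end Optimization

/-! ### Quadratic functions and their preconditioned gradients. -/

section Quadratic

variable {ι : Type*} [Fintype ι] [DecidableEq ι]

/-- Factor U = RᵀR and take S = R. Through S, projections in the norm of U become Euclidean
projections onto the image of the set. -/
lemma exists_sqNorm_eq_norm_sq {U : Matrix ι ι ℝ} (hU : U.PosSemidef) :
    ∃ S : EuclideanSpace ℝ ι →L[ℝ] EuclideanSpace ℝ ι,
      (∀ V, sqNorm U V = ‖S V‖ ^ 2) ∧
      ∀ V V', inner ℝ (S V) (S V') = V'.ofLp ⬝ᵥ (U *ᵥ V.ofLp) := by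
  open scoped MatrixOrder in
  obtain ⟨R, hR⟩ := CStarAlgebra.nonneg_iff_eq_star_mul_self.1 hU.nonneg
  have key : ∀ V V' : EuclideanSpace ℝ ι, inner ℝ (Matrix.toEuclideanCLM (𝕜 := ℝ) R V)
      (Matrix.toEuclideanCLM (𝕜 := ℝ) R V') = V'.ofLp ⬝ᵥ (U *ᵥ V.ofLp) := by
    intro V V'
    rw [hR, EuclideanSpace.inner_eq_star_dotProduct, ← Matrix.mulVec_mulVec,
      Matrix.dotProduct_mulVec, Matrix.star_eq_conjTranspose,
      Matrix.conjTranspose_eq_transpose_of_trivial, Matrix.vecMul_transpose]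
    simp
  refine ⟨Matrix.toEuclideanCLM (𝕜 := ℝ) R, fun V => ?_, key⟩
  rw [← real_inner_self_eq_norm_sq, key, sqNorm]

/-- A quadratic function with Hessian `2 U`, `U` positive definite, is a squared distance in the
norm of `U`, and its gradient is the corresponding one. -/
lemma exists_complete_square {U : Matrix ι ι ℝ} (hU : U.PosDef) {f : EuclideanSpace ℝ ι → ℝ}
    {c₀ : ℝ} {b : ι → ℝ} (hf : ∀ V, f V = c₀ + 2 * (b ⬝ᵥ V.ofLp) + sqNorm U V) :
    ∃ (m : EuclideanSpace ℝ ι) (c₁ : ℝ), (∀ V, f V = c₁ + sqNorm U (V - m)) ∧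
      ∀ (r : ℝ) (V : EuclideanSpace ℝ ι),
        Matrix.toEuclideanLin U⁻¹ (∇ (fun V => r * f V) V) = (2 * r) • (V - m) := by
  obtain ⟨S, hS, hSi⟩ := exists_sqNorm_eq_norm_sq hU.posSemidef
  have hdet : IsUnit U.det := (Matrix.isUnit_iff_isUnit_det U).1 hU.isUnit
  -- The critical point: half the gradient of f is U V + b, which vanishes at V = -U⁻¹ b.
  set m : EuclideanSpace ℝ ι := WithLp.toLp 2 (-(U⁻¹ *ᵥ b)) with hm
  have hUm : U *ᵥ m.ofLp = -b := by
    rw [hm]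
    simp only [Matrix.mulVec_neg, Matrix.mulVec_mulVec, Matrix.mul_nonsing_inv _ hdet,
      Matrix.one_mulVec]
  have hfm : ∀ V, f V = (c₀ - sqNorm U m) + sqNorm U (V - m) := by
    intro V
    have h1 : inner ℝ (S V) (S m) = -(b ⬝ᵥ V.ofLp) := by
      rw [real_inner_comm, hSi, hUm, dotProduct_neg, dotProduct_comm]
    rw [hf, hS (V - m), map_sub, norm_sub_sq_real, h1, ← hS, ← hS]
    ring
  refine ⟨m, c₀ - sqNorm U m, hfm, fun r V => ?_⟩
  have hgrad : HasGradientAt (fun V => r * f V)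
      (WithLp.toLp 2 ((2 * r) • (U *ᵥ (V - m).ofLp)) : EuclideanSpace ℝ ι) V := by
    rw [hasGradientAt_iff_hasFDerivAt]
    have h1 : HasFDerivAt (fun V => S (V - m)) S V :=
      S.hasFDerivAt.comp V ((hasFDerivAt_id V).sub_const m)
    have h2 := ((h1.norm_sq).const_add (c₀ - sqNorm U m)).const_mul r
    have h3 : (fun V => r * f V) = fun V => r * ((c₀ - sqNorm U m) + ‖S (V - m)‖ ^ 2) := by
      funext V
      rw [hfm, hS (V - m)]
    rw [h3]
    refine h2.congr_fderiv (ContinuousLinearMap.ext fun V' => ?_)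
    have h4 := hSi (V - m) V'
    simp only [InnerProductSpace.toDual_apply_apply, _root_.smul_apply,
      ContinuousLinearMap.comp_apply, innerSL_apply_apply, smul_eq_mul, nsmul_eq_mul, h4,
      EuclideanSpace.inner_eq_star_dotProduct, star_trivial, dotProduct_smul]
    push_cast
    ring
  rw [hgrad.gradient]
  ext i
  have h5 : (Matrix.toEuclideanLin U⁻¹
      (WithLp.toLp 2 ((2 * r) • (U *ᵥ (V - m).ofLp)) : EuclideanSpace ℝ ι)).ofLp
      = U⁻¹ *ᵥ ((2 * r) • (U *ᵥ (V - m).ofLp)) := rfl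
  rw [h5, Matrix.mulVec_smul, Matrix.mulVec_mulVec, Matrix.nonsing_inv_mul _ hdet,
    Matrix.one_mulVec]
  rfl

end Quadratic

end OnlineControl

namespace OnlineControl

variable {H dx du : ℕ} {D : Measure (Vec dx)} {W σ : ℝ}

/-! ### Integrability and nondegeneracy of the noise. -/

section Noise

lemma NoiseLaw.nonneg [IsProbabilityMeasure D] (hD : NoiseLaw D W σ) : 0 ≤ W := by
  obtain ⟨x, hx⟩ := hD.bounded.exists
  exact (norm_nonneg x).trans hx

lemma NoiseLaw.ae_pi_norm_le [IsProbabilityMeasure D] (hD : NoiseLaw D W σ) (N : ℕ) :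
    ∀ᵐ n ∂(Measure.pi fun _ : Fin N => D), ∀ i, ‖n i‖ ≤ W :=
  ae_all_iff.2 fun i =>
    (measurePreserving_eval (fun _ : Fin N => D) i).quasiMeasurePreserving.ae hD.bounded

/-- Continuous functions of finitely many noises are integrable. -/
lemma NoiseLaw.integrable_of_continuous [IsProbabilityMeasure D] (hD : NoiseLaw D W σ) {N : ℕ}
    {f : (Fin N → Vec dx) → ℝ} (hf : Continuous f) :
    Integrable f (Measure.pi fun _ : Fin N => D) := by
  -- Almost surely the noises lie in a compact product of balls, on which a continuous function is
  -- bounded.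
  obtain ⟨b, hb⟩ := (isCompact_univ_pi fun _ : Fin N =>
    isCompact_closedBall (0 : Vec dx) W).exists_bound_of_continuousOn hf.continuousOn
  refine Integrable.of_bound hf.aestronglyMeasurable b ?_
  filter_upwards [hD.ae_pi_norm_le N] with n hn
  exact hb n fun i _ => mem_closedBall_zero_iff.2 (hn i)

lemma NoiseLaw.integrable_of_continuous_single [IsProbabilityMeasure D] (hD : NoiseLaw D W σ)
    {E : Type*} [NormedAddCommGroup E] [SecondCountableTopologyEither (Vec dx) E]
    {f : Vec dx → E} (hf : Continuous f) : Integrable f D := by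
  obtain ⟨b, hb⟩ := (isCompact_closedBall (0 : Vec dx) W).exists_bound_of_continuousOn
    hf.continuousOn
  refine Integrable.of_bound hf.aestronglyMeasurable b ?_
  filter_upwards [hD.bounded] with x hx
  exact hb x (mem_closedBall_zero_iff.2 hx)

lemma NoiseLaw.integral_apply [IsProbabilityMeasure D] (hD : NoiseLaw D W σ) (a : Fin dx) :
    ∫ x, x a ∂D = 0 := by
  have h := (EuclideanSpace.proj (𝕜 := ℝ) a : Vec dx →L[ℝ] ℝ).integral_comp_comm
    (hD.integrable_of_continuous_single continuous_id)
  have hc := hD.centred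
  simp only [id_eq] at h
  rw [hc] at h
  simpa using h

lemma NoiseLaw.integral_dotProduct [IsProbabilityMeasure D] (hD : NoiseLaw D W σ)
    (c : Fin dx → ℝ) : ∫ x, c ⬝ᵥ x.ofLp ∂D = 0 := by
  simp only [dotProduct]
  rw [integral_finsetSum _ fun a _ => hD.integrable_of_continuous_single (by fun_prop)]
  simp [integral_const_mul, hD.integral_apply]

lemma NoiseLaw.le_integral_dotProduct_sq [IsProbabilityMeasure D] (hD : NoiseLaw D W σ)
    (c : Fin dx → ℝ) : σ ^ 2 * (c ⬝ᵥ c) ≤ ∫ x, (c ⬝ᵥ x.ofLp) ^ 2 ∂D := by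
  have h := hD.covariance.dotProduct_mulVec_nonneg c
  have h1 : ∫ x, (c ⬝ᵥ x.ofLp) ^ 2 ∂D
      = c ⬝ᵥ ((Matrix.of fun a b => ∫ x, x a * x b ∂D : Matrix (Fin dx) (Fin dx) ℝ) *ᵥ c) := by
    have h2 : ∀ x : Vec dx, (c ⬝ᵥ x.ofLp) ^ 2 = ∑ a, ∑ b, c a * c b * (x a * x b) := fun x => by
      rw [dotProduct, sq, Finset.sum_mul_sum]
      exact Finset.sum_congr rfl fun a _ => Finset.sum_congr rfl fun b _ => by ring
    simp only [h2]
    rw [integral_finsetSum _ fun a _ => hD.integrable_of_continuous_single (by fun_prop)]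
    rw [dotProduct]
    refine Finset.sum_congr rfl fun a _ => ?_
    rw [integral_finsetSum _ fun b _ => hD.integrable_of_continuous_single (by fun_prop),
      Matrix.mulVec, dotProduct, Finset.mul_sum]
    refine Finset.sum_congr rfl fun b _ => ?_
    rw [integral_const_mul, Matrix.of_apply]
    ring
  rw [h1]
  simp only [star_trivial, Matrix.sub_mulVec, Matrix.smul_mulVec, Matrix.one_mulVec,
    dotProduct_sub, dotProduct_smul, smul_eq_mul] at h
  linarith

/-- A linear combination of independent noises vanishes only if its coefficients do. -/
lemma NoiseLaw.eq_zero_of_sum_dotProduct_eq_zero [IsProbabilityMeasure D] (hD : NoiseLaw D W σ)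
    (hσ : 0 < σ) {N : ℕ} (c : Fin N → Fin dx → ℝ)
    (hc : ∀ᵐ n ∂(Measure.pi fun _ : Fin N => D), ∑ i, c i ⬝ᵥ (n i).ofLp = 0) (i : Fin N) :
    c i = 0 := by
  set μ := Measure.pi fun _ : Fin N => D with hμ
  set X : Fin N → (Fin N → Vec dx) → ℝ := fun i n => c i ⬝ᵥ (n i).ofLp with hX
  have hg : ∀ i, Continuous fun x : Vec dx => c i ⬝ᵥ x.ofLp := fun i => by
    simp only [dotProduct]; fun_prop
  have hXc : ∀ i, Continuous (X i) := fun i => (hg i).comp (continuous_apply i)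
  have hXm : ∀ i, MemLp (X i) 2 μ := fun i => by
    rw [memLp_two_iff_integrable_sq (hXc i).aestronglyMeasurable]
    exact hD.integrable_of_continuous ((hXc i).pow 2)
  have hind : iIndepFun X μ := iIndepFun_pi fun i => (hg i).measurable.aemeasurable
  -- By independence the variance of the sum, which is zero, is the sum of the variances, so each
  -- summand has variance zero. The covariance bound then forces σ² |c i|² ≤ 0.
  have hvar := IndepFun.variance_sum (s := Finset.univ) (fun i _ => hXm i)
    fun i _ j _ hij => hind.indepFun hij
  have hzero : Var[∑ i, X i; μ] = 0 := by
    rw [variance_congr (Y := 0), variance_zero]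
    filter_upwards [hc] with n hn
    simpa [hX] using hn
  rw [hzero] at hvar
  have hi := (Finset.sum_eq_zero_iff_of_nonneg fun i _ => variance_nonneg (X i) μ).1 hvar.symm i
    (Finset.mem_univ i)
  have hmp := measurePreserving_eval (fun _ : Fin N => D) i
  have hint : ∀ g : Vec dx → ℝ, Continuous g → ∫ n, g (n i) ∂μ = ∫ x, g x ∂D := fun g hgc => by
    rw [← hmp.map_eq, integral_map hmp.measurable.aemeasurable hgc.aestronglyMeasurable]
  have h1 : ∫ n, X i n ∂μ = 0 := (hint _ (hg i)).trans (hD.integral_dotProduct (c i))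
  rw [variance_eq_integral (hXm i).aestronglyMeasurable.aemeasurable, h1] at hi
  simp only [sub_zero] at hi
  have h2 := hD.le_integral_dotProduct_sq (c i)
  rw [← hint (fun x => (c i ⬝ᵥ x.ofLp) ^ 2) ((hg i).pow 2)] at h2
  have h3 : 0 ≤ c i ⬝ᵥ c i := by
    simp only [dotProduct]; exact Finset.sum_nonneg fun _ _ => mul_self_nonneg _
  have h4 : c i ⬝ᵥ c i = 0 := by
    have : σ ^ 2 * (c i ⬝ᵥ c i) ≤ 0 := h2.trans hi.le
    nlinarith [pow_pos hσ 2]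
  exact dotProduct_self_eq_zero.1 h4

end Noise

/-! ### The preconditioner as the second moment of the tangent map. -/

section Gram

variable (A : Matrix (Fin dx) (Fin dx) ℝ) (B : Matrix (Fin dx) (Fin du) ℝ)
  (K₀ : Matrix (Fin du) (Fin dx) ℝ)

/-- The linear part of the affine map `M ↦ z(M)`. -/
noncomputable def tangent (n : Fin (2 * H + 1) → Vec dx) :
    Policy H dx du →ₗ[ℝ] (Fin dx ⊕ Fin du → ℝ) where
  toFun M := surrogatePair A B K₀ M n - surrogatePair A B K₀ 0 n
  map_add' M N := by
    have hy := response_add_sub (A - B * K₀) B M N (extend n)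
    have hv := input_add M N (extend n)
    have h0 : input (0 : Policy H dx du) (extend n) = 0 := by
      simpa using input_smul 0 (0 : Policy H dx du) (extend n)
    ext (a | a)
    · have := congrArg (fun x : Vec dx => x a) hy
      simpa [surrogatePair, surrogateState_eq] using this
    · have := congrArg (fun x : Vec du => x a) (congrArg (fun x => -app K₀ x) hy)
      simp only [app_add, app_sub] at this
      simp [surrogatePair, surrogateAction_eq, hv, h0] at this ⊢
      linarith
  map_smul' r M := by
    have hy := response_smul_sub (A - B * K₀) B r M (extend n)
    have hv := input_smul r M (extend n)
    have h0 : input (0 : Policy H dx du) (extend n) = 0 := by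
      simpa using input_smul 0 (0 : Policy H dx du) (extend n)
    ext (a | a)
    · have := congrArg (fun x : Vec dx => x a) hy
      simpa [surrogatePair, surrogateState_eq] using this
    · have := congrArg (fun x : Vec du => x a) (congrArg (fun x => -app K₀ x) hy)
      simp only [app_smul, app_sub] at this
      simp [surrogatePair, surrogateAction_eq, hv, h0] at this ⊢
      linarith

lemma jacobian_mulVec (n : Fin (2 * H + 1) → Vec dx) (V : Policy H dx du) :
    jacobian A B K₀ n *ᵥ V.ofLp = tangent A B K₀ n V := by
  have hV : V = ∑ p, V p • (EuclideanSpace.single p 1 : Policy H dx du) := by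
    ext q
    simp [Finset.sum_apply, Pi.single_apply]
  conv_rhs => rw [hV, map_sum]
  ext ρ
  simp [Matrix.mulVec, dotProduct, jacobian, tangent, mul_comm]

lemma surrogatePair_eq_add (n : Fin (2 * H + 1) → Vec dx) (V : Policy H dx du) :
    surrogatePair A B K₀ V n = surrogatePair A B K₀ 0 n + jacobian A B K₀ n *ᵥ V.ofLp := by
  rw [jacobian_mulVec]
  simp [tangent]

lemma surrogatePair_dotProduct_self (n : Fin (2 * H + 1) → Vec dx) (V : Policy H dx du) :
    surrogatePair A B K₀ V n ⬝ᵥ surrogatePair A B K₀ V n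
      = ‖surrogateState A B K₀ V n‖ ^ 2 + ‖surrogateAction A B K₀ V n‖ ^ 2 := by
  rw [EuclideanSpace.real_norm_sq_eq, EuclideanSpace.real_norm_sq_eq]
  simp [surrogatePair, dotProduct, sq]

lemma continuous_surrogatePair (V : Policy H dx du) (ρ : Fin dx ⊕ Fin du) :
    Continuous fun n => surrogatePair A B K₀ V n ρ := by
  have hy : Continuous fun n : Fin (2 * H + 1) → Vec dx => surrogateState A B K₀ V n := by
    simp only [surrogateState_eq]
    exact continuous_response _ _ _ continuous_extend
  have hv : Continuous fun n : Fin (2 * H + 1) → Vec dx => surrogateAction A B K₀ V n := by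
    have h := ((continuous_app K₀).comp hy).neg.add (continuous_input V continuous_extend)
    refine h.congr fun n => ?_
    rw [surrogateAction_eq, ← surrogateState_eq]
    rfl
  rcases ρ with a | a
  · simp only [surrogatePair, Sum.elim_inl]; fun_prop
  · simp only [surrogatePair, Sum.elim_inr]; fun_prop

lemma continuous_jacobian (ρ : Fin dx ⊕ Fin du) (p : Fin H × Fin du × Fin dx) :
    Continuous fun n => jacobian A B K₀ n ρ p :=
  (continuous_surrogatePair A B K₀ _ ρ).sub (continuous_surrogatePair A B K₀ _ ρ)

variable [IsProbabilityMeasure D]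

/-- Vᵀ E[JᵀJ] V = E‖JV‖². All later estimates in the P-norm go through this probabilistic form. -/
lemma sqNorm_gram (hD : NoiseLaw D W σ) (V : Policy H dx du) :
    sqNorm (gram H A B K₀ D) V
      = ∫ n, (jacobian A B K₀ n *ᵥ V.ofLp) ⬝ᵥ (jacobian A B K₀ n *ᵥ V.ofLp)
          ∂(Measure.pi fun _ : Fin (2 * H + 1) => D) := by
  have hc := continuous_jacobian (H := H) A B K₀
  have hJ : ∀ p q, Continuous fun n : Fin (2 * H + 1) → Vec dx =>
      ((jacobian A B K₀ n)ᵀ * jacobian A B K₀ n) p q := by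
    intro p q
    simp only [Matrix.mul_apply, Matrix.transpose_apply]
    fun_prop
  have h1 : ∀ n, (jacobian A B K₀ n *ᵥ V.ofLp) ⬝ᵥ (jacobian A B K₀ n *ᵥ V.ofLp)
      = ∑ p, ∑ q, V p * V q * ((jacobian A B K₀ n)ᵀ * jacobian A B K₀ n) p q := by
    intro n
    rw [Matrix.dotProduct_mulVec, ← Matrix.mulVec_transpose, Matrix.mulVec_mulVec,
      dotProduct_comm, dotProduct]
    refine Finset.sum_congr rfl fun p _ => ?_
    rw [Matrix.mulVec, dotProduct, Finset.mul_sum]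
    exact Finset.sum_congr rfl fun q _ => by ring
  simp only [h1]
  rw [integral_finsetSum _ fun p _ => hD.integrable_of_continuous
    (by exact continuous_finsetSum _ fun q _ => continuous_const.mul (hJ p q)), sqNorm, dotProduct]
  refine Finset.sum_congr rfl fun p _ => ?_
  rw [integral_finsetSum _ fun q _ => hD.integrable_of_continuous
    (by exact continuous_const.mul (hJ p q)), Matrix.mulVec, dotProduct, Finset.mul_sum]
  refine Finset.sum_congr rfl fun q _ => ?_
  rw [integral_const_mul, gram, Matrix.of_apply]
  ring

/-- Expand the square of z(V) = z(0) + JV and integrate. The quadratic part is exactly the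
preconditioner, which is why preconditioning makes the landscape isotropic. -/
lemma integral_surrogatePair_dotProduct_self (hD : NoiseLaw D W σ) :
    ∃ (c₀ : ℝ) (b : Fin H × Fin du × Fin dx → ℝ), ∀ V : Policy H dx du,
      ∫ n, surrogatePair A B K₀ V n ⬝ᵥ surrogatePair A B K₀ V n
        ∂(Measure.pi fun _ : Fin (2 * H + 1) => D)
      = c₀ + 2 * (b ⬝ᵥ V.ofLp) + sqNorm (gram H A B K₀ D) V := by
  have hz := continuous_surrogatePair (H := H) A B K₀
  have hJ := continuous_jacobian (H := H) A B K₀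
  refine ⟨∫ n, surrogatePair A B K₀ (0 : Policy H dx du) n ⬝ᵥ surrogatePair A B K₀ 0 n
      ∂(Measure.pi fun _ : Fin (2 * H + 1) => D),
    fun p => ∫ n, (surrogatePair A B K₀ (0 : Policy H dx du) n ᵥ* jacobian A B K₀ n) p
      ∂(Measure.pi fun _ : Fin (2 * H + 1) => D), fun V => ?_⟩
  have hb : ∀ p, Continuous fun n =>
      (surrogatePair A B K₀ (0 : Policy H dx du) n ᵥ* jacobian A B K₀ n) p := fun p => by
    simp only [Matrix.vecMul, dotProduct]
    fun_prop
  have hJV : ∀ ρ, Continuous fun n => (jacobian A B K₀ n *ᵥ V.ofLp) ρ := fun ρ => by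
    simp only [Matrix.mulVec, dotProduct]
    fun_prop
  have h1 : ∀ n, surrogatePair A B K₀ V n ⬝ᵥ surrogatePair A B K₀ V n
      = surrogatePair A B K₀ (0 : Policy H dx du) n ⬝ᵥ surrogatePair A B K₀ 0 n
        + 2 * ∑ p, (surrogatePair A B K₀ (0 : Policy H dx du) n ᵥ* jacobian A B K₀ n) p * V p
        + (jacobian A B K₀ n *ᵥ V.ofLp) ⬝ᵥ (jacobian A B K₀ n *ᵥ V.ofLp) := by
    intro n
    have h2 : ∑ p, (surrogatePair A B K₀ (0 : Policy H dx du) n ᵥ* jacobian A B K₀ n) p * V p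
        = surrogatePair A B K₀ (0 : Policy H dx du) n ⬝ᵥ (jacobian A B K₀ n *ᵥ V.ofLp) := by
      rw [Matrix.dotProduct_mulVec]
      rfl
    rw [h2, surrogatePair_eq_add, add_dotProduct, dotProduct_add, dotProduct_add,
      dotProduct_comm (jacobian A B K₀ n *ᵥ V.ofLp) (surrogatePair A B K₀ 0 n)]
    ring
  have i1 := hD.integrable_of_continuous (N := 2 * H + 1) (f := fun n =>
    surrogatePair A B K₀ (0 : Policy H dx du) n ⬝ᵥ surrogatePair A B K₀ 0 n)
    (by simp only [dotProduct]; fun_prop)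
  have i2 := hD.integrable_of_continuous (N := 2 * H + 1) (f := fun n =>
    2 * ∑ p, (surrogatePair A B K₀ (0 : Policy H dx du) n ᵥ* jacobian A B K₀ n) p * V p)
    (by fun_prop)
  have i3 := hD.integrable_of_continuous (N := 2 * H + 1) (f := fun n =>
    (jacobian A B K₀ n *ᵥ V.ofLp) ⬝ᵥ (jacobian A B K₀ n *ᵥ V.ofLp))
    (by simp only [dotProduct]; fun_prop)
  simp only [h1]
  rw [integral_add (by exact i1.add i2) i3, integral_add i1 i2, sqNorm_gram A B K₀ hD,
    integral_const_mul, integral_finsetSum _ fun p _ => hD.integrable_of_continuous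
      (by exact (hb p).mul continuous_const)]
  simp only [integral_mul_const, dotProduct]

/-- The second moment of the disturbance action is controlled by the norm of the preconditioner. -/
lemma integral_norm_input_sq_le (hD : NoiseLaw D W σ) (V : Policy H dx du) :
    ∫ n, ‖input V (extend n)‖ ^ 2 ∂(Measure.pi fun _ : Fin (2 * H + 1) => D)
      ≤ (1 + ‖K₀‖ ^ 2) * sqNorm (gram H A B K₀ D) V := by
  have hJ := continuous_jacobian (H := H) A B K₀
  have hJV : ∀ ρ, Continuous fun n => (jacobian A B K₀ n *ᵥ V.ofLp) ρ := fun ρ => by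
    simp only [Matrix.mulVec, dotProduct]
    fun_prop
  rw [sqNorm_gram A B K₀ hD, ← integral_const_mul]
  refine integral_mono (hD.integrable_of_continuous
    ((continuous_input V continuous_extend).norm.pow 2)) (hD.integrable_of_continuous
      (by simp only [dotProduct]; fun_prop)) fun n => ?_
  set y : Vec dx := surrogateState A B K₀ V n - surrogateState A B K₀ 0 n with hy
  set v : Vec du := surrogateAction A B K₀ V n - surrogateAction A B K₀ 0 n with hv
  have h0 : input (0 : Policy H dx du) (extend n) = 0 := by
    simpa using input_smul 0 (0 : Policy H dx du) (extend n)
  -- The disturbance action is recovered from the variations y of the state and v of the action,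
  -- because v = -K₀ y + input. Cauchy–Schwarz then gives the factor 1 + ‖K₀‖².
  have h1 : input V (extend n) = v + app K₀ y := by
    rw [hv, hy, surrogateAction_eq, surrogateAction_eq, h0, ← surrogateState_eq,
      ← surrogateState_eq, app_sub]
    abel
  have h2 : (jacobian A B K₀ n *ᵥ V.ofLp) ⬝ᵥ (jacobian A B K₀ n *ᵥ V.ofLp)
      = ‖y‖ ^ 2 + ‖v‖ ^ 2 := by
    rw [jacobian_mulVec, EuclideanSpace.real_norm_sq_eq, EuclideanSpace.real_norm_sq_eq]
    simp [tangent, surrogatePair, dotProduct, sq, hy, hv]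
  have h3 : ‖input V (extend n)‖ ≤ ‖v‖ + ‖K₀‖ * ‖y‖ := by
    rw [h1]
    exact (norm_add_le _ _).trans (add_le_add_right (norm_app_le _ _) _)
  dsimp only
  rw [h2]
  calc ‖input V (extend n)‖ ^ 2 ≤ (‖v‖ + ‖K₀‖ * ‖y‖) ^ 2 :=
        pow_le_pow_left₀ (norm_nonneg _) h3 2
    _ ≤ (1 + ‖K₀‖ ^ 2) * (‖y‖ ^ 2 + ‖v‖ ^ 2) := by nlinarith [sq_nonneg (‖y‖ - ‖K₀‖ * ‖v‖)]

/-- If the quadratic form fails to be positive at V, the disturbance action of V vanishes almost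
surely. It is a linear combination of independent nondegenerate noises, so every block of V is zero.
-/
lemma gram_posDef (hD : NoiseLaw D W σ) (hσ : 0 < σ) : (gram H A B K₀ D).PosDef := by
  have hsymm : (gram H A B K₀ D).IsHermitian := by
    ext p q
    simp only [Matrix.conjTranspose_apply, star_trivial, gram, Matrix.of_apply]
    refine integral_congr_ae (Filter.Eventually.of_forall fun n => ?_)
    simp only [Matrix.mul_apply, Matrix.transpose_apply]
    exact Finset.sum_congr rfl fun _ _ => mul_comm _ _
  refine Matrix.PosDef.of_dotProduct_mulVec_pos hsymm fun x hx => ?_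
  set V : Policy H dx du := WithLp.toLp 2 x with hV
  have hsq : star x ⬝ᵥ (gram H A B K₀ D *ᵥ x) = sqNorm (gram H A B K₀ D) V := by
    rw [star_trivial]; rfl
  rw [hsq]
  have hle := integral_norm_input_sq_le A B K₀ hD V
  have hK : 0 < 1 + ‖K₀‖ ^ 2 := by positivity
  by_contra hneg
  apply hx
  have hi : ∫ n, ‖input V (extend n)‖ ^ 2 ∂(Measure.pi fun _ : Fin (2 * H + 1) => D) = 0 := by
    refine le_antisymm (hle.trans (mul_nonpos_of_nonneg_of_nonpos hK.le (not_lt.1 hneg))) ?_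
    exact integral_nonneg fun n => sq_nonneg _
  rw [integral_eq_zero_iff_of_nonneg (fun n => sq_nonneg _) (hD.integrable_of_continuous
    ((continuous_input V continuous_extend).norm.pow 2))] at hi
  have hblock : ∀ (i : Fin (2 * H + 1)) (a : Fin du), block V i a = 0 := by
    intro i a
    refine hD.eq_zero_of_sum_dotProduct_eq_zero hσ (fun i : Fin (2 * H + 1) => block V i a) ?_ i
    filter_upwards [hi] with n hn
    have h1 : input V (extend n) = 0 := by simpa using hn
    -- Padding with the zero blocks beyond H writes the action as a combination of all 2H+1 noises.
    have h2 : input V (extend n) = ∑ i : Fin (2 * H + 1), app (block V i) (n i) := by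
      have h3 : ∑ i : Fin (2 * H + 1), app (block V i) (n i)
          = ∑ i ∈ Finset.range (2 * H + 1), app (block V i) (extend n i) := by
        rw [Finset.sum_range]
        refine Finset.sum_congr rfl fun i _ => ?_
        rw [extend, dif_pos i.2]
      rw [h3, ← Finset.sum_range_add_sum_Ico _ (show H ≤ 2 * H + 1 by omega),
        Finset.sum_eq_zero (s := Finset.Ico _ _), add_zero, input]
      intro i hi
      rw [block_of_le (Finset.mem_Ico.1 hi).1, zero_app]
    rw [h2] at h1
    have h4 := congrArg (fun x : Vec du => x a) h1
    simpa [app_ofLp, Matrix.mulVec] using h4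
  funext p
  have h5 := congrFun (hblock ⟨p.1.1, by omega⟩ p.2.1) p.2.2
  simpa [block, hV] using h5

end Gram

end OnlineControl

/-! ### Standing assumptions. -/

namespace OnlineControl

variable {H dx du : ℕ}

/-- The standing assumptions on the system, the stabilising controller and the constants. -/
structure StableSystem (A : Matrix (Fin dx) (Fin dx) ℝ) (B : Matrix (Fin dx) (Fin du) ℝ)
    (K₀ : Matrix (Fin du) (Fin dx) ℝ) (κ γ κB : ℝ) : Prop where
  one_le : 1 ≤ κ
  pos : 0 < γ
  lt_one : γ < 1
  norm_le : ‖B‖ ≤ κB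
  two_le : 2 ≤ κB * (1 - γ)
  stable : DiagStronglyStable A B κ γ K₀

/-- The constant in terms of which all bounds are stated. -/
noncomputable def scale (κ γ κB : ℝ) : ℝ := κ * κB * γ⁻¹

variable {A : Matrix (Fin dx) (Fin dx) ℝ} {B : Matrix (Fin dx) (Fin du) ℝ}
  {K₀ K : Matrix (Fin du) (Fin dx) ℝ} {κ γ κB W : ℝ}

lemma state_linearCtrl_eq_sum (K : Matrix (Fin du) (Fin dx) ℝ) (w : ℕ → Vec dx) (t : ℕ) :
    state A B (linearCtrl K w) w (t + 1)
      = ∑ j ∈ Finset.range t, app ((A - B * K) ^ j) (w (t - j)) := by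
  refine eq_sum_of_recursion (x := state A B (linearCtrl K w) w) rfl (fun t => ?_) t
  rw [state_succ K, linearCtrl, neg_add_cancel, app_zero, zero_add]

namespace StableSystem

/-! ### Absorbing all constants into powers of one scale. -/

section Scale

lemma two_le_bound (h : StableSystem A B K₀ κ γ κB) : 2 ≤ κB := by
  have h1 := h.pos; have h2 := h.two_le; have h3 := h.lt_one
  have : 0 < κB := by
    by_contra hc
    nlinarith
  nlinarith

lemma one_le_inv (h : StableSystem A B K₀ κ γ κB) : 1 ≤ γ⁻¹ := (one_le_inv₀ h.pos).2 h.lt_one.le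

lemma two_le_scale (h : StableSystem A B K₀ κ γ κB) : 2 ≤ scale κ γ κB := by
  have h1 := h.one_le; have h2 := h.two_le_bound; have h3 := h.one_le_inv
  have : 2 ≤ κ * κB := by nlinarith
  unfold scale
  nlinarith

lemma two_mul_mul_inv_le_scale (h : StableSystem A B K₀ κ γ κB) : 2 * κ * γ⁻¹ ≤ scale κ γ κB := by
  have h1 := h.one_le; have h2 := h.two_le_bound; have h3 := h.one_le_inv
  unfold scale
  have : 2 * κ ≤ κ * κB := by nlinarith
  gcongr

lemma two_mul_le_scale (h : StableSystem A B K₀ κ γ κB) : 2 * κ ≤ scale κ γ κB := by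
  have h1 := h.one_le; have h3 := h.one_le_inv
  refine le_trans ?_ h.two_mul_mul_inv_le_scale
  nlinarith

lemma le_scale (h : StableSystem A B K₀ κ γ κB) : κ ≤ scale κ γ κB := by
  have h1 := h.one_le; have h2 := h.two_mul_le_scale
  linarith

lemma bound_le_scale (h : StableSystem A B K₀ κ γ κB) : κB ≤ scale κ γ κB := by
  have h1 := h.one_le; have h2 := h.two_le_bound; have h3 := h.one_le_inv
  unfold scale
  have : κB ≤ κ * κB := by nlinarith
  nlinarith

lemma pow_le_pow (h : StableSystem A B K₀ κ γ κB) {m n : ℕ} (hmn : m ≤ n)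
    : scale κ γ κB ^ m ≤ scale κ γ κB ^ n :=
  pow_le_pow_right₀ (by linarith [h.two_le_scale]) hmn

lemma pow_add_one_le (h : StableSystem A B K₀ κ γ κB)
    {n : ℕ} : scale κ γ κB ^ n + 1 ≤ scale κ γ κB ^ (n + 1) := by
  have h1 := h.two_le_scale
  have h2 : 1 ≤ scale κ γ κB ^ n := one_le_pow₀ (by linarith)
  rw [pow_succ]
  nlinarith

lemma policy_bound_le (h : StableSystem A B K₀ κ γ κB) : κ ^ 3 * κB * γ⁻¹ ≤ scale κ γ κB ^ 3 := by
  have h1 := h.one_le; have h2 := h.two_le_scale; have h3 := h.le_scale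
  calc κ ^ 3 * κB * γ⁻¹ = κ ^ 2 * scale κ γ κB := by unfold scale; ring
    _ ≤ scale κ γ κB ^ 2 * scale κ γ κB := by gcongr
    _ = scale κ γ κB ^ 3 := by ring

lemma sq_mul_inv_le (h : StableSystem A B K₀ κ γ κB) : κ ^ 2 * γ⁻¹ ≤ scale κ γ κB ^ 2 := by
  have h1 := h.one_le; have h2 := h.two_le_scale; have h3 := h.le_scale
  have h4 := h.two_mul_mul_inv_le_scale; have h5 := h.one_le_inv
  calc κ ^ 2 * γ⁻¹ = κ * (κ * γ⁻¹) := by ring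
    _ ≤ scale κ γ κB * scale κ γ κB := by
        gcongr
        nlinarith [mul_nonneg (by linarith : (0:ℝ) ≤ κ) (by linarith : (0:ℝ) ≤ γ⁻¹)]
    _ = scale κ γ κB ^ 2 := by ring

/-- With z the scale, actions are at most z³W. The exponent 7 is 2 from κ²γ⁻¹ ≤ z² plus 5 from κB z³
+ 1 ≤ z⁵. -/
lemma response_bound_le (h : StableSystem A B K₀ κ γ κB) (hW : 0 ≤ W) :
    κ ^ 2 * (κB * (scale κ γ κB ^ 3 * W) + W) * γ⁻¹ ≤ scale κ γ κB ^ 7 * W := by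
  have h1 := h.two_le_bound; have h2 := h.two_le_scale; have h3 := h.bound_le_scale
  have h4 := h.sq_mul_inv_le; have h5 := h.one_le_inv
  have h6 : κB * scale κ γ κB ^ 3 + 1 ≤ scale κ γ κB ^ 5 :=
    calc κB * scale κ γ κB ^ 3 + 1 ≤ scale κ γ κB * scale κ γ κB ^ 3 + 1 := by gcongr
      _ = scale κ γ κB ^ 4 + 1 := by ring
      _ ≤ scale κ γ κB ^ 5 := h.pow_add_one_le
  calc κ ^ 2 * (κB * (scale κ γ κB ^ 3 * W) + W) * γ⁻¹
      = (κ ^ 2 * γ⁻¹) * (κB * scale κ γ κB ^ 3 + 1) * W := by ring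
    _ ≤ scale κ γ κB ^ 2 * scale κ γ κB ^ 5 * W := by gcongr
    _ = scale κ γ κB ^ 7 * W := by ring

/-- The left side is the Lipschitz constant from disturbance actions to states and full actions
together, both summed over time. -/
lemma comparison_bound_le (h : StableSystem A B K₀ κ γ κB) : (1 + κ) * (κ ^ 2 * γ⁻¹ * κB)
    + 1 ≤ scale κ γ κB ^ 5 := by
  have h1 := h.one_le; have h2 := h.two_le_scale; have h3 := h.le_scale
  have h4 := h.two_mul_le_scale
  calc (1 + κ) * (κ ^ 2 * γ⁻¹ * κB) + 1 = (1 + κ) * (κ * scale κ γ κB) + 1 := by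
        unfold scale; ring
    _ ≤ scale κ γ κB * (scale κ γ κB * scale κ γ κB) + 1 := by
        gcongr
        linarith
    _ = scale κ γ κB ^ 3 + 1 := by ring
    _ ≤ scale κ γ κB ^ 4 := h.pow_add_one_le
    _ ≤ scale κ γ κB ^ 5 := h.pow_le_pow (by norm_num)

/-- Passing from a bound on the state to a bound on the action. -/
lemma action_bound_le (h : StableSystem A B K₀ κ γ κB) (hW : 0 ≤ W)
    {x : Vec dx} {a : Vec du} (hx : ‖x‖ ≤ scale κ γ κB ^ 7 * W)
    (ha : ‖a‖ ≤ scale κ γ κB ^ 3 * W) : ‖-app K₀ x + a‖ ≤ scale κ γ κB ^ 9 * W := by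
  have h2 := h.two_le_scale
  refine (norm_add_le _ _).trans ?_
  rw [norm_neg]
  calc ‖app K₀ x‖ + ‖a‖ ≤ scale κ γ κB * (scale κ γ κB ^ 7 * W) + scale κ γ κB ^ 3 * W :=
        add_le_add (norm_app_le_of_le (h.stable.norm_le.trans h.le_scale) hx) ha
    _ ≤ scale κ γ κB ^ 8 * W + scale κ γ κB ^ 8 * W := by
        have := mul_le_mul_of_nonneg_right (h.pow_le_pow (show 3 ≤ 8 by norm_num)) hW
        nlinarith
    _ ≤ scale κ γ κB ^ 9 * W := by
        have : 0 ≤ scale κ γ κB ^ 8 * W := by positivity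
        nlinarith

end Scale

/-! ### Uniform bounds on states and actions. -/

section Bounds

lemma norm_input_le (h : StableSystem A B K₀ κ γ κB)
    {M : Policy H dx du} (hM : M ∈ policySet H dx du κ κB γ) (hW : 0 ≤ W)
    {n : ℕ → Vec dx} (hn : ∀ i, ‖n i‖ ≤ W) : ‖input M n‖ ≤ scale κ γ κB ^ 3 * W := by
  have h1 := h.one_le; have h2 := h.two_le_bound
  have hc : 0 ≤ κ ^ 3 * κB := by positivity
  exact (OnlineControl.norm_input_le h.pos h.lt_one hc hW
    (norm_block_le_of_mem hM hc h.pos.le h.lt_one) hn).trans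
      (mul_le_mul_of_nonneg_right h.policy_bound_le hW)

lemma norm_response_le (h : StableSystem A B K₀ κ γ κB)
    {M : Policy H dx du} (hM : M ∈ policySet H dx du κ κB γ) (hW : 0 ≤ W)
    {n : ℕ → Vec dx} (hn : ∀ i, ‖n i‖ ≤ W) :
    ‖response (A - B * K₀) B M n‖ ≤ scale κ γ κB ^ 7 * W :=
  (OnlineControl.norm_response_le h.pos h.lt_one (h.stable.norm_pow_le h.one_le) h.norm_le hn
    fun _ => h.norm_input_le hM hW fun _ => hn _).trans (h.response_bound_le hW)

/-- Weakened to the ninth power, so that states and actions, surrogate or true, share the bound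
required by the cost comparisons. -/
lemma norm_response_le' (h : StableSystem A B K₀ κ γ κB)
    {M : Policy H dx du} (hM : M ∈ policySet H dx du κ κB γ) (hW : 0 ≤ W)
    {n : ℕ → Vec dx} (hn : ∀ i, ‖n i‖ ≤ W) :
    ‖response (A - B * K₀) B M n‖ ≤ scale κ γ κB ^ 9 * W :=
  (h.norm_response_le hM hW hn).trans
    (mul_le_mul_of_nonneg_right (h.pow_le_pow (by norm_num)) hW)

lemma norm_response_action_le (h : StableSystem A B K₀ κ γ κB)
    {M : Policy H dx du} (hM : M ∈ policySet H dx du κ κB γ)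
    (hW : 0 ≤ W) {n : ℕ → Vec dx} (hn : ∀ i, ‖n i‖ ≤ W) :
    ‖-app K₀ (response (A - B * K₀) B M n) + input M n‖ ≤ scale κ γ κB ^ 9 * W :=
  h.action_bound_le hW (h.norm_response_le hM hW hn) (h.norm_input_le hM hW hn)

lemma norm_state_policyCtrl_le_pow_seven (h : StableSystem A B K₀ κ γ κB)
    {M : ℕ → Policy H dx du} {T : ℕ}
    (hM : ∀ t, 1 ≤ t → t ≤ T → M t ∈ policySet H dx du κ κB γ) (hW : 0 ≤ W) {w : ℕ → Vec dx}
    (hw : ∀ s, ‖w s‖ ≤ W) {t : ℕ} (ht : 1 ≤ t) (htT : t ≤ T) :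
    ‖state A B (policyCtrl K₀ M w) w t‖ ≤ scale κ γ κB ^ 7 * W := by
  have h1 := h.two_le_bound; have h2 := h.two_le_scale
  obtain ⟨t, rfl⟩ := Nat.exists_eq_add_of_le' ht
  have hrec : ∀ t, state A B (policyCtrl K₀ M w) w (t + 2)
      = app (A - B * K₀) (state A B (policyCtrl K₀ M w) w (t + 1))
        + (fun s => app B (input (M s) (history w s)) + w s) (t + 1) := fun t => by
    rw [state_succ K₀, policyCtrl_eq, neg_add_cancel_comm]
  refine (norm_le_of_recursion h.pos h.lt_one (x := state A B (policyCtrl K₀ M w) w)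
    (d := fun s => app B (input (M s) (history w s)) + w s) (b := κB * (scale κ γ κB ^ 3 * W) + W)
    (by positivity) (h.stable.norm_pow_le h.one_le) rfl hrec fun s hs hst => ?_).trans
      (h.response_bound_le hW)
  exact (norm_add_le _ _).trans (add_le_add (norm_app_le_of_le h.norm_le
    (h.norm_input_le (hM s hs (by omega)) hW (norm_history_le hW hw s))) (hw s))

lemma norm_state_policyCtrl_le (h : StableSystem A B K₀ κ γ κB) {M : ℕ → Policy H dx du} {T : ℕ}
    (hM : ∀ t, 1 ≤ t → t ≤ T → M t ∈ policySet H dx du κ κB γ) (hW : 0 ≤ W) {w : ℕ → Vec dx}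
    (hw : ∀ s, ‖w s‖ ≤ W) {t : ℕ} (ht : 1 ≤ t) (htT : t ≤ T) :
    ‖state A B (policyCtrl K₀ M w) w t‖ ≤ scale κ γ κB ^ 9 * W :=
  (h.norm_state_policyCtrl_le_pow_seven hM hW hw ht htT).trans
    (mul_le_mul_of_nonneg_right (h.pow_le_pow (by norm_num)) hW)

lemma norm_policyCtrl_le (h : StableSystem A B K₀ κ γ κB) {M : ℕ → Policy H dx du} {T : ℕ}
    (hM : ∀ t, 1 ≤ t → t ≤ T → M t ∈ policySet H dx du κ κB γ) (hW : 0 ≤ W) {w : ℕ → Vec dx}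
    (hw : ∀ s, ‖w s‖ ≤ W) {t : ℕ} (ht : 1 ≤ t) (htT : t ≤ T) :
    ‖policyCtrl K₀ M w t (state A B (policyCtrl K₀ M w) w t)‖ ≤ scale κ γ κB ^ 9 * W := by
  rw [policyCtrl_eq]
  exact h.action_bound_le hW (h.norm_state_policyCtrl_le_pow_seven hM hW hw ht htT)
    (h.norm_input_le (hM t ht htT) hW (norm_history_le hW hw t))

lemma norm_state_linearCtrl_le (h : StableSystem A B K₀ κ γ κB) (hK : DiagStronglyStable A B κ γ K)
    (hW : 0 ≤ W) {w : ℕ → Vec dx}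
    (hw : ∀ s, ‖w s‖ ≤ W) {t : ℕ} (ht : 1 ≤ t) :
    ‖state A B (linearCtrl K w) w t‖ ≤ scale κ γ κB ^ 2 * W := by
  obtain ⟨t, rfl⟩ := Nat.exists_eq_add_of_le' ht
  refine (norm_le_of_recursion h.pos h.lt_one hW (hK.norm_pow_le h.one_le) rfl
    (d := w) (fun t => ?_) fun s _ _ => hw s).trans (le_trans (le_of_eq ?_)
      (mul_le_mul_of_nonneg_right h.sq_mul_inv_le hW))
  · rw [state_succ K, linearCtrl, neg_add_cancel, app_zero, zero_add]
  · ring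

lemma norm_state_linearCtrl_le' (h : StableSystem A B K₀ κ γ κB)
    (hK : DiagStronglyStable A B κ γ K) (hW : 0 ≤ W)
    {w : ℕ → Vec dx} (hw : ∀ s, ‖w s‖ ≤ W) {t : ℕ} (ht : 1 ≤ t) :
    ‖state A B (linearCtrl K w) w t‖ ≤ scale κ γ κB ^ 9 * W :=
  (h.norm_state_linearCtrl_le hK hW hw ht).trans
    (mul_le_mul_of_nonneg_right (h.pow_le_pow (by norm_num)) hW)

lemma norm_linearCtrl_le (h : StableSystem A B K₀ κ γ κB) (hK : DiagStronglyStable A B κ γ K)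
    (hW : 0 ≤ W) {w : ℕ → Vec dx}
    (hw : ∀ s, ‖w s‖ ≤ W) {t : ℕ} (ht : 1 ≤ t) :
    ‖linearCtrl K w t (state A B (linearCtrl K w) w t)‖ ≤ scale κ γ κB ^ 9 * W := by
  rw [linearCtrl, norm_neg]
  refine (norm_app_le_of_le (hK.norm_le.trans h.le_scale)
    (h.norm_state_linearCtrl_le hK hW hw ht)).trans ?_
  have := mul_le_mul_of_nonneg_right (h.pow_le_pow (show 3 ≤ 9 by norm_num)) hW
  refine le_trans (le_of_eq ?_) this
  ring

end Bounds

/-! ### Comparing trajectories, truncation, and imitation of a linear controller. -/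

section Comparison

lemma abs_norm_sq_sub_le {E : Type*} [SeminormedAddCommGroup E] {x y : E} {b : ℝ} (hx : ‖x‖ ≤ b)
    (hy : ‖y‖ ≤ b) : |‖x‖ ^ 2 - ‖y‖ ^ 2| ≤ 2 * b * ‖x - y‖ := by
  have h1 := abs_norm_sub_norm_le x y
  have h2 : ‖x‖ ^ 2 - ‖y‖ ^ 2 = (‖x‖ + ‖y‖) * (‖x‖ - ‖y‖) := by ring
  rw [h2, abs_mul, abs_of_nonneg (by positivity)]
  exact mul_le_mul (by linarith) h1 (abs_nonneg _) (by linarith [norm_nonneg x])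

lemma abs_sphericalCost_sub_le {r : ℕ → ℝ} {β b : ℝ} {t : ℕ} (hr0 : 0 ≤ r t) (hr : r t ≤ β)
    {x x' : Vec dx} {u u' : Vec du} (hx : ‖x‖ ≤ b) (hx' : ‖x'‖ ≤ b) (hu : ‖u‖ ≤ b)
    (hu' : ‖u'‖ ≤ b) :
    |sphericalCost r t x u - sphericalCost r t x' u'|
      ≤ β * (2 * b) * (‖x - x'‖ + ‖u - u'‖) := by
  have hb : 0 ≤ b := (norm_nonneg x).trans hx
  have h1 : sphericalCost r t x u - sphericalCost r t x' u'
      = r t * ((‖x‖ ^ 2 - ‖x'‖ ^ 2) + (‖u‖ ^ 2 - ‖u'‖ ^ 2)) := by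
    simp only [sphericalCost]; ring
  rw [h1, abs_mul, abs_of_nonneg hr0, mul_assoc]
  refine mul_le_mul hr ?_ (abs_nonneg _) (hr0.trans hr)
  refine (abs_add_le _ _).trans ?_
  linarith [abs_norm_sq_sub_le hx hx', abs_norm_sq_sub_le hu hu', hr0]

/-- Two controllers whose inputs are close have close costs. -/
lemma abs_sum_cost_sub_le (h : StableSystem A B K₀ κ γ κB)
    {r : ℕ → ℝ} {β b : ℝ} {T : ℕ} (hβ : 0 ≤ β) (hb : 0 ≤ b)
    (hr : ∀ t, 1 ≤ t → t ≤ T → r t ∈ Set.Icc 0 β) (ctrl ctrl' : ℕ → Vec dx → Vec du)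
    (w : ℕ → Vec dx)
    (hx : ∀ t, 1 ≤ t → t ≤ T → ‖state A B ctrl w t‖ ≤ b)
    (hu : ∀ t, 1 ≤ t → t ≤ T → ‖ctrl t (state A B ctrl w t)‖ ≤ b)
    (hx' : ∀ t, 1 ≤ t → t ≤ T → ‖state A B ctrl' w t‖ ≤ b)
    (hu' : ∀ t, 1 ≤ t → t ≤ T → ‖ctrl' t (state A B ctrl' w t)‖ ≤ b) :
    |∑ t ∈ Finset.Icc 1 T, sphericalCost r t (state A B ctrl w t) (ctrl t (state A B ctrl w t))
      - ∑ t ∈ Finset.Icc 1 T,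
        sphericalCost r t (state A B ctrl' w t) (ctrl' t (state A B ctrl' w t))|
      ≤ β * (2 * b) * scale κ γ κB ^ 5 * ∑ t ∈ Finset.Icc 1 T,
        ‖(ctrl t (state A B ctrl w t) + app K₀ (state A B ctrl w t))
          - (ctrl' t (state A B ctrl' w t) + app K₀ (state A B ctrl' w t))‖ := by
  set x := state A B ctrl w with hxdef
  set x' := state A B ctrl' w with hxdef'
  set a : ℕ → Vec du := fun t => ctrl t (x t) + app K₀ (x t) with ha
  set a' : ℕ → Vec du := fun t => ctrl' t (x' t) + app K₀ (x' t) with ha'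
  have hκ := h.one_le
  -- Both trajectories see the same noise, which cancels. Their difference obeys the stable
  -- recursion of K₀, driven only by the difference of the additional inputs.
  have hrec : ∀ t, (x - x') (t + 2) = app (A - B * K₀) ((x - x') (t + 1))
      + (fun s => app B (a s - a' s)) (t + 1) := fun t => by
    simp only [Pi.sub_apply, hxdef, hxdef', state_succ K₀]
    simp only [ha, ha', app_sub, hxdef, hxdef']
    abel
  have hS : ∑ t ∈ Finset.Icc 1 T, ‖x t - x' t‖
      ≤ κ ^ 2 * γ⁻¹ * κB * ∑ t ∈ Finset.Icc 1 T, ‖a t - a' t‖ := by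
    have h1 := sum_norm_le_of_recursion h.pos h.lt_one (h.stable.norm_pow_le h.one_le)
      (x := x - x') (d := fun s => app B (a s - a' s)) (by simp [hxdef, hxdef', state]) hrec T
    rw [sum_Icc_one_eq_sum_range, sum_Icc_one_eq_sum_range, mul_assoc]
    refine h1.trans (mul_le_mul_of_nonneg_left ?_ ?_)
    · rw [Finset.mul_sum]
      exact Finset.sum_le_sum fun t _ => norm_app_le_of_le h.norm_le le_rfl
    · have := h.one_le_inv
      positivity
  have hu_sub : ∀ t, ‖ctrl t (x t) - ctrl' t (x' t)‖ ≤ κ * ‖x t - x' t‖ + ‖a t - a' t‖ := by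
    intro t
    have h1 : ctrl t (x t) - ctrl' t (x' t) = (a t - a' t) - app K₀ (x t - x' t) := by
      simp only [ha, ha', app_sub]; abel
    rw [h1]
    refine (norm_sub_le _ _).trans ?_
    linarith [norm_app_le_of_le h.stable.norm_le (le_refl ‖x t - x' t‖)]
  have hA : 0 ≤ ∑ t ∈ Finset.Icc 1 T, ‖a t - a' t‖ := Finset.sum_nonneg fun _ _ => norm_nonneg _
  rw [← Finset.sum_sub_distrib]
  calc _ ≤ ∑ t ∈ Finset.Icc 1 T, β * (2 * b) * ((1 + κ) * ‖x t - x' t‖ + ‖a t - a' t‖) := by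
        refine (Finset.abs_sum_le_sum_abs _ _).trans (Finset.sum_le_sum fun t ht => ?_)
        obtain ⟨h1, h2⟩ := Finset.mem_Icc.1 ht
        refine (abs_sphericalCost_sub_le (hr t h1 h2).1 (hr t h1 h2).2 (hx t h1 h2) (hx' t h1 h2)
          (hu t h1 h2) (hu' t h1 h2)).trans (mul_le_mul_of_nonneg_left ?_ (by positivity))
        linarith [hu_sub t]
    _ = β * (2 * b) * ((1 + κ) * ∑ t ∈ Finset.Icc 1 T, ‖x t - x' t‖
          + ∑ t ∈ Finset.Icc 1 T, ‖a t - a' t‖) := by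
        rw [← Finset.mul_sum, Finset.sum_add_distrib, ← Finset.mul_sum]
    _ ≤ β * (2 * b) * ((1 + κ) * (κ ^ 2 * γ⁻¹ * κB * ∑ t ∈ Finset.Icc 1 T, ‖a t - a' t‖)
          + ∑ t ∈ Finset.Icc 1 T, ‖a t - a' t‖) := by gcongr
    _ = β * (2 * b) * (((1 + κ) * (κ ^ 2 * γ⁻¹ * κB) + 1)
          * ∑ t ∈ Finset.Icc 1 T, ‖a t - a' t‖) := by ring
    _ ≤ β * (2 * b) * (scale κ γ κB ^ 5 * ∑ t ∈ Finset.Icc 1 T, ‖a t - a' t‖) := by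
        gcongr
        exact h.comparison_bound_le
    _ = _ := by ring

/-- Truncating the past: the state is close to its surrogate. -/
lemma norm_state_sub_response_le (h : StableSystem A B K₀ κ γ κB)
    {M : Policy H dx du} (hM : M ∈ policySet H dx du κ κB γ)
    (hW : 0 ≤ W) {w : ℕ → Vec dx} (hw : ∀ s, ‖w s‖ ≤ W) {t : ℕ} (ht : 1 ≤ t) :
    ‖state A B (policyCtrl K₀ (fun _ => M) w) w t - response (A - B * K₀) B M (history w t)‖
      ≤ scale κ γ κB ^ 7 * W * (1 - γ) ^ H := by
  have h1 := h.two_le_bound; have h2 := h.two_le_scale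
  have h0 : 0 ≤ 1 - γ := sub_nonneg.2 h.lt_one.le
  obtain ⟨s, rfl⟩ := Nat.exists_eq_add_of_le' ht
  set F := A - B * K₀ with hF
  -- State and response are partial sums of this one sequence, over j < s and j < H+1. It vanishes
  -- from j = s on because the noise is zero before time 1.
  set f : ℕ → Vec dx := fun j => app (F ^ j)
    (app B (input M fun i => history w (s + 1) (j + 1 + i)) + history w (s + 1) j) with hf
  have hrec : ∀ t, state A B (policyCtrl K₀ (fun _ => M) w) w (t + 2)
      = app F (state A B (policyCtrl K₀ (fun _ => M) w) w (t + 1))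
        + (fun s => app B (input M (history w s)) + w s) (t + 1) := fun t => by
    rw [state_succ K₀, policyCtrl_eq, neg_add_cancel_comm]
  have hstate : state A B (policyCtrl K₀ (fun _ => M) w) w (s + 1)
      = ∑ j ∈ Finset.range s, f j := by
    rw [eq_sum_of_recursion (x := state A B (policyCtrl K₀ (fun _ => M) w) w)
      (d := fun s => app B (input M (history w s)) + w s) rfl hrec]
    refine Finset.sum_congr rfl fun j hj => ?_
    rw [Finset.mem_range] at hj
    have e1 : history w (s + 1) j = w (s - j) := by
      rw [history, if_pos (by omega), Nat.add_sub_cancel]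
    have e2 : input M (fun i => history w (s + 1) (j + 1 + i)) = input M (history w (s - j)) := by
      refine input_congr M fun i _ => ?_
      unfold history
      by_cases hi : i + 1 < s - j
      · rw [if_pos hi, if_pos (by omega)]
        congr 1
        omega
      · rw [if_neg hi, if_neg (by omega)]
    simp only [hf, e1, e2]
  have hbound : ∀ j, ‖f j‖ ≤ κ ^ 2 * (κB * (scale κ γ κB ^ 3 * W) + W) * (1 - γ) ^ j := by
    intro j
    refine (norm_app_le_of_le (h.stable.norm_pow_le h.one_le j) ((norm_add_le _ _).trans
      (add_le_add (norm_app_le_of_le h.norm_le (h.norm_input_le hM hW fun i =>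
        norm_history_le hW hw _ _)) (norm_history_le hW hw _ _)))).trans (le_of_eq ?_)
    ring
  have hzero : ∀ j, s ≤ j → f j = 0 := by
    intro j hj
    have e1 : ∀ i, j ≤ i → history w (s + 1) i = 0 := fun i hi => by
      rw [history, if_neg (by omega)]
    have e2 : input M (fun i => history w (s + 1) (j + 1 + i)) = 0 :=
      Finset.sum_eq_zero fun i _ => by dsimp only; rw [e1 _ (by omega), app_zero]
    simp only [hf, e1 j le_rfl, e2, app_zero, add_zero]
  rw [hstate, response]
  refine (norm_sum_range_sub_sum_range_le h.pos h.lt_one (by positivity) hbound hzero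
    (H + 1)).trans ?_
  calc κ ^ 2 * (κB * (scale κ γ κB ^ 3 * W) + W) * (1 - γ) ^ (H + 1) * γ⁻¹
      = κ ^ 2 * (κB * (scale κ γ κB ^ 3 * W) + W) * γ⁻¹ * (1 - γ) ^ (H + 1) := by ring
    _ ≤ scale κ γ κB ^ 7 * W * (1 - γ) ^ H := by
        refine mul_le_mul (h.response_bound_le hW) ?_ (by positivity) (by positivity)
        exact pow_le_pow_of_le_one h0 (by linarith [h.pos]) (Nat.le_succ H)

/-- The disturbance-action policy that imitates the linear controller `K`. -/
noncomputable def _root_.OnlineControl.imitation (H : ℕ) (A : Matrix (Fin dx) (Fin dx) ℝ)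
    (B : Matrix (Fin dx) (Fin du) ℝ) (K₀ K : Matrix (Fin du) (Fin dx) ℝ) : Policy H dx du :=
  ofBlocks H fun i => (K₀ - K) * (A - B * K) ^ i

lemma norm_imitation_le (h : StableSystem A B K₀ κ γ κB) (hK : DiagStronglyStable A B κ γ K)
    (i : ℕ) :
    ‖(K₀ - K) * (A - B * K) ^ i‖ ≤ 2 * κ ^ 3 * (1 - γ) ^ i := by
  have hκ := h.one_le
  have h1 : ‖K₀ - K‖ ≤ 2 * κ :=
    (norm_sub_le _ _).trans (by linarith [h.stable.norm_le, hK.norm_le])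
  refine (Matrix.l2_opNorm_mul _ _).trans ((mul_le_mul h1 (hK.norm_pow_le h.one_le i)
    (norm_nonneg _) (by positivity)).trans (le_of_eq ?_))
  ring

/-- The blocks are at most 2κ³(1-γ)^(i-1). The assumption κB(1-γ) ≥ 2 pays both for the 2 and for
the missing factor 1 - γ. -/
lemma imitation_mem (h : StableSystem A B K₀ κ γ κB) (hK : DiagStronglyStable A B κ γ K) :
    imitation H A B K₀ K ∈ policySet H dx du κ κB γ := by
  intro i hi
  obtain ⟨h1, h2⟩ := Finset.mem_Icc.1 hi
  have hκ := h.one_le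
  have h0 : 0 ≤ 1 - γ := sub_nonneg.2 h.lt_one.le
  rw [imitation, block_ofBlocks _ (by omega)]
  refine (h.norm_imitation_le hK (i - 1)).trans ?_
  calc 2 * κ ^ 3 * (1 - γ) ^ (i - 1) ≤ (κB * (1 - γ)) * κ ^ 3 * (1 - γ) ^ (i - 1) := by
        gcongr
        exact h.two_le
    _ = κ ^ 3 * κB * (1 - γ) ^ (i - 1 + 1) := by ring
    _ = κ ^ 3 * κB * (1 - γ) ^ i := by rw [Nat.sub_add_cancel h1]

/-- On the trajectory of the linear controller `K`, the imitating policy has almost the inputs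
of `K`. -/
lemma norm_linear_input_sub_le (h : StableSystem A B K₀ κ γ κB) (hK : DiagStronglyStable A B κ γ K)
    (hW : 0 ≤ W)
    {w : ℕ → Vec dx} (hw : ∀ s, ‖w s‖ ≤ W) {t : ℕ} (ht : 1 ≤ t) :
    ‖app (K₀ - K) (state A B (linearCtrl K w) w t)
        - input (imitation H A B K₀ K) (history w t)‖
      ≤ scale κ γ κB ^ 3 * W * (1 - γ) ^ H := by
  have hκ := h.one_le; have hz := h.two_le_scale
  have h0 : 0 ≤ 1 - γ := sub_nonneg.2 h.lt_one.le
  obtain ⟨s, rfl⟩ := Nat.exists_eq_add_of_le' ht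
  -- Relative to K₀, the controller K adds the input (K₀ - K)x. Expanding x in past noises gives
  -- these terms, whose matrices are precisely the blocks of the imitation, so only the truncation
  -- at H is lost.
  set f : ℕ → Vec du := fun j => app ((K₀ - K) * (A - B * K) ^ j) (history w (s + 1) j) with hf
  have h1 : app (K₀ - K) (state A B (linearCtrl K w) w (s + 1)) = ∑ j ∈ Finset.range s, f j := by
    rw [state_linearCtrl_eq_sum, app_sum]
    refine Finset.sum_congr rfl fun j hj => ?_
    rw [Finset.mem_range] at hj
    simp only [hf]
    rw [history, if_pos (by omega), Nat.add_sub_cancel, mul_app]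
  have h2 : input (imitation H A B K₀ K) (history w (s + 1)) = ∑ j ∈ Finset.range H, f j := by
    refine Finset.sum_congr rfl fun j hj => ?_
    rw [imitation, block_ofBlocks _ (Finset.mem_range.1 hj)]
  have h3 : ∀ j, ‖f j‖ ≤ 2 * κ ^ 3 * W * (1 - γ) ^ j := fun j =>
    (norm_app_le_of_le (h.norm_imitation_le hK j) (norm_history_le hW hw _ _)).trans
      (le_of_eq (by ring))
  have h4 : ∀ j, s ≤ j → f j = 0 := fun j hj => by
    simp only [hf]
    rw [history, if_neg (by omega), app_zero]
  rw [h1, h2]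
  refine (norm_sum_range_sub_sum_range_le h.pos h.lt_one (by positivity) h3 h4 H).trans ?_
  calc 2 * κ ^ 3 * W * (1 - γ) ^ H * γ⁻¹ = κ ^ 2 * (2 * κ * γ⁻¹) * (W * (1 - γ) ^ H) := by ring
    _ ≤ scale κ γ κB ^ 2 * scale κ γ κB * (W * (1 - γ) ^ H) := by
        gcongr
        exacts [by have := h.one_le_inv; positivity, h.le_scale, h.two_mul_mul_inv_le_scale]
    _ = scale κ γ κB ^ 3 * W * (1 - γ) ^ H := by ring

end Comparison

end StableSystem

end OnlineControl

namespace OnlineControl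

variable {H dx du : ℕ} {A : Matrix (Fin dx) (Fin dx) ℝ} {B : Matrix (Fin dx) (Fin du) ℝ}
  {K₀ K : Matrix (Fin du) (Fin dx) ℝ} {κ γ κB W σ : ℝ} {D : Measure (Vec dx)}

/-! ### The common surrogate cost and its bounds. -/

section Surrogate

/-- The surrogate cost for the weight `1`. -/
noncomputable def meanSquare (A : Matrix (Fin dx) (Fin dx) ℝ) (B : Matrix (Fin dx) (Fin du) ℝ)
    (K₀ : Matrix (Fin du) (Fin dx) ℝ) (D : Measure (Vec dx)) (M : Policy H dx du) : ℝ :=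
  ∫ n, surrogatePair A B K₀ M n ⬝ᵥ surrogatePair A B K₀ M n
    ∂(Measure.pi fun _ : Fin (2 * H + 1) => D)

/-- Time enters only through the factor `r t`, so the surrogate costs of all rounds have the same
minimizers over the policy set. -/
lemma surrogateCost_sphericalCost (r : ℕ → ℝ) (t : ℕ) (M : Policy H dx du) :
    surrogateCost A B K₀ D (sphericalCost r t) M = r t * meanSquare A B K₀ D M := by
  simp only [surrogateCost, sphericalCost, meanSquare, surrogatePair_dotProduct_self]
  exact integral_const_mul _ _

lemma sphericalCost_mem_Icc {r : ℕ → ℝ} {t : ℕ} {β b : ℝ} (hr : r t ∈ Set.Icc 0 β) {x : Vec dx}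
    {u : Vec du} (hx : ‖x‖ ≤ b) (hu : ‖u‖ ≤ b) :
    sphericalCost r t x u ∈ Set.Icc 0 (β * (2 * b ^ 2)) := by
  have h1 := pow_le_pow_left₀ (norm_nonneg x) hx 2
  have h2 := pow_le_pow_left₀ (norm_nonneg u) hu 2
  have h3 : 0 ≤ ‖x‖ ^ 2 + ‖u‖ ^ 2 := by positivity
  exact ⟨mul_nonneg hr.1 h3, mul_le_mul hr.2 (by linarith) h3 (hr.1.trans hr.2)⟩

variable [IsProbabilityMeasure D]

lemma norm_surrogateState_le (h : StableSystem A B K₀ κ γ κB) (hD : NoiseLaw D W σ)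
    {M : Policy H dx du} (hM : M ∈ policySet H dx du κ κB γ)
    {n : Fin (2 * H + 1) → Vec dx} (hn : ∀ i, ‖n i‖ ≤ W) :
    ‖surrogateState A B K₀ M n‖ ≤ scale κ γ κB ^ 9 * W := by
  rw [surrogateState_eq]
  exact h.norm_response_le' hM hD.nonneg (norm_extend_le hD.nonneg hn)

lemma norm_surrogateAction_le (h : StableSystem A B K₀ κ γ κB) (hD : NoiseLaw D W σ)
    {M : Policy H dx du} (hM : M ∈ policySet H dx du κ κB γ)
    {n : Fin (2 * H + 1) → Vec dx} (hn : ∀ i, ‖n i‖ ≤ W) :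
    ‖surrogateAction A B K₀ M n‖ ≤ scale κ γ κB ^ 9 * W := by
  rw [surrogateAction_eq]
  exact h.norm_response_action_le hM hD.nonneg (norm_extend_le hD.nonneg hn)

lemma mul_meanSquare_mem_Icc (h : StableSystem A B K₀ κ γ κB) (hD : NoiseLaw D W σ)
    {M : Policy H dx du} (hM : M ∈ policySet H dx du κ κB γ)
    {r β : ℝ} (hr : r ∈ Set.Icc 0 β) :
    r * meanSquare A B K₀ D M ∈ Set.Icc 0 (β * (2 * (scale κ γ κB ^ 9 * W) ^ 2)) := by
  have hz := continuous_surrogatePair (H := H) A B K₀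
  have h0 : 0 ≤ meanSquare A B K₀ D M := integral_nonneg fun n => by
    dsimp only
    rw [surrogatePair_dotProduct_self]
    positivity
  have h1 : meanSquare A B K₀ D M ≤ 2 * (scale κ γ κB ^ 9 * W) ^ 2 := by
    have h2 : meanSquare A B K₀ D M ≤ ∫ _, 2 * (scale κ γ κB ^ 9 * W) ^ 2
        ∂(Measure.pi fun _ : Fin (2 * H + 1) => D) := by
      refine integral_mono_ae (hD.integrable_of_continuous
        (by simp only [dotProduct]; fun_prop)) (integrable_const _) ?_
      filter_upwards [hD.ae_pi_norm_le (2 * H + 1)] with n hn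
      rw [surrogatePair_dotProduct_self]
      have h3 := pow_le_pow_left₀ (norm_nonneg _) (norm_surrogateState_le h hD hM hn) 2
      have h4 := pow_le_pow_left₀ (norm_nonneg _) (norm_surrogateAction_le h hD hM hn) 2
      linarith
    simpa using h2
  exact ⟨mul_nonneg hr.1 h0, mul_le_mul hr.2 h1 h0 (hr.1.trans hr.2)⟩

/-- The diameter of the policy set in the norm of the preconditioner. -/
lemma sqNorm_gram_sub_le (h : StableSystem A B K₀ κ γ κB) (hD : NoiseLaw D W σ)
    {M N : Policy H dx du} (hM : M ∈ policySet H dx du κ κB γ)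
    (hN : N ∈ policySet H dx du κ κB γ) :
    sqNorm (gram H A B K₀ D) (M - N) ≤ (3 * (scale κ γ κB ^ 9 * W)) ^ 2 := by
  have hJ := continuous_jacobian (H := H) A B K₀
  have hJV : ∀ ρ, Continuous fun n => (jacobian A B K₀ n *ᵥ (M - N).ofLp) ρ := fun ρ => by
    simp only [Matrix.mulVec, dotProduct]
    fun_prop
  rw [sqNorm_gram A B K₀ hD]
  have h2 : ∫ n, (jacobian A B K₀ n *ᵥ (M - N).ofLp) ⬝ᵥ (jacobian A B K₀ n *ᵥ (M - N).ofLp)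
        ∂(Measure.pi fun _ : Fin (2 * H + 1) => D)
      ≤ ∫ _, (3 * (scale κ γ κB ^ 9 * W)) ^ 2 ∂(Measure.pi fun _ : Fin (2 * H + 1) => D) := by
    refine integral_mono_ae (hD.integrable_of_continuous
      (by simp only [dotProduct]; fun_prop)) (integrable_const _) ?_
    filter_upwards [hD.ae_pi_norm_le (2 * H + 1)] with n hn
    have h3 : (jacobian A B K₀ n *ᵥ (M - N).ofLp) ⬝ᵥ (jacobian A B K₀ n *ᵥ (M - N).ofLp)
        = ‖surrogateState A B K₀ M n - surrogateState A B K₀ N n‖ ^ 2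
          + ‖surrogateAction A B K₀ M n - surrogateAction A B K₀ N n‖ ^ 2 := by
      rw [jacobian_mulVec, map_sub, EuclideanSpace.real_norm_sq_eq,
        EuclideanSpace.real_norm_sq_eq]
      simp [tangent, surrogatePair, dotProduct, sq]
    have h4 := (norm_sub_le _ _).trans
      (add_le_add (norm_surrogateState_le h hD hM hn) (norm_surrogateState_le h hD hN hn))
    have h5 := (norm_sub_le _ _).trans
      (add_le_add (norm_surrogateAction_le h hD hM hn) (norm_surrogateAction_le h hD hN hn))
    rw [h3]
    -- With b the common bound, both differences are at most 2b, and 4b² + 4b² ≤ (3b)². The 3 stands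
    -- for 2√2.
    have h6 := pow_le_pow_left₀ (norm_nonneg _) h4 2
    have h7 := pow_le_pow_left₀ (norm_nonneg _) h5 2
    nlinarith [sq_nonneg (scale κ γ κB ^ 9 * W)]
  simpa using h2

end Surrogate

/-! ### Random trajectories and stationarity of the noise history. -/

section Trajectories

variable {Ω : Type*} [MeasurableSpace Ω] {P : Measure Ω} {w : ℕ → Ω → Vec dx}

lemma ae_norm_noise_le (hD : NoiseLaw D W σ) (hw : ∀ t, HasLaw (w t) D P) :
    ∀ᵐ ω ∂P, ∀ s, ‖w s ω‖ ≤ W := by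
  refine ae_all_iff.2 fun s => ae_of_ae_map (hw s).aemeasurable (p := fun x => ‖x‖ ≤ W) ?_
  rw [(hw s).map_eq]
  exact hD.bounded

lemma aemeasurable_app {m n : ℕ} (G : Matrix (Fin m) (Fin n) ℝ) {x : Ω → Vec n}
    (hx : AEMeasurable x P) : AEMeasurable (fun ω => app G (x ω)) P :=
  (continuous_app G).measurable.comp_aemeasurable hx

lemma aemeasurable_state {ctrl : (ℕ → Vec dx) → ℕ → Vec dx → Vec du}
    (hw : ∀ t, AEMeasurable (w t) P)
    (hctrl : ∀ (t : ℕ) (x : Ω → Vec dx), AEMeasurable x P →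
      AEMeasurable (fun ω => ctrl (fun s => w s ω) t (x ω)) P) (t : ℕ) :
    AEMeasurable (fun ω => state A B (ctrl fun s => w s ω) (fun s => w s ω) t) P := by
  cases t with
  | zero => exact aemeasurable_const
  | succ t =>
    induction t with
    | zero => exact aemeasurable_const
    | succ t ih =>
      exact ((aemeasurable_app A ih).add (aemeasurable_app B (hctrl _ _ ih))).add (hw _)

lemma aemeasurable_linearCtrl (K : Matrix (Fin du) (Fin dx) ℝ) (t : ℕ) (x : Ω → Vec dx)
    (hx : AEMeasurable x P) :
    AEMeasurable (fun ω => linearCtrl K (fun s => w s ω) t (x ω)) P :=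
  (aemeasurable_app K hx).neg

lemma aemeasurable_history (hw : ∀ t, AEMeasurable (w t) P) (t i : ℕ) :
    AEMeasurable (fun ω => history (fun s => w s ω) t i) P := by
  unfold history
  split_ifs
  · exact hw _
  · exact aemeasurable_const

lemma aemeasurable_input (M : Policy H dx du) (hw : ∀ t, AEMeasurable (w t) P) (t : ℕ) :
    AEMeasurable (fun ω => input M (history (fun s => w s ω) t)) P := by
  unfold input
  exact Finset.aemeasurable_fun_sum _ fun i _ => aemeasurable_app _ (aemeasurable_history hw _ _)

lemma aemeasurable_response (F : Matrix (Fin dx) (Fin dx) ℝ) (M : Policy H dx du)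
    (hw : ∀ t, AEMeasurable (w t) P) (t : ℕ) :
    AEMeasurable (fun ω => response F B M (history (fun s => w s ω) t)) P := by
  unfold response input
  exact Finset.aemeasurable_fun_sum _ fun j _ => aemeasurable_app _ ((aemeasurable_app _
    (Finset.aemeasurable_fun_sum _ fun i _ => aemeasurable_app _
      (aemeasurable_history hw _ _))).add (aemeasurable_history hw _ _))

lemma aemeasurable_policyCtrl (K₀ : Matrix (Fin du) (Fin dx) ℝ) (M : ℕ → Policy H dx du)
    (hw : ∀ t, AEMeasurable (w t) P) (t : ℕ) (x : Ω → Vec dx) (hx : AEMeasurable x P) :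
    AEMeasurable (fun ω => policyCtrl K₀ M (fun s => w s ω) t (x ω)) P := by
  simp only [policyCtrl_eq]
  exact (aemeasurable_app K₀ hx).neg.add (aemeasurable_input _ hw t)

/-- The cost at time `t` as a random variable. -/
noncomputable def stageCost (A : Matrix (Fin dx) (Fin dx) ℝ) (B : Matrix (Fin dx) (Fin du) ℝ)
    (w : ℕ → Ω → Vec dx) (r : ℕ → ℝ) (ctrl : (ℕ → Vec dx) → ℕ → Vec dx → Vec du) (t : ℕ)
    (ω : Ω) : ℝ :=
  sphericalCost r t (state A B (ctrl fun s => w s ω) (fun s => w s ω) t)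
    (ctrl (fun s => w s ω) t (state A B (ctrl fun s => w s ω) (fun s => w s ω) t))

lemma expectedCost_eq (r : ℕ → ℝ) (T : ℕ) (ctrl : (ℕ → Vec dx) → ℕ → Vec dx → Vec du) :
    expectedCost P A B w (sphericalCost r) T ctrl
      = ∫ ω, ∑ t ∈ Finset.Icc 1 T, stageCost A B w r ctrl t ω ∂P := rfl

lemma aestronglyMeasurable_stageCost {ctrl : (ℕ → Vec dx) → ℕ → Vec dx → Vec du}
    (hw : ∀ t, AEMeasurable (w t) P)
    (hctrl : ∀ (t : ℕ) (x : Ω → Vec dx), AEMeasurable x P →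
      AEMeasurable (fun ω => ctrl (fun s => w s ω) t (x ω)) P) (r : ℕ → ℝ) (t : ℕ) :
    AEStronglyMeasurable (stageCost A B w r ctrl t) P := by
  have hx := aemeasurable_state (A := A) (B := B) hw hctrl t
  exact (((hx.norm.pow_const 2).add ((hctrl t _ hx).norm.pow_const 2)).const_mul
    (r t)).aestronglyMeasurable

/-- After the initial phase, the noise history has the law of the noise in the surrogate. -/
lemma integral_history [IsProbabilityMeasure D] (hw : ∀ t, HasLaw (w t) D P) (hind : iIndepFun w P)
    {g : (ℕ → Vec dx) → ℝ} (hg : ∀ n n' : ℕ → Vec dx, (∀ i < 2 * H + 1, n i = n' i) → g n = g n')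
    (hgc : Continuous fun n : Fin (2 * H + 1) → Vec dx => g (extend n)) {t : ℕ}
    (ht : 2 * H + 2 ≤ t) :
    ∫ ω, g (history (fun s => w s ω) t) ∂P
      = ∫ n, g (extend n) ∂(Measure.pi fun _ : Fin (2 * H + 1) => D) := by
  -- As t ≥ 2H+2, all times t - 1 - i with i ≤ 2H are at least 1. The truncated subtraction is
  -- therefore genuine and no zero padding enters.
  have hinj : Function.Injective fun i : Fin (2 * H + 1) => t - 1 - i.1 := by
    intro i j hij
    dsimp only at hij
    ext
    omega
  have hlaw : HasLaw (fun ω (i : Fin (2 * H + 1)) => w (t - 1 - i) ω)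
      (Measure.pi fun _ : Fin (2 * H + 1) => D) P :=
    (hind.precomp hinj).hasLaw_pi fun i => hw _
  rw [← hlaw.integral_comp hgc.aestronglyMeasurable]
  refine integral_congr_ae (Filter.Eventually.of_forall fun ω => hg _ _ fun i hi => ?_)
  rw [history, if_pos (by omega), extend, dif_pos hi]

variable [IsProbabilityMeasure P]

lemma stageCost_integrable {ctrl : (ℕ → Vec dx) → ℕ → Vec dx → Vec du}
    (hw : ∀ t, AEMeasurable (w t) P)
    (hctrl : ∀ (t : ℕ) (x : Ω → Vec dx), AEMeasurable x P →
      AEMeasurable (fun ω => ctrl (fun s => w s ω) t (x ω)) P) {r : ℕ → ℝ} {t : ℕ} {c : ℝ}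
    (hc : ∀ᵐ ω ∂P, stageCost A B w r ctrl t ω ∈ Set.Icc 0 c) :
    Integrable (stageCost A B w r ctrl t) P := by
  refine Integrable.of_bound (aestronglyMeasurable_stageCost hw hctrl r t) c ?_
  filter_upwards [hc] with ω hω
  rw [Real.norm_of_nonneg hω.1]
  exact hω.2

/-- Jensen's inequality in the form that the variance is nonnegative. It converts second-moment
bounds into first-moment bounds. -/
lemma integral_le_sqrt_bound {f : Ω → ℝ} (hf : MemLp f 2 P) {b : ℝ} (hb : 0 ≤ b)
    (h : ∫ ω, f ω ^ 2 ∂P ≤ b ^ 2) : ∫ ω, f ω ∂P ≤ b := by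
  have h1 := variance_nonneg f P
  rw [variance_eq_sub hf] at h1
  have h2 : (∫ ω, f ω ∂P) ^ 2 ≤ b ^ 2 := by
    refine le_trans ?_ h
    simpa using h1
  exact (le_abs_self _).trans (abs_le_of_sq_le_sq h2 hb)

end Trajectories

section Sums

/-- Used with N = 2H+1, the rounds whose noise history is still padded with zeros. Each of them is
charged a flat error e. -/
lemma sum_Icc_le_of_initial_phase {f g : ℕ → ℝ} {e : ℝ} (he : 0 ≤ e) {N T : ℕ}
    (hf : ∀ t, 1 ≤ t → t ≤ T → f t ≤ (if t ≤ N then e else 0) + g t) :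
    ∑ t ∈ Finset.Icc 1 T, f t ≤ N * e + ∑ t ∈ Finset.Icc 1 T, g t := by
  refine (Finset.sum_le_sum fun t ht => hf t (Finset.mem_Icc.1 ht).1
    (Finset.mem_Icc.1 ht).2).trans ?_
  rw [Finset.sum_add_distrib, ← Finset.sum_filter]
  refine add_le_add_left ?_ _
  rw [Finset.sum_const, nsmul_eq_mul]
  refine mul_le_mul_of_nonneg_right ?_ he
  have h1 : (Finset.Icc 1 T).filter (fun t => t ≤ N) ⊆ Finset.Icc 1 N := fun t ht => by
    rw [Finset.mem_filter, Finset.mem_Icc] at ht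
    exact Finset.mem_Icc.2 ⟨ht.1.1, ht.2⟩
  have h2 := Finset.card_le_card h1
  rw [Nat.card_Icc, Nat.add_sub_cancel] at h2
  exact_mod_cast h2

end Sums

end OnlineControl

/-! ### Comparison of expected costs. -/

namespace OnlineControl

variable {H dx du T : ℕ} {A : Matrix (Fin dx) (Fin dx) ℝ} {B : Matrix (Fin dx) (Fin du) ℝ}
  {K₀ K : Matrix (Fin du) (Fin dx) ℝ} {κ γ κB W σ β : ℝ} {r : ℕ → ℝ}
  {Ω : Type*} [MeasurableSpace Ω] {P : Measure Ω} {w : ℕ → Ω → Vec dx}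
  {D : Measure (Vec dx)} [IsProbabilityMeasure D]

lemma ae_stageCost_policyCtrl_mem_Icc (h : StableSystem A B K₀ κ γ κB) (hD : NoiseLaw D W σ)
    (hw : ∀ t, HasLaw (w t) D P) (hr : ∀ t, 1 ≤ t → t ≤ T → r t ∈ Set.Icc 0 β)
    {M : ℕ → Policy H dx du}
    (hM : ∀ t, 1 ≤ t → t ≤ T → M t ∈ policySet H dx du κ κB γ) {t : ℕ} (ht : 1 ≤ t)
    (htT : t ≤ T) :
    ∀ᵐ ω ∂P, stageCost A B w r (policyCtrl K₀ M) t ω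
      ∈ Set.Icc 0 (β * (2 * (scale κ γ κB ^ 9 * W) ^ 2)) := by
  filter_upwards [ae_norm_noise_le hD hw] with ω hω
  exact sphericalCost_mem_Icc (hr t ht htT) (h.norm_state_policyCtrl_le hM hD.nonneg hω ht htT)
    (h.norm_policyCtrl_le hM hD.nonneg hω ht htT)

lemma ae_stageCost_linearCtrl_mem_Icc (h : StableSystem A B K₀ κ γ κB) (hD : NoiseLaw D W σ)
    (hw : ∀ t, HasLaw (w t) D P) (hr : ∀ t, 1 ≤ t → t ≤ T → r t ∈ Set.Icc 0 β)
    (hK : DiagStronglyStable A B κ γ K) {t : ℕ} (ht : 1 ≤ t)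
    (htT : t ≤ T) :
    ∀ᵐ ω ∂P, stageCost A B w r (linearCtrl K) t ω
      ∈ Set.Icc 0 (β * (2 * (scale κ γ κB ^ 9 * W) ^ 2)) := by
  filter_upwards [ae_norm_noise_le hD hw] with ω hω
  exact sphericalCost_mem_Icc (hr t ht htT) (h.norm_state_linearCtrl_le' hK hD.nonneg hω ht)
    (h.norm_linearCtrl_le hK hD.nonneg hω ht)

variable [IsProbabilityMeasure P]

lemma integrable_stageCost_policyCtrl (h : StableSystem A B K₀ κ γ κB) (hD : NoiseLaw D W σ)
    (hw : ∀ t, HasLaw (w t) D P) (hr : ∀ t, 1 ≤ t → t ≤ T → r t ∈ Set.Icc 0 β)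
    {M : ℕ → Policy H dx du}
    (hM : ∀ t, 1 ≤ t → t ≤ T → M t ∈ policySet H dx du κ κB γ) {t : ℕ} (ht : 1 ≤ t)
    (htT : t ≤ T) : Integrable (stageCost A B w r (policyCtrl K₀ M) t) P :=
  stageCost_integrable (fun t => (hw t).aemeasurable)
    (aemeasurable_policyCtrl K₀ M fun t => (hw t).aemeasurable)
    (ae_stageCost_policyCtrl_mem_Icc h hD hw hr hM ht htT)

lemma integrable_stageCost_linearCtrl (h : StableSystem A B K₀ κ γ κB) (hD : NoiseLaw D W σ)
    (hw : ∀ t, HasLaw (w t) D P) (hr : ∀ t, 1 ≤ t → t ≤ T → r t ∈ Set.Icc 0 β)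
    (hK : DiagStronglyStable A B κ γ K) {t : ℕ} (ht : 1 ≤ t)
    (htT : t ≤ T) : Integrable (stageCost A B w r (linearCtrl K) t) P :=
  stageCost_integrable (fun t => (hw t).aemeasurable) (aemeasurable_linearCtrl K)
    (ae_stageCost_linearCtrl_mem_Icc h hD hw hr hK ht htT)

/-- The minimum of the cost over the strongly stable linear controllers is attained. -/
lemma exists_isLeast_expectedCost (h : StableSystem A B K₀ κ γ κB) (hD : NoiseLaw D W σ)
    (hw : ∀ t, HasLaw (w t) D P) (hr : ∀ t, 1 ≤ t → t ≤ T → r t ∈ Set.Icc 0 β)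
    :
    ∃ K, DiagStronglyStable A B κ γ K ∧
      IsLeast ((fun K => expectedCost P A B w (sphericalCost r) T (linearCtrl K)) ''
        {K | DiagStronglyStable A B κ γ K})
        (expectedCost P A B w (sphericalCost r) T (linearCtrl K)) := by
  have hstate : ∀ (ω : Ω) (t : ℕ), Continuous fun K : Matrix (Fin du) (Fin dx) ℝ =>
      state A B (linearCtrl K fun s => w s ω) (fun s => w s ω) t := by
    intro ω t
    cases t with
    | zero => exact continuous_const
    | succ t =>
      induction t with
      | zero => exact continuous_const
      | succ t ih =>
        exact (((continuous_app A).comp ih).add ((continuous_app B).comp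
          (continuous_app_left.comp (continuous_id.prodMk ih)).neg)).add continuous_const
  have hcost : ∀ (ω : Ω) (t : ℕ), Continuous fun K : Matrix (Fin du) (Fin dx) ℝ =>
      stageCost A B w r (linearCtrl K) t ω := by
    intro ω t
    have hu : Continuous fun K : Matrix (Fin du) (Fin dx) ℝ =>
        app K (state A B (linearCtrl K fun s => w s ω) (fun s => w s ω) t) :=
      continuous_app_left.comp (continuous_id.prodMk (hstate ω t))
    exact continuous_const.mul (((hstate ω t).norm.pow 2).add (hu.neg.norm.pow 2))
  -- The cost is pathwise continuous in K and uniformly bounded over stable K, so dominated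
  -- convergence applies. The minimum is then attained by compactness.
  have hcont : ContinuousOn
      (fun K => expectedCost P A B w (sphericalCost r) T (linearCtrl K))
      {K | DiagStronglyStable A B κ γ K} := by
    simp only [expectedCost_eq]
    refine continuousOn_of_dominated
      (bound := fun _ => ∑ t ∈ Finset.Icc 1 T, β * (2 * (scale κ γ κB ^ 9 * W) ^ 2))
      (fun K _ => ?_) (fun K hK => ?_) (integrable_const _) ?_
    · exact Finset.aestronglyMeasurable_fun_sum _ fun t _ => aestronglyMeasurable_stageCost
        (fun t => (hw t).aemeasurable) (aemeasurable_linearCtrl K) r t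
    · have hall : ∀ᵐ ω ∂P, ∀ t ∈ Finset.Icc 1 T, stageCost A B w r (linearCtrl K) t ω
          ∈ Set.Icc 0 (β * (2 * (scale κ γ κB ^ 9 * W) ^ 2)) :=
        (Finset.eventually_all _).2 fun t ht => ae_stageCost_linearCtrl_mem_Icc h hD hw hr hK
          (Finset.mem_Icc.1 ht).1 (Finset.mem_Icc.1 ht).2
      filter_upwards [hall] with ω hω
      refine norm_sum_le_of_le _ fun t ht => ?_
      rw [Real.norm_of_nonneg (hω t ht).1]
      exact (hω t ht).2
    · exact Filter.Eventually.of_forall fun ω =>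
        (continuous_finsetSum _ fun t _ => hcost ω t).continuousOn
  obtain ⟨K, hK, hmin⟩ := (isCompact_diagStronglyStable A B κ γ).exists_isMinOn
    ⟨K₀, h.stable⟩ hcont
  exact ⟨K, hK, ⟨K, hK, rfl⟩, by rintro _ ⟨L, hL, rfl⟩; exact hmin hL⟩

/-- Replacing the iterates by a fixed policy. -/
lemma expectedCost_sub_le_of_sqNorm (h : StableSystem A B K₀ κ γ κB) (hD : NoiseLaw D W σ)
    (hw : ∀ t, HasLaw (w t) D P) (hr : ∀ t, 1 ≤ t → t ≤ T → r t ∈ Set.Icc 0 β)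
    (hind : iIndepFun w P) (hβ : 0 ≤ β) {M : ℕ → Policy H dx du}
    {N : Policy H dx du} (hM : ∀ t, 1 ≤ t → t ≤ T → M t ∈ policySet H dx du κ κB γ)
    (hN : N ∈ policySet H dx du κ κB γ) {E : ℕ → ℝ} (hE : ∀ t, 0 ≤ E t)
    (hEM : ∀ t, sqNorm (gram H A B K₀ D) (M t - N) = E t ^ 2) :
    expectedCost P A B w (sphericalCost r) T (policyCtrl K₀ M)
        - expectedCost P A B w (sphericalCost r) T (policyCtrl K₀ fun _ => N)
      ≤ β * (2 * (scale κ γ κB ^ 9 * W)) * scale κ γ κB ^ 5 *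
        ((2 * H + 1) * (2 * (scale κ γ κB ^ 3 * W))
          + scale κ γ κB * ∑ t ∈ Finset.Icc 1 T, E t) := by
  have hz := h.two_le_scale
  have hW := hD.nonneg
  have hκ := h.one_le
  have hwm : ∀ t, AEMeasurable (w t) P := fun t => (hw t).aemeasurable
  have hinput : ∀ t, 1 ≤ t → t ≤ T →
      ∀ᵐ ω ∂P, ‖input (M t - N) (history (fun s => w s ω) t)‖ ≤ 2 * (scale κ γ κB ^ 3 * W) := by
    intro t ht htT
    filter_upwards [ae_norm_noise_le hD hw] with ω hω
    rw [input_sub]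
    refine (norm_sub_le _ _).trans ?_
    have h1 := h.norm_input_le (hM t ht htT) hW (norm_history_le hW hω t)
    have h2 := h.norm_input_le hN hW (norm_history_le hW hω t)
    linarith
  have hmem : ∀ t, 1 ≤ t → t ≤ T →
      MemLp (fun ω => ‖input (M t - N) (history (fun s => w s ω) t)‖) 2 P := by
    intro t ht htT
    refine MemLp.of_bound (aemeasurable_input _ hwm t).norm.aestronglyMeasurable
      (2 * (scale κ γ κB ^ 3 * W)) ?_
    filter_upwards [hinput t ht htT] with ω hω
    rwa [norm_norm]
  have hmean : ∀ t, 1 ≤ t → t ≤ T →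
      ∫ ω, ‖input (M t - N) (history (fun s => w s ω) t)‖ ∂P
        ≤ (if t ≤ 2 * H + 1 then 2 * (scale κ γ κB ^ 3 * W) else 0) + scale κ γ κB * E t := by
    intro t ht htT
    have hE' : 0 ≤ scale κ γ κB * E t := mul_nonneg (by linarith) (hE t)
    split_ifs with hcase
    · have h1 : ∫ ω, ‖input (M t - N) (history (fun s => w s ω) t)‖ ∂P
          ≤ ∫ _, 2 * (scale κ γ κB ^ 3 * W) ∂P :=
        integral_mono_ae ((hmem t ht htT).integrable one_le_two) (integrable_const _)
          (hinput t ht htT)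
      simp only [integral_const, probReal_univ, one_smul] at h1
      linarith
    · rw [zero_add]
      -- The policies M t and N are deterministic and the history is complete, so the second moment
      -- is the one computed in the surrogate model, where the P-norm controls it.
      refine integral_le_sqrt_bound (hmem t ht htT) hE' ?_
      rw [integral_history (H := H) hw hind (g := fun n => ‖input (M t - N) n‖ ^ 2)
        (fun n n' hn => by rw [input_congr _ fun i hi => hn i (by omega)])
        ((continuous_input _ continuous_extend).norm.pow 2) (by omega)]
      refine (integral_norm_input_sq_le A B K₀ hD (M t - N)).trans ?_
      rw [hEM, mul_pow]
      refine mul_le_mul_of_nonneg_right ?_ (sq_nonneg _)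
      -- With z the scale, 1 + ‖K₀‖² ≤ 1 + κ² ≤ (2κ)² ≤ z².
      have h1 := pow_le_pow_left₀ (norm_nonneg _) h.stable.norm_le 2
      have h2 := pow_le_pow_left₀ (by positivity) h.two_mul_le_scale 2
      nlinarith
  have hNc : ∀ t, 1 ≤ t → t ≤ T → (fun _ : ℕ => N) t ∈ policySet H dx du κ κB γ :=
    fun _ _ _ => hN
  have hI1 : ∀ t ∈ Finset.Icc 1 T, Integrable (stageCost A B w r (policyCtrl K₀ M) t) P :=
    fun t ht => integrable_stageCost_policyCtrl h hD hw hr hM (Finset.mem_Icc.1 ht).1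
      (Finset.mem_Icc.1 ht).2
  have hI2 : ∀ t ∈ Finset.Icc 1 T,
      Integrable (stageCost A B w r (policyCtrl K₀ fun _ => N) t) P :=
    fun t ht => integrable_stageCost_policyCtrl h hD hw hr hNc (Finset.mem_Icc.1 ht).1
      (Finset.mem_Icc.1 ht).2
  have hI3 : ∀ t ∈ Finset.Icc 1 T,
      Integrable (fun ω => ‖input (M t - N) (history (fun s => w s ω) t)‖) P := fun t ht =>
    (hmem t (Finset.mem_Icc.1 ht).1 (Finset.mem_Icc.1 ht).2).integrable one_le_two
  rw [expectedCost_eq, expectedCost_eq,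
    ← integral_sub (integrable_finsetSum _ hI1) (integrable_finsetSum _ hI2)]
  calc _ ≤ ∫ ω, β * (2 * (scale κ γ κB ^ 9 * W)) * scale κ γ κB ^ 5 *
        ∑ t ∈ Finset.Icc 1 T, ‖input (M t - N) (history (fun s => w s ω) t)‖ ∂P := by
        refine integral_mono_ae ((integrable_finsetSum _ hI1).sub (integrable_finsetSum _ hI2))
          ((integrable_finsetSum _ hI3).const_mul _) ?_
        filter_upwards [ae_norm_noise_le hD hw] with ω hω
        refine (le_abs_self _).trans ((h.abs_sum_cost_sub_le hβ (by positivity) hr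
          (policyCtrl K₀ M fun s => w s ω) (policyCtrl K₀ (fun _ => N) fun s => w s ω)
          (fun s => w s ω)
          (fun t h1 h2 => h.norm_state_policyCtrl_le hM hW hω h1 h2)
          (fun t h1 h2 => h.norm_policyCtrl_le hM hW hω h1 h2)
          (fun t h1 h2 => h.norm_state_policyCtrl_le hNc hW hω h1 h2)
          (fun t h1 h2 => h.norm_policyCtrl_le hNc hW hω h1 h2)).trans (le_of_eq ?_))
        simp only [policyCtrl_eq, neg_add_cancel_comm, input_sub]
    _ = β * (2 * (scale κ γ κB ^ 9 * W)) * scale κ γ κB ^ 5 *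
        ∑ t ∈ Finset.Icc 1 T, ∫ ω, ‖input (M t - N) (history (fun s => w s ω) t)‖ ∂P := by
        rw [integral_const_mul, integral_finsetSum _ hI3]
    _ ≤ _ := by
        refine mul_le_mul_of_nonneg_left ?_ (by positivity)
        refine (sum_Icc_le_of_initial_phase (by positivity) hmean).trans (le_of_eq ?_)
        rw [← Finset.mul_sum]
        push_cast
        ring

/-- The cost of a fixed policy is close to its surrogate cost. -/
lemma abs_expectedCost_sub_meanSquare_le (h : StableSystem A B K₀ κ γ κB) (hD : NoiseLaw D W σ)
    (hw : ∀ t, HasLaw (w t) D P) (hr : ∀ t, 1 ≤ t → t ≤ T → r t ∈ Set.Icc 0 β)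
    (hind : iIndepFun w P) (hβ : 0 ≤ β) (hT : 1 ≤ T)
    (hH : (1 - γ) ^ H ≤ 1 / T) {N : Policy H dx du} (hN : N ∈ policySet H dx du κ κB γ) :
    |expectedCost P A B w (sphericalCost r) T (policyCtrl K₀ fun _ => N)
        - ∑ t ∈ Finset.Icc 1 T, r t * meanSquare A B K₀ D N|
      ≤ (2 * H + 1) * (β * (2 * (scale κ γ κB ^ 9 * W) ^ 2))
        + β * (2 * (scale κ γ κB ^ 17 * W ^ 2)) := by
  have hz := h.two_le_scale
  have hW := hD.nonneg
  have hκ := h.one_le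
  have hT0 : (0 : ℝ) < T := by exact_mod_cast hT
  have hwm : ∀ t, AEMeasurable (w t) P := fun t => (hw t).aemeasurable
  have hNc : ∀ t, 1 ≤ t → t ≤ T → (fun _ : ℕ => N) t ∈ policySet H dx du κ κB γ :=
    fun _ _ _ => hN
  have hI : ∀ t, 1 ≤ t → t ≤ T →
      Integrable (stageCost A B w r (policyCtrl K₀ fun _ => N) t) P :=
    fun t h1 h2 => integrable_stageCost_policyCtrl h hD hw hr hNc h1 h2
  set e : ℝ := β * (2 * (scale κ γ κB ^ 9 * W) ^ 2) with he
  -- Error per round once the history is complete. The factor 1/T comes from the horizon, so T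
  -- rounds contribute only a constant.
  set e' : ℝ := β * (2 * (scale κ γ κB ^ 17 * W ^ 2)) / T with he'
  have he0 : 0 ≤ e := by positivity
  have he0' : 0 ≤ e' := by positivity
  have hstage : ∀ t, 1 ≤ t → t ≤ T →
      |∫ ω, stageCost A B w r (policyCtrl K₀ fun _ => N) t ω ∂P - r t * meanSquare A B K₀ D N|
        ≤ (if t ≤ 2 * H + 1 then e else 0) + e' := by
    intro t ht htT
    split_ifs with hcase
    · have h1 := mul_meanSquare_mem_Icc h hD hN (hr t ht htT)
      have h2 := ae_stageCost_policyCtrl_mem_Icc h hD hw hr hNc ht htT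
      have h3 : 0 ≤ ∫ ω, stageCost A B w r (policyCtrl K₀ fun _ => N) t ω ∂P :=
        integral_nonneg_of_ae (h2.mono fun ω hω => hω.1)
      have h4 : ∫ ω, stageCost A B w r (policyCtrl K₀ fun _ => N) t ω ∂P ≤ e := by
        have h5 := integral_mono_ae (hI t ht htT) (integrable_const e) (h2.mono fun ω hω => hω.2)
        simpa using h5
      rw [abs_le]
      constructor <;> linarith [h1.1, h1.2]
    -- Here g is the surrogate cost on a given history. Its mean along the true noise equals the
    -- surrogate mean, so what is left is a pathwise truncation error.
    · set g : (ℕ → Vec dx) → ℝ := fun n => sphericalCost r t (response (A - B * K₀) B N n)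
        (-app K₀ (response (A - B * K₀) B N n) + input N n) with hg
      have hgc : Continuous fun n : Fin (2 * H + 1) → Vec dx => g (extend n) := by
        have c1 := continuous_response (A - B * K₀) B N
          (continuous_extend (dx := dx) (N := 2 * H + 1))
        have c2 := continuous_input N (continuous_extend (dx := dx) (N := 2 * H + 1))
        exact continuous_const.mul ((c1.norm.pow 2).add
          ((((continuous_app K₀).comp c1).neg.add c2).norm.pow 2))
      have h1 : r t * meanSquare A B K₀ D N
          = ∫ ω, g (history (fun s => w s ω) t) ∂P := by
        rw [integral_history (H := H) hw hind (g := g) (fun n n' hn => by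
          simp only [hg]
          rw [response_congr _ _ _ hn, input_congr _ fun i hi => hn i (by omega)]) hgc (by omega),
          ← surrogateCost_sphericalCost]
        simp only [surrogateCost, surrogateState_eq, surrogateAction_eq, hg]
      have hIg : Integrable (fun ω => g (history (fun s => w s ω) t)) P := by
        have m1 := aemeasurable_response (B := B) (A - B * K₀) N hwm t
        have m2 := aemeasurable_input N hwm t
        refine Integrable.of_bound (((m1.norm.pow_const 2).add
          (((aemeasurable_app K₀ m1).neg.add m2).norm.pow_const 2)).const_mul
            (r t)).aestronglyMeasurable e ?_
        filter_upwards [ae_norm_noise_le hD hw] with ω hω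
        have h2 := sphericalCost_mem_Icc (hr t ht htT)
          (h.norm_response_le' hN hW (norm_history_le hW hω t))
          (h.norm_response_action_le hN hW (norm_history_le hW hω t))
        exact (Real.norm_of_nonneg h2.1).le.trans h2.2
      rw [h1, ← integral_sub (hI t ht htT) hIg, zero_add]
      have h2 : ∀ᵐ ω ∂P, ‖stageCost A B w r (policyCtrl K₀ fun _ => N) t ω
          - g (history (fun s => w s ω) t)‖ ≤ e' := by
        filter_upwards [ae_norm_noise_le hD hw] with ω hω
        have h3 := h.norm_state_sub_response_le hN hW hω ht
        set x := state A B (policyCtrl K₀ (fun _ => N) fun s => w s ω) (fun s => w s ω) t with hx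
        set y := response (A - B * K₀) B N (history (fun s => w s ω) t) with hy
        have h4 : ‖policyCtrl K₀ (fun _ => N) (fun s => w s ω) t x
            - (-app K₀ y + input N (history (fun s => w s ω) t))‖ ≤ κ * ‖x - y‖ := by
          rw [policyCtrl_eq]
          have h5 : -app K₀ x + input N (history (fun s => w s ω) t)
              - (-app K₀ y + input N (history (fun s => w s ω) t)) = -app K₀ (x - y) := by
            rw [app_sub]; abel
          rw [h5, norm_neg]
          exact norm_app_le_of_le h.stable.norm_le le_rfl
        refine (StableSystem.abs_sphericalCost_sub_le (hr t ht htT).1 (hr t ht htT).2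
          (h.norm_state_policyCtrl_le hNc hW hω ht htT)
          (h.norm_response_le' hN hW (norm_history_le hW hω t))
          (h.norm_policyCtrl_le hNc hW hω ht htT)
          (h.norm_response_action_le hN hW (norm_history_le hW hω t))).trans ?_
        have h6 : ‖x - y‖ ≤ scale κ γ κB ^ 7 * W * (1 / T) :=
          h3.trans (mul_le_mul_of_nonneg_left hH (by positivity))
        calc β * (2 * (scale κ γ κB ^ 9 * W)) * (‖x - y‖ + _)
            ≤ β * (2 * (scale κ γ κB ^ 9 * W)) *
                (scale κ γ κB * (scale κ γ κB ^ 7 * W * (1 / T))) := by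
              refine mul_le_mul_of_nonneg_left ?_ (by positivity)
              calc ‖x - y‖ + _ ≤ (1 + κ) * ‖x - y‖ := by linarith [h4]
                _ ≤ scale κ γ κB * (scale κ γ κB ^ 7 * W * (1 / T)) := by
                    refine mul_le_mul ?_ h6 (norm_nonneg _) (by linarith)
                    linarith [h.two_mul_le_scale]
          _ = e' := by rw [he']; ring
      have h7 := norm_integral_le_of_norm_le_const h2
      simpa using h7
  rw [expectedCost_eq, integral_finsetSum _ fun t ht =>
    hI t (Finset.mem_Icc.1 ht).1 (Finset.mem_Icc.1 ht).2, ← Finset.sum_sub_distrib]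
  refine (Finset.abs_sum_le_sum_abs _ _).trans ((sum_Icc_le_of_initial_phase he0 hstage).trans
    (le_of_eq ?_))
  rw [Finset.sum_const, Nat.card_Icc, Nat.add_sub_cancel, nsmul_eq_mul, he',
    mul_div_cancel₀ _ hT0.ne']
  push_cast
  ring

/-- The imitating policy has almost the cost of the linear controller. -/
lemma expectedCost_imitation_sub_le (h : StableSystem A B K₀ κ γ κB) (hD : NoiseLaw D W σ)
    (hw : ∀ t, HasLaw (w t) D P) (hr : ∀ t, 1 ≤ t → t ≤ T → r t ∈ Set.Icc 0 β)
    (hβ : 0 ≤ β) (hT : 1 ≤ T) (hH : (1 - γ) ^ H ≤ 1 / T)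
    (hK : DiagStronglyStable A B κ γ K) :
    expectedCost P A B w (sphericalCost r) T (policyCtrl K₀ fun _ => imitation H A B K₀ K)
        - expectedCost P A B w (sphericalCost r) T (linearCtrl K)
      ≤ β * (2 * (scale κ γ κB ^ 17 * W ^ 2)) := by
  have hz := h.two_le_scale
  have hW := hD.nonneg
  have hT0 : (0 : ℝ) < T := by exact_mod_cast hT
  have hNc : ∀ t, 1 ≤ t → t ≤ T →
      (fun _ : ℕ => imitation H A B K₀ K) t ∈ policySet H dx du κ κB γ :=
    fun _ _ _ => h.imitation_mem hK
  have hI1 : ∀ t ∈ Finset.Icc 1 T,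
      Integrable (stageCost A B w r (policyCtrl K₀ fun _ => imitation H A B K₀ K) t) P :=
    fun t ht => integrable_stageCost_policyCtrl h hD hw hr hNc (Finset.mem_Icc.1 ht).1
      (Finset.mem_Icc.1 ht).2
  have hI2 : ∀ t ∈ Finset.Icc 1 T, Integrable (stageCost A B w r (linearCtrl K) t) P :=
    fun t ht => integrable_stageCost_linearCtrl h hD hw hr hK (Finset.mem_Icc.1 ht).1
      (Finset.mem_Icc.1 ht).2
  rw [expectedCost_eq, expectedCost_eq,
    ← integral_sub (integrable_finsetSum _ hI1) (integrable_finsetSum _ hI2)]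
  have hle : ∀ᵐ ω ∂P, ∑ t ∈ Finset.Icc 1 T,
        stageCost A B w r (policyCtrl K₀ fun _ => imitation H A B K₀ K) t ω
      - ∑ t ∈ Finset.Icc 1 T, stageCost A B w r (linearCtrl K) t ω
      ≤ β * (2 * (scale κ γ κB ^ 17 * W ^ 2)) := by
    filter_upwards [ae_norm_noise_le hD hw] with ω hω
    refine (le_abs_self _).trans ((h.abs_sum_cost_sub_le hβ (by positivity) hr
      (policyCtrl K₀ (fun _ => imitation H A B K₀ K) fun s => w s ω)
      (linearCtrl K fun s => w s ω) (fun s => w s ω)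
      (fun t h1 h2 => h.norm_state_policyCtrl_le hNc hW hω h1 h2)
      (fun t h1 h2 => h.norm_policyCtrl_le hNc hW hω h1 h2)
      (fun t h1 h2 => h.norm_state_linearCtrl_le' hK hW hω h1)
      (fun t h1 h2 => h.norm_linearCtrl_le hK hW hω h1)).trans ?_)
    have hsum : ∑ t ∈ Finset.Icc 1 T,
        ‖(policyCtrl K₀ (fun _ => imitation H A B K₀ K) (fun s => w s ω) t
            (state A B (policyCtrl K₀ (fun _ => imitation H A B K₀ K) fun s => w s ω)
              (fun s => w s ω) t)
            + app K₀ (state A B (policyCtrl K₀ (fun _ => imitation H A B K₀ K) fun s => w s ω)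
              (fun s => w s ω) t))
          - (linearCtrl K (fun s => w s ω) t
              (state A B (linearCtrl K fun s => w s ω) (fun s => w s ω) t)
            + app K₀ (state A B (linearCtrl K fun s => w s ω) (fun s => w s ω) t))‖
        ≤ scale κ γ κB ^ 3 * W := by
      calc _ ≤ ∑ _t ∈ Finset.Icc 1 T, scale κ γ κB ^ 3 * W * (1 / T) := by
            refine Finset.sum_le_sum fun t ht => ?_
            refine le_trans (le_of_eq ?_) ((h.norm_linear_input_sub_le hK hW hω
              (Finset.mem_Icc.1 ht).1).trans (mul_le_mul_of_nonneg_left hH (by positivity)))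
            rw [policyCtrl_eq, neg_add_cancel_comm, norm_sub_rev, sub_app, linearCtrl]
            congr 2
            abel
        _ = scale κ γ κB ^ 3 * W := by
            rw [Finset.sum_const, Nat.card_Icc, Nat.add_sub_cancel, nsmul_eq_mul]
            field_simp
    refine (mul_le_mul_of_nonneg_left hsum (by positivity)).trans (le_of_eq ?_)
    ring
  have h1 := integral_mono_ae ((integrable_finsetSum _ hI1).sub (integrable_finsetSum _ hI2))
    (integrable_const _) hle
  simpa using h1

end OnlineControl

/-! ### Convergence of the iterates and the regret bound. -/

namespace OnlineControl

variable {H dx du T : ℕ} {A : Matrix (Fin dx) (Fin dx) ℝ} {B : Matrix (Fin dx) (Fin du) ℝ}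
  {K₀ : Matrix (Fin du) (Fin dx) ℝ} {κ γ κB W σ α β c : ℝ} {r η : ℕ → ℝ}
  {D : Measure (Vec dx)}

lemma IsNaturalGradientRun.mem {C : ℕ → Vec dx → Vec du → ℝ} {M : ℕ → Policy H dx du}
    (hM : IsNaturalGradientRun A B K₀ κ κB γ D C η T M) {t : ℕ} (ht : 1 ≤ t) (htT : t ≤ T) :
    M t ∈ policySet H dx du κ κB γ := by
  obtain ⟨s, rfl⟩ := Nat.exists_eq_add_of_le' ht
  rcases Nat.eq_zero_or_pos s with rfl | hs
  · exact hM.1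
  · exact (hM.2 s hs (by omega)).1

variable [IsProbabilityMeasure D]

/-- The iterates converge to the best policy, at a rate that is summable over time. -/
lemma IsNaturalGradientRun.exists_minimizer (h : StableSystem A B K₀ κ γ κB)
    (hD : NoiseLaw D W σ) (hσ : 0 < σ) (hc : 1 ≤ c) (hα : 0 < α) (hT : 2 ≤ T)
    (hr : ∀ t, 1 ≤ t → t ≤ T → r t ∈ Set.Icc α β)
    (hη : ∀ t : ℕ, 1 ≤ t → t < T → η t ∈ Set.Icc (1 / (α * t)) (c / (α * t)))
    {M : ℕ → Policy H dx du}
    (hM : IsNaturalGradientRun A B K₀ κ κB γ D (sphericalCost r) η T M) :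
    ∃ N ∈ policySet H dx du κ κB γ,
      (∀ V ∈ policySet H dx du κ κB γ, meanSquare A B K₀ D N ≤ meanSquare A B K₀ D V) ∧
      ∃ E : ℕ → ℝ, (∀ t, 0 ≤ E t) ∧ (∀ t, sqNorm (gram H A B K₀ D) (M t - N) = E t ^ 2) ∧
        ∑ t ∈ Finset.Icc 1 T, E t ≤ 18 * c * (β / α) * (scale κ γ κB ^ 9 * W) := by
  have hpos := gram_posDef (H := H) A B K₀ hD hσ
  have hz := h.two_le_scale
  have hW := hD.nonneg
  obtain ⟨c₀, b, hquad⟩ := integral_surrogatePair_dotProduct_self (H := H) A B K₀ hD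
  obtain ⟨m, c₁, hsq, hgrad⟩ := exists_complete_square (f := meanSquare A B K₀ D) hpos hquad
  obtain ⟨S, hS, -⟩ := exists_sqNorm_eq_norm_sq hpos.posSemidef
  -- The P-projection of the unconstrained minimizer m onto the policy set. It minimizes every
  -- surrogate cost simultaneously.
  obtain ⟨N, hN, hNmin⟩ := (isCompact_policySet (κ := κ) (κB := κB) (γ := γ)).exists_isMinOn
    (f := fun V : Policy H dx du => ‖S (V - m)‖) ⟨M 1, hM.1⟩ (by fun_prop)
  have hNmin' : ∀ V ∈ policySet H dx du κ κB γ, ‖S (N - m)‖ ≤ ‖S (V - m)‖ := fun V hV => hNmin hV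
  refine ⟨N, hN, fun V hV => ?_, fun t => ‖S (M t - N)‖, fun t => norm_nonneg _,
    fun t => hS _, ?_⟩
  · rw [hsq, hsq, hS, hS]
    have := pow_le_pow_left₀ (norm_nonneg _) (hNmin' V hV) 2
    linarith
  have hdiam : ∀ t, 1 ≤ t → t ≤ T → ‖S (M t - N)‖ ≤ 3 * (scale κ γ κB ^ 9 * W) := by
    intro t ht htT
    have h1 := sqNorm_gram_sub_le h hD (hM.mem ht htT) hN
    rw [hS] at h1
    exact (abs_norm _).symm.le.trans (abs_le_of_sq_le_sq h1 (by positivity))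
  have hconv : Convex ℝ (S '' policySet H dx du κ κB γ) :=
    convex_policySet.linear_image S.toLinearMap
  have hαβ : α ≤ β := (hr 1 le_rfl (by omega)).1.trans (hr 1 le_rfl (by omega)).2
  have hβα : 1 ≤ β / α := (one_le_div hα).2 hαβ
  have hcβ : 1 ≤ c * (β / α) := by nlinarith
  -- From round k on, the effective step s is at most 1, so |1 - s| = 1 - s. Earlier rounds are paid
  -- for by the diameter.
  set k : ℕ := ⌈2 * (c * (β / α))⌉₊ with hk
  have hkge : 2 * (c * (β / α)) ≤ k := Nat.le_ceil _
  have hkle : (k : ℝ) ≤ 3 * (c * (β / α)) := by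
    have := (Nat.ceil_lt_add_one (show 0 ≤ 2 * (c * (β / α)) by linarith)).le
    linarith
  have hk2 : 2 ≤ k := by
    have : (2 : ℝ) ≤ k := by linarith
    exact_mod_cast this
  have hstep : ∀ t, k ≤ t → t < T →
      (t : ℝ) * ‖S (M (t + 1) - N)‖ ≤ (t - 2) * ‖S (M t - N)‖ := by
    intro t hkt htT
    have ht : 1 ≤ t := by omega
    have ht0 : (0 : ℝ) < t := by exact_mod_cast ht
    obtain ⟨hproj, hprojmin⟩ := hM.2 t ht htT
    obtain ⟨hη1, hη2⟩ := hη t ht htT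
    obtain ⟨hr1, hr2⟩ := hr t ht htT.le
    have hη0 : 0 < η t := lt_of_lt_of_le (by positivity) hη1
    have hr0 : 0 < r t := hα.trans_le hr1
    -- The preconditioned gradient is 2 r_t (M_t - m), so this is the step length towards m. The
    -- bounds η_t ≥ 1/(αt) and r_t ≥ α give s t ≥ 2, hence t(1 - s) ≤ t - 2.
    set s : ℝ := η t * (2 * r t) with hs
    have hs0 : 0 ≤ s := by positivity
    have hs2 : 2 ≤ s * t := by
      rw [div_le_iff₀ (by positivity)] at hη1
      have : η t * (α * t) ≤ η t * (r t * t) := by gcongr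
      rw [hs]
      linarith
    have hs1 : s ≤ 1 := by
      have h1 : s ≤ c / (α * t) * (2 * β) := by
        rw [hs]
        gcongr
      have h2 : c / (α * t) * (2 * β) = 2 * (c * (β / α)) / t := by
        field_simp
      rw [h2] at h1
      refine h1.trans ((div_le_one ht0).2 (hkge.trans ?_))
      exact_mod_cast hkt
    have hcost : (surrogateCost A B K₀ D (sphericalCost r t) : Policy H dx du → ℝ)
        = fun V => r t * meanSquare A B K₀ D V :=
      funext fun V => surrogateCost_sphericalCost r t V
    have hdir : M t - η t • Matrix.toEuclideanLin (gram H A B K₀ D)⁻¹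
        (∇ (surrogateCost A B K₀ D (sphericalCost r t)) (M t)) = M t - s • (M t - m) := by
      rw [hcost, hgrad, smul_smul]
    rw [hdir] at hprojmin
    have hcontr := norm_sub_le_of_projected_step hconv (p := S (M t)) (p' := S (M (t + 1)))
      (q := S N) (m := S m) hs0 ⟨_, hproj, rfl⟩ ⟨N, hN, rfl⟩ (by
        rintro _ ⟨V, hV, rfl⟩
        have h1 := hprojmin V hV
        rw [hS, hS] at h1
        have h2 := abs_le_of_sq_le_sq h1 (norm_nonneg _)
        rw [abs_norm] at h2
        simp only [map_sub, map_smul] at h2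
        rw [norm_sub_rev, norm_sub_rev _ (S V)]
        exact h2) (by
        rintro _ ⟨V, hV, rfl⟩
        have h1 := hNmin' V hV
        rw [map_sub, map_sub] at h1
        rw [norm_sub_rev, norm_sub_rev _ (S V)]
        exact h1)
    rw [← map_sub, ← map_sub, abs_of_nonneg (by linarith)] at hcontr
    calc (t : ℝ) * ‖S (M (t + 1) - N)‖ ≤ t * ((1 - s) * ‖S (M t - N)‖) := by gcongr
      _ = (t - s * t) * ‖S (M t - N)‖ := by ring
      _ ≤ (t - 2) * ‖S (M t - N)‖ := by gcongr
  refine (sum_le_of_contraction (fun t => norm_nonneg _) (by positivity) hdiam hk2 hstep).trans ?_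
  calc 2 * (k : ℝ) * (3 * (scale κ γ κB ^ 9 * W))
      ≤ 2 * (3 * (c * (β / α))) * (3 * (scale κ γ κB ^ 9 * W)) := by gcongr
    _ = 18 * c * (β / α) * (scale κ γ κB ^ 9 * W) := by ring

/-- From log κ ≤ κ - 1 and log T ≥ 1/2 one gets log(Tκ²) ≤ 4κ log T. The rounding and the added 1
are absorbed using log T ≥ 1/2 and scale at least 2. -/
lemma horizon_le (h : StableSystem A B K₀ κ γ κB) (hT : 2 ≤ T) :
    2 * (horizon κ γ T : ℝ) + 1 ≤ 8 * scale κ γ κB * Real.log T := by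
  have hκ := h.one_le; have hγ := h.one_le_inv; have hz := h.two_le_scale
  have hz2 := h.two_mul_mul_inv_le_scale
  have hT' : (2 : ℝ) ≤ T := by exact_mod_cast hT
  have hlog : 1 / 2 ≤ Real.log T := by
    have h1 := Real.log_le_log (by norm_num) hT'
    linarith [Real.log_two_gt_d9]
  have hlogκ : Real.log κ ≤ κ - 1 := Real.log_le_sub_one_of_pos (by linarith)
  have hlogκ0 : 0 ≤ Real.log κ := Real.log_nonneg hκ
  have hexp : Real.log (T * κ ^ 2) = Real.log T + 2 * Real.log κ := by
    rw [Real.log_mul (by positivity) (by positivity), Real.log_pow]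
    norm_num
  have hH : (horizon κ γ T : ℝ) ≤ γ⁻¹ * (Real.log T + 2 * Real.log κ) + 1 := by
    rw [← hexp]
    refine (Nat.ceil_lt_add_one ?_).le
    rw [hexp]
    positivity
  have h1 : γ⁻¹ * (Real.log T + 2 * Real.log κ) ≤ 2 * (2 * κ * γ⁻¹) * Real.log T := by
    have h2 : Real.log T + 2 * Real.log κ ≤ 4 * κ * Real.log T := by nlinarith
    nlinarith
  have h3 : 2 * (2 * κ * γ⁻¹) * Real.log T ≤ 2 * scale κ γ κB * Real.log T := by gcongr
  nlinarith

/-- The regret bound with an explicit constant, in terms of `κ`, `κB` and `γ` only. -/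
lemma regret_le {c : ℝ} (hc : 1 ≤ c) {T dx du : ℕ}
    {A : Matrix (Fin dx) (Fin dx) ℝ} {B : Matrix (Fin dx) (Fin du) ℝ}
    {K₀ K : Matrix (Fin du) (Fin dx) ℝ} {κ γ κB W σ α β : ℝ} {r η : ℕ → ℝ}
    {D : Measure (Vec dx)} [IsProbabilityMeasure D] {Ω : Type*} [MeasurableSpace Ω] {P : Measure Ω}
    [IsProbabilityMeasure P] {w : ℕ → Ω → Vec dx} {M : ℕ → Policy (horizon κ γ T) dx du}
    (h : StableSystem A B K₀ κ γ κB) (hD : NoiseLaw D W σ) (hσ : 0 < σ)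
    (hw : ∀ t, HasLaw (w t) D P) (hind : iIndepFun w P) (hα : 0 < α) (hT : 2 ≤ T)
    (hr : ∀ t, 1 ≤ t → t ≤ T → r t ∈ Set.Icc α β)
    (hη : ∀ t : ℕ, 1 ≤ t → t < T → η t ∈ Set.Icc (1 / (α * t)) (c / (α * t)))
    (hM : IsNaturalGradientRun A B K₀ κ κB γ D (sphericalCost r) η T M)
    (hK : DiagStronglyStable A B κ γ K) :
    expectedCost P A B w (sphericalCost r) T (policyCtrl K₀ M)
        - expectedCost P A B w (sphericalCost r) T (linearCtrl K)
      ≤ 152 * c * scale κ γ κB ^ 24 * (β ^ 2 * W ^ 2 / α) * Real.log T := by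
  have hz := h.two_le_scale
  have hW := hD.nonneg
  have hT' : (2 : ℝ) ≤ T := by exact_mod_cast hT
  have hlog : 1 / 2 ≤ Real.log T := by
    have h1 := Real.log_le_log (by norm_num) hT'
    linarith [Real.log_two_gt_d9]
  have hαβ : α ≤ β := (hr 1 le_rfl (by omega)).1.trans (hr 1 le_rfl (by omega)).2
  have hβ : 0 ≤ β := hα.le.trans hαβ
  have hr' : ∀ t, 1 ≤ t → t ≤ T → r t ∈ Set.Icc 0 β := fun t h1 h2 =>
    ⟨hα.le.trans (hr t h1 h2).1, (hr t h1 h2).2⟩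
  have hH := one_sub_pow_horizon_le h.one_le h.pos h.lt_one hT
  have hHle := horizon_le h hT
  obtain ⟨N, hN, hNmin, E, hE0, hE, hEsum⟩ := hM.exists_minimizer h hD hσ hc hα hT hr hη
  have hI := h.imitation_mem (H := horizon κ γ T) hK
  -- The chain: iterates to N, N to its surrogate cost, surrogate cost of the imitation to its true
  -- cost, and imitation to K. Minimality of N, in `s5`, links the two surrogate costs.
  have s1 := expectedCost_sub_le_of_sqNorm h hD hw hr' hind hβ (fun t => hM.mem) hN hE0 hE
  have s2 := (abs_le.1
    (abs_expectedCost_sub_meanSquare_le h hD hw hr' hind hβ (by omega) hH hN)).2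
  have s3 := (abs_le.1
    (abs_expectedCost_sub_meanSquare_le h hD hw hr' hind hβ (by omega) hH hI)).1
  have s4 := expectedCost_imitation_sub_le h hD hw hr' hβ (by omega) hH hK
  have s5 : ∑ t ∈ Finset.Icc 1 T, r t * meanSquare A B K₀ D N
      ≤ ∑ t ∈ Finset.Icc 1 T, r t * meanSquare A B K₀ D (imitation (horizon κ γ T) A B K₀ K) :=
    Finset.sum_le_sum fun t ht => mul_le_mul_of_nonneg_left (hNmin _ hI)
      (hr' t (Finset.mem_Icc.1 ht).1 (Finset.mem_Icc.1 ht).2).1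
  set z := scale κ γ κB with hzdef
  set ℓ := Real.log T with hℓ
  set n : ℝ := 2 * (horizon κ γ T : ℝ) + 1 with hn
  have hn0 : 0 ≤ n := by positivity
  set X : ℝ := β ^ 2 * W ^ 2 / α with hX
  have hβX : β * W ^ 2 ≤ X := by
    rw [hX, le_div_iff₀ hα]
    nlinarith [mul_le_mul_of_nonneg_left hαβ (mul_nonneg hβ (sq_nonneg W))]
  have hX0 : 0 ≤ X := by positivity
  -- Common unit for all error terms. The exponent 24 = 9 + 5 + 1 + 9 and the ratio β²/α come from
  -- the optimization term; the others carry βW², which is at most X because α ≤ β.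
  set Y : ℝ := c * z ^ 24 * X * ℓ with hY
  have hz0 : 0 ≤ z := by linarith
  have hzp : ∀ m ≤ 24, z ^ m ≤ z ^ 24 := fun m hm => h.pow_le_pow hm
  have p1 : ∀ m ≤ 24, z ^ m * ℓ * (β * W ^ 2) ≤ Y := fun m hm =>
    calc z ^ m * ℓ * (β * W ^ 2) ≤ (c * z ^ 24) * ℓ * X := by
          gcongr
          · have := hzp m hm
            have : 0 ≤ z ^ 24 := by positivity
            nlinarith
      _ = Y := by rw [hY]; ring
  have p2 : ∀ m ≤ 24, z ^ m * (β * W ^ 2) ≤ 2 * Y := fun m hm => by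
    refine le_trans ?_ (mul_le_mul_of_nonneg_left (p1 m hm) zero_le_two)
    have : 0 ≤ z ^ m * (β * W ^ 2) := by positivity
    nlinarith
  have p3 : c * z ^ 24 * X ≤ 2 * Y := by
    have : 0 ≤ c * z ^ 24 * X := by positivity
    rw [hY]
    nlinarith
  have q1 : β * (2 * (z ^ 9 * W)) * z ^ 5 * (n * (2 * (z ^ 3 * W))
      + z * ∑ t ∈ Finset.Icc 1 T, E t) ≤ 32 * Y + 72 * Y := by
    calc _ ≤ β * (2 * (z ^ 9 * W)) * z ^ 5 * ((8 * z * ℓ) * (2 * (z ^ 3 * W))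
          + z * (18 * c * (β / α) * (z ^ 9 * W))) := by gcongr
      _ = 32 * (z ^ 18 * ℓ * (β * W ^ 2)) + 36 * (c * z ^ 24 * X) := by
          rw [hX]; field_simp; ring
      _ ≤ 32 * Y + 72 * Y := by linarith [p1 18 (by norm_num)]
  have q2 : n * (β * (2 * (z ^ 9 * W) ^ 2)) + β * (2 * (z ^ 17 * W ^ 2)) ≤ 16 * Y + 4 * Y := by
    calc _ ≤ (8 * z * ℓ) * (β * (2 * (z ^ 9 * W) ^ 2)) + β * (2 * (z ^ 17 * W ^ 2)) := by gcongr
      _ = 16 * (z ^ 19 * ℓ * (β * W ^ 2)) + 2 * (z ^ 17 * (β * W ^ 2)) := by ring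
      _ ≤ 16 * Y + 4 * Y := by linarith [p1 19 (by norm_num), p2 17 (by norm_num)]
  have q3 : β * (2 * (z ^ 17 * W ^ 2)) ≤ 4 * Y := by
    have := p2 17 (by norm_num)
    linarith
  have hfin : 152 * c * z ^ 24 * X * ℓ = 152 * Y := by rw [hY]; ring
  rw [hfin]
  have hY0 : 0 ≤ Y := by positivity
  -- The four comparisons cost 104, 20, 20 and 4 units of Y, in total 148.
  linarith

end OnlineControl

open OnlineControl
theorem corollary2 (c : ℝ) (hc : 1 ≤ c) :
    ∃ (C : ℝ) (p : ℕ), ∀ (dx du : ℕ)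
      (A : Matrix (Fin dx) (Fin dx) ℝ) (B : Matrix (Fin dx) (Fin du) ℝ)
      (K₀ : Matrix (Fin du) (Fin dx) ℝ) (κ γ κB W σ α β : ℝ)
      (Ω : Type*) [MeasurableSpace Ω] (P : Measure Ω) [IsProbabilityMeasure P]
      (w : ℕ → Ω → Vec dx) (D : Measure (Vec dx)) (T : ℕ) (r η : ℕ → ℝ)
      (M : ℕ → Policy (horizon κ γ T) dx du),
      1 ≤ κ → 0 < γ → γ < 1 → ‖B‖ ≤ κB → 2 ≤ κB * (1 - γ) →
      DiagStronglyStable A B κ γ K₀ →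
      0 < σ → NoiseLaw D W σ → (∀ t, HasLaw (w t) D P) → iIndepFun w P →
      0 < α → 2 ≤ T → (∀ t, 1 ≤ t → t ≤ T → r t ∈ Set.Icc α β) →
      (∀ t, 1 ≤ t → t < T → η t ∈ Set.Icc (1 / (α * t)) (c / (α * t))) →
      IsNaturalGradientRun A B K₀ κ κB γ D (sphericalCost r) η T M →
      ∃ m : ℝ,
        IsLeast ((fun K => expectedCost P A B w (sphericalCost r) T (linearCtrl K)) ''
          {K | DiagStronglyStable A B κ γ K}) m ∧
        expectedCost P A B w (sphericalCost r) T (policyCtrl K₀ M) - m ≤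
          C * ((max dx du : ℕ) * κ * κB * γ⁻¹) ^ p * (β ^ 2 * W ^ 2 / α) * Real.log T ^ 7 := by
  -- The factor 64 = 2⁶ trades log T for (log T)⁷, which may be smaller since only log T ≥ 1/2 is
  -- known.
  refine ⟨152 * c * 64, 24, ?_⟩
  intro dx du A B K₀ κ γ κB W σ α β Ω _ P _ w D T r η M hκ hγ hγ1 hB hκB hK₀ hσ hD hw hind hα hT
    hr hη hM
  have hDprob : IsProbabilityMeasure D := (hw 0).isProbabilityMeasure_iff.1 ‹_›
  have h : StableSystem A B K₀ κ γ κB := ⟨hκ, hγ, hγ1, hB, hκB, hK₀⟩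
  have hr' : ∀ t, 1 ≤ t → t ≤ T → r t ∈ Set.Icc 0 β := fun t h1 h2 =>
    ⟨hα.le.trans (hr t h1 h2).1, (hr t h1 h2).2⟩
  obtain ⟨K, hK, hleast⟩ := exists_isLeast_expectedCost h hD hw hr'
  refine ⟨_, hleast, ?_⟩
  have hT' : (2 : ℝ) ≤ T := by exact_mod_cast hT
  have hlog : 1 / 2 ≤ Real.log T := by
    have h1 := Real.log_le_log (by norm_num) hT'
    linarith [Real.log_two_gt_d9]
  have hκB0 : 0 ≤ κB := by linarith [h.two_le_bound]
  -- For dx = 0 the dimension factor may be 0 and cannot be bounded below by 1. The noise space is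
  -- then trivial, so W = 0 is admissible and the regret is at most 0.
  rcases Nat.eq_zero_or_pos dx with hdx | hdx
  · have hD0 : NoiseLaw D 0 σ := by
      refine ⟨Filter.Eventually.of_forall fun x => ?_, hD.centred, hD.covariance⟩
      subst hdx
      rw [Subsingleton.elim x 0, norm_zero]
    have h0 := regret_le hc h hD0 hσ hw hind hα hT hr hη hM hK
    refine h0.trans ?_
    rw [zero_pow two_ne_zero, mul_zero, zero_div, mul_zero, zero_mul]
    positivity
  · refine (regret_le hc h hD hσ hw hind hα hT hr hη hM hK).trans ?_
    have hd : (1 : ℝ) ≤ (max dx du : ℕ) := by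
      exact_mod_cast hdx.trans_le (le_max_left _ _)
    have hz := h.two_le_scale
    have hscale : scale κ γ κB ≤ (max dx du : ℕ) * κ * κB * γ⁻¹ := by
      have : ((max dx du : ℕ) : ℝ) * κ * κB * γ⁻¹ = (max dx du : ℕ) * scale κ γ κB := by
        unfold scale; ring
      rw [this]
      nlinarith
    have hpow : Real.log T ≤ 64 * Real.log T ^ 7 := by
      have h1 : (1 / 2 : ℝ) ^ 6 ≤ Real.log T ^ 6 := pow_le_pow_left₀ (by norm_num) hlog 6
      have h2 : 64 * Real.log T ^ 7 = (64 * Real.log T ^ 6) * Real.log T := by ring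
      rw [h2]
      norm_num at h1
      nlinarith
    calc 152 * c * scale κ γ κB ^ 24 * (β ^ 2 * W ^ 2 / α) * Real.log T
        ≤ 152 * c * ((max dx du : ℕ) * κ * κB * γ⁻¹) ^ 24 * (β ^ 2 * W ^ 2 / α)
          * (64 * Real.log T ^ 7) := by gcongr
      _ = _ := by ring
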